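/- Let $N=\mathbf Z^d$ with dual lattice $M=\mathbf Z^d$, and let $\rho\subset N_{\mathbf R}$ be a rational strictly convex polyhedral cone of dimension $d$, with dual cone $\rho^\vee\subset M_{\mathbf R}$; write $u\le_\rho u'$ if $u'-u\in\rho^\vee$. For a lattice $L\subset M_{\mathbf Q}$ let $\mathbf C\{\rho^\vee\cap L\}$ be the ring of convergent power series $\sum c_uX^u$ with exponents $u\in\rho^\vee\cap L$. A polynomial in $\mathbf C\{\rho^\vee\cap M\}[Y]$ with invertible leading coefficient is quasi-ordinary if its discriminant is of the form $X^\delta H$ with $\delta\in\rho^\vee\cap M$, $H\in\mathbf C\{\rho^\vee\cap M\}$ and $H$ has non-zero constant term. Let $f\in\mathbf C\{\rho^\vee\cap M\}[Y]$ be a monic irreducible quasi-ordinary polynomial of degree $n$ whose non-leading coefficients have zero constant terms, let $\zeta\in\mathbf C\{\rho^\vee\cap\frac1nM\}$ be a root of $f$, and let $R=\mathbf C\{\rho^\vee\cap M\}[\zeta]$. Let $\lambda_1<_\rho\dots<_\rho\lambda_g$, with $g\ge1$, be the characteristic exponents of $f$, i.e. the exponents $\lambda$ such that the difference of two distinct roots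 of $f$ has the form $X^{\lambda}\cdot\text{unit}$. Put $M_0=M$, $M_i=M_{i-1}+\mathbf Z\lambda_i$, $n_0=1$, $n_i=\#(M_i/M_{i-1})$, $\gamma_1=\lambda_1$, $\gamma_{j+1}=n_j\gamma_j+\lambda_{j+1}-\lambda_j$, and $\Gamma=\rho^\vee\cap M+\mathbf Z_{\ge0}\gamma_1+\dots+\mathbf Z_{\ge0}\gamma_g$. For $j=0,\dots,g-1$ let $q_j$ be a $j$-th semi-root of $f$, i.e. an irreducible quasi-ordinary polynomial of degree $n_0n_1\cdots n_j$ such that $fq_j$ is quasi-ordinary and $\lambda_{j+1}$ is the largest exponent $\lambda$ for which the difference of a root of $f$ and a root of $q_j$ is of the form $X^\lambda\cdot\text{unit}$; assume that $q_j$ is normalized so that the coefficient of $X^{\gamma_{j+1}}$ in $q_j(\zeta)$ is $1$. Let $\Psi_0:\mathbf C\{\rho^\vee\cap M\}[U_1,\dots,U_g]\to R$ be the homomorphism of $\mathbf C\{\rho^\vee\cap M\}$-algebras with $U_j\mapsto q_{j-1}(\zeta)$. Let $\eta$ be in the interior of $\rho$. For $j\in\eta(\rho^\vee\cap M_g)$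 filter $\mathbf C\{\rho^\vee\cap M_g\}$ by the ideals of series all of whose exponents $u$ satisfy $\langle\eta,u\rangle\ge j$, give $R$ the induced filtration, and filter $\mathbf C\{\rho^\vee\cap M\}[U_1,\dots,U_g]$ by the ideals of elements all of whose terms $X^\alpha U^v$ satisfy $\langle\eta,\alpha+\sum v_i\gamma_i\rangle\ge j$. Then $R\subset\mathbf C\{\rho^\vee\cap M_g\}$, $\Gamma\subset\rho^\vee\cap M_g$, the homomorphisms $$\mathbf C\{\rho^\vee\cap M\}[U_1,\dots,U_g]\xrightarrow{\ \Psi_0\ }R\hookrightarrow\mathbf C\{\rho^\vee\cap M_g\}$$ are filtered, and the associated sequence of homomorphisms of graded $\mathbf C$-algebras is isomorphic, as a sequence of graded $\mathbf C$-algebras, to $$\mathbf C[\rho^\vee\cap M][U_1,\dots,U_g]\longrightarrow\mathbf C[\Gamma]\hookrightarrow\mathbf C[\rho^\vee\cap M_g],$$ where the first homomorphism maps $X^\alpha U^v\mapsto X^{\alpha+\sum v_i\gamma_i}$, the second is the inclusion, and the gradings are defined by $\eta$: $\deg X^u=\langle\eta,u\rangle$ and $\deg X^\alpha U^v=\langle\eta,\alpha+\sum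 v_i\gamma_i\rangle$. If moreover $\eta$ is irrational (its coordinates are linearly independent over $\mathbf Q$), then $\Gamma$ is determined by the grading: $u\mapsto\langle\eta,u\rangle$ is injective on $\rho^\vee\cap M_g$, each homogeneous component of $\operatorname{gr}\mathbf C\{\rho^\vee\cap M_g\}$, of degree in $\eta(\rho^\vee\cap M_g)$, has dimension one, each homogeneous component of $\operatorname{gr}R$ has dimension zero or one, an element $u\in\rho^\vee\cap M_g$ lies in $\Gamma$ if and only if the component of $\operatorname{gr}R$ of degree $\langle\eta,u\rangle$ is non-zero, and $\eta$ induces an isomorphism of $\Gamma$ onto the semigroup of the degrees of the non-zero components of $\operatorname{gr}R$. -/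

import Mathlib

open scoped DirectSum

noncomputable section

namespace ToricQO

/-! ### Filtered algebras and their associated graded algebras -/

section Filtration


/-- A decreasing multiplicative filtration of a commutative `ℂ`-algebra `B`, indexed by an ordered
commutative monoid `ι`. -/
structure Filt (ι : Type) [AddCommMonoid ι] [PartialOrder ι] (B : Type) [CommRing B]
    [Algebra ℂ B] where
  /-- the terms of the filtration -/
  F : ι → Submodule ℂ B
  anti : Antitone F
  one_mem : (1 : B) ∈ F 0
  mul_mem : ∀ {i j : ι} {x y : B}, x ∈ F i → y ∈ F j → x * y ∈ F (i + j)

variable {ι : Type} [AddCommMonoid ι] [PartialOrder ι] [IsOrderedCancelAddMonoid ι]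
  {B : Type} [CommRing B] [Algebra ℂ B] {B' : Type} [CommRing B'] [Algebra ℂ B']

namespace Filt

/-- The filtration induced by an algebra homomorphism (for an injective one: by a subalgebra). -/
def comap (F : Filt ι B') (φ : B →ₐ[ℂ] B') : Filt ι B where
  F i := (F.F i).comap φ.toLinearMap
  anti _ _ h := Submodule.comap_mono (F.anti h)
  one_mem := by simpa using F.one_mem
  mul_mem hx hy := by simpa using F.mul_mem hx hy

/-- The union (sum) of the terms of the filtration of index strictly larger than `i`; when `i` has
an immediate successor `i⁺` this is the term of index `i⁺`. -/
def above (F : Filt ι B) (i : ι) : Submodule ℂ B := ⨆ (j : ι) (_ : i < j), F.F j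

theorem mul_above (F : Filt ι B) {i j : ι} {x y : B} (hx : x ∈ F.F i) (hy : y ∈ F.above j) :
    x * y ∈ F.above (i + j) := by
  have : F.above j ≤ (F.above (i + j)).comap (LinearMap.mulLeft ℂ x) := by
    refine iSup₂_le fun k hk z hz => ?_
    exact (le_iSup₂_of_le (f := fun (l : ι) (_ : i + j < l) => F.F l) (i + k)
      (by gcongr) le_rfl) (F.mul_mem hx hz)
  exact this hy

/-- The homogeneous component of degree `i` of the associated graded algebra. -/
def Piece (F : Filt ι B) (i : ι) : Type := F.F i ⧸ (F.above i).comap (F.F i).subtype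

instance (F : Filt ι B) (i : ι) : AddCommGroup (F.Piece i) :=
  inferInstanceAs (AddCommGroup (F.F i ⧸ (F.above i).comap (F.F i).subtype))

instance (F : Filt ι B) (i : ι) : Module ℂ (F.Piece i) :=
  inferInstanceAs (Module ℂ (F.F i ⧸ (F.above i).comap (F.F i).subtype))

/-- The class in degree `i` of an element of the `i`-th term of the filtration. -/
def cls (F : Filt ι B) (i : ι) : F.F i →ₗ[ℂ] F.Piece i :=
  ((F.above i).comap (F.F i).subtype).mkQ

theorem cls_surjective (F : Filt ι B) (i : ι) : Function.Surjective (F.cls i) :=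
  Submodule.mkQ_surjective _

theorem cls_eq_zero (F : Filt ι B) {i : ι} {x : F.F i} : F.cls i x = 0 ↔ (x : B) ∈ F.above i :=
  Submodule.Quotient.mk_eq_zero _

/-- Multiplication of representatives, as a bilinear map. -/
def preMul (F : Filt ι B) (i j : ι) : F.F i →ₗ[ℂ] F.F j →ₗ[ℂ] F.F (i + j) :=
  LinearMap.mk₂ ℂ (fun x y => ⟨x.1 * y.1, F.mul_mem x.2 y.2⟩)
    (fun _ _ _ => Subtype.ext (add_mul _ _ _))
    (fun _ _ _ => Subtype.ext (smul_mul_assoc _ _ _))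
    (fun _ _ _ => Subtype.ext (mul_add _ _ _))
    (fun _ _ _ => Subtype.ext (mul_smul_comm _ _ _))

/-- Multiplication of homogeneous elements of the associated graded algebra. -/
def pieceMul (F : Filt ι B) (i j : ι) : F.Piece i →ₗ[ℂ] F.Piece j →ₗ[ℂ] F.Piece (i + j) :=
  Submodule.liftQ _
    (LinearMap.flip (Submodule.liftQ _ (LinearMap.flip ((F.preMul i j).compr₂ (F.cls (i + j))))
      (by
        intro y hy
        ext x
        exact F.cls_eq_zero.2 (F.mul_above x.2 hy))))
    (by
      intro x hx
      refine LinearMap.ext fun y => ?_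
      obtain ⟨y, rfl⟩ := F.cls_surjective j y
      refine F.cls_eq_zero.2 ?_
      have := F.mul_above y.2 hx
      rw [mul_comm, add_comm] at this
      exact this)

theorem pieceMul_cls (F : Filt ι B) {i j : ι} (x : F.F i) (y : F.F j) :
    F.pieceMul i j (F.cls i x) (F.cls j y) =
      F.cls (i + j) ⟨x.1 * y.1, F.mul_mem x.2 y.2⟩ := rfl

theorem mk_cls_eq (F : Filt ι B) {i j : ι} (h : i = j) {x : F.F i} {y : F.F j}
    (hxy : (x : B) = y) :
    GradedMonoid.mk (A := F.Piece) i (F.cls i x) = GradedMonoid.mk j (F.cls j y) := by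
  subst h
  obtain rfl : x = y := Subtype.ext hxy
  rfl

instance (F : Filt ι B) : GradedMonoid.GMul F.Piece := ⟨fun {i j} x y => F.pieceMul i j x y⟩

instance (F : Filt ι B) : GradedMonoid.GOne F.Piece := ⟨F.cls 0 ⟨1, F.one_mem⟩⟩

theorem mk_mul_cls (F : Filt ι B) {i j : ι} (x : F.F i) (y : F.F j) :
    GradedMonoid.mk (A := F.Piece) i (F.cls i x) * GradedMonoid.mk j (F.cls j y) =
      GradedMonoid.mk (i + j) (F.cls (i + j) ⟨x.1 * y.1, F.mul_mem x.2 y.2⟩) := rfl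

theorem one_mk (F : Filt ι B) :
    (1 : GradedMonoid F.Piece) = GradedMonoid.mk 0 (F.cls 0 ⟨1, F.one_mem⟩) := rfl

theorem exists_rep (F : Filt ι B) (a : GradedMonoid F.Piece) :
    ∃ (i : ι) (x : F.F i), a = GradedMonoid.mk i (F.cls i x) := by
  obtain ⟨i, a⟩ := a
  obtain ⟨x, rfl⟩ := F.cls_surjective i a
  exact ⟨i, x, rfl⟩

instance (F : Filt ι B) : DirectSum.GCommRing F.Piece where
  mul_zero {i j} a := map_zero (F.pieceMul i j a)
  zero_mul {i j} b := LinearMap.map_zero₂ (F.pieceMul i j) b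
  mul_add {i j} a b c := map_add (F.pieceMul i j a) b c
  add_mul {i j} a b c := LinearMap.map_add₂ (F.pieceMul i j) a b c
  one_mul a := by
    obtain ⟨i, x, rfl⟩ := F.exists_rep a
    rw [one_mk, mk_mul_cls]
    exact F.mk_cls_eq (zero_add _) (one_mul _)
  mul_one a := by
    obtain ⟨i, x, rfl⟩ := F.exists_rep a
    rw [one_mk, mk_mul_cls]
    exact F.mk_cls_eq (add_zero _) (mul_one _)
  mul_assoc a b c := by
    obtain ⟨i, x, rfl⟩ := F.exists_rep a
    obtain ⟨j, y, rfl⟩ := F.exists_rep b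
    obtain ⟨k, z, rfl⟩ := F.exists_rep c
    simp only [mk_mul_cls]
    exact F.mk_cls_eq (add_assoc _ _ _) (mul_assoc _ _ _)
  mul_comm a b := by
    obtain ⟨i, x, rfl⟩ := F.exists_rep a
    obtain ⟨j, y, rfl⟩ := F.exists_rep b
    simp only [mk_mul_cls]
    exact F.mk_cls_eq (add_comm _ _) (mul_comm _ _)
  natCast n := n • F.cls 0 ⟨1, F.one_mem⟩
  natCast_zero := zero_smul _ _
  natCast_succ n := succ_nsmul _ n
  intCast n := n • F.cls 0 ⟨1, F.one_mem⟩
  intCast_ofNat n := natCast_zsmul _ n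
  intCast_negSucc_ofNat n := negSucc_zsmul _ n

instance (F : Filt ι B) : DirectSum.GAlgebra ℂ F.Piece where
  toFun := ((LinearMap.toSpanSingleton ℂ (F.Piece 0) (F.cls 0 ⟨1, F.one_mem⟩)).toAddMonoidHom)
  map_one := one_smul ℂ (F.cls 0 ⟨1, F.one_mem⟩)
  map_mul r s := by
    change GradedMonoid.mk (A := F.Piece) 0 ((r * s) • F.cls 0 ⟨1, F.one_mem⟩) =
      GradedMonoid.mk 0 (r • F.cls 0 ⟨1, F.one_mem⟩) *
        GradedMonoid.mk 0 (s • F.cls 0 ⟨1, F.one_mem⟩)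
    rw [← map_smul, ← map_smul, ← map_smul, mk_mul_cls]
    exact F.mk_cls_eq (zero_add _).symm (by simp [smul_smul, mul_comm])
  commutes r a := by
    obtain ⟨i, x, rfl⟩ := F.exists_rep a
    change GradedMonoid.mk (A := F.Piece) 0 (r • F.cls 0 ⟨1, F.one_mem⟩) *
      GradedMonoid.mk i (F.cls i x) = GradedMonoid.mk i (F.cls i x) *
        GradedMonoid.mk 0 (r • F.cls 0 ⟨1, F.one_mem⟩)
    rw [← map_smul, mk_mul_cls, mk_mul_cls]
    exact F.mk_cls_eq (add_comm _ _) (mul_comm _ _)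
  smul_def r a := by
    obtain ⟨i, x, rfl⟩ := F.exists_rep a
    change GradedMonoid.mk (A := F.Piece) i (r • F.cls i x) =
      GradedMonoid.mk 0 (r • F.cls 0 ⟨1, F.one_mem⟩) * GradedMonoid.mk i (F.cls i x)
    rw [← map_smul, ← map_smul, mk_mul_cls]
    exact F.mk_cls_eq (zero_add _).symm (by simp)

/-- The associated graded algebra `⨁ i, F i / (⨆ j > i, F j)`. -/
abbrev Gr (F : Filt ι B) : Type := ⨁ i, F.Piece i

/-- An algebra homomorphism between filtered algebras is filtered if it respects the terms of the
filtrations. -/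
def IsFiltered (F : Filt ι B) (G : Filt ι B') (φ : B →ₐ[ℂ] B') : Prop :=
  ∀ i, ∀ x ∈ F.F i, φ x ∈ G.F i

/-- The homogeneous component of degree `i` of the map of graded algebras associated to a filtered
homomorphism. -/
def pieceMap (F : Filt ι B) (G : Filt ι B') (φ : B →ₐ[ℂ] B') (h : IsFiltered F G φ) (i : ι) :
    F.Piece i →ₗ[ℂ] G.Piece i :=
  Submodule.mapQ _ _ (φ.toLinearMap.restrict (h i)) (by
    intro x hx
    have : F.above i ≤ (G.above i).comap φ.toLinearMap :=
      iSup₂_le fun j hj z hz =>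
        (le_iSup₂_of_le (f := fun (l : ι) (_ : i < l) => G.F l) j hj le_rfl) (h j z hz)
    exact this hx)

/-- The homomorphism of associated graded algebras defined by a filtered homomorphism. -/
def grMap [DecidableEq ι] (F : Filt ι B) (G : Filt ι B') (φ : B →ₐ[ℂ] B')
    (h : IsFiltered F G φ) : F.Gr →ₐ[ℂ] G.Gr :=
  DirectSum.toAlgebra ℂ F.Piece
    (fun i => (DirectSum.lof ℂ ι G.Piece i).comp (pieceMap F G φ h i))
    (by
      change DirectSum.of G.Piece 0 (G.cls 0 ⟨φ 1, _⟩) = DirectSum.of G.Piece 0 (G.cls 0 ⟨1, _⟩)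
      congr 3
      exact map_one φ)
    (by
      intro i j x y
      obtain ⟨x, rfl⟩ := F.cls_surjective i x
      obtain ⟨y, rfl⟩ := F.cls_surjective j y
      change DirectSum.of G.Piece (i + j) (G.cls (i + j) ⟨φ (x.1 * y.1), _⟩) =
        DirectSum.of G.Piece i (G.cls i ⟨φ x.1, _⟩) * DirectSum.of G.Piece j (G.cls j ⟨φ y.1, _⟩)
      rw [DirectSum.of_mul_of]
      change _ = DirectSum.of G.Piece (i + j) (G.cls (i + j) ⟨φ x.1 * φ y.1, _⟩)
      congr 3
      exact map_mul φ _ _)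

/-- An algebra isomorphism from the associated graded algebra to an algebra `C` with homogeneous
components `𝒞 i` is graded if it maps each homogeneous component onto the one of the same degree. -/
def IsGradedEquiv [DecidableEq ι] (F : Filt ι B) {C : Type} [CommRing C] [Algebra ℂ C]
    (𝒞 : ι → Submodule ℂ C) (e : F.Gr ≃ₐ[ℂ] C) : Prop :=
  ∀ i, (LinearMap.range (DirectSum.lof ℂ ι F.Piece i)).map e.toLinearMap = 𝒞 i

end Filt

end Filtration

/-! ### Toric cones, exponents and convergent series -/

/-- A rational strictly convex polyhedral cone `ρ` of maximal dimension in `N_ℝ`, where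
`N = ℤ^d`. -/
structure ToricCone (d : ℕ) where
  /-- the cone `ρ ⊂ N_ℝ = ℝ^d` -/
  cone : PointedCone ℝ (Fin d → ℝ)
  /-- it is generated by finitely many vectors of `N = ℤ^d` -/
  rational : ∃ s : Finset (Fin d → ℤ),
    cone = PointedCone.hull ℝ ((fun (v : Fin d → ℤ) (i : Fin d) => (v i : ℝ)) '' (s : Set _))
  /-- it contains no line -/
  strictly_convex : cone.toConvexCone.Salient
  /-- it spans `N_ℝ` (equivalently, the dual cone `ρ^∨` is strictly convex) -/
  full_dim : Submodule.span ℝ (cone : Set (Fin d → ℝ)) = ⊤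

namespace ToricCone

variable {d : ℕ}

/-- The space `M_ℝ = ℝ^d` of exponents, where `M = ℤ^d` is the lattice dual to `N`; it is ordered
by `u ≤ u'` iff `u' - u ∈ ρ^∨`. -/
def Expo (_ρ : ToricCone d) : Type := Fin d → ℝ

variable (ρ : ToricCone d)

instance : AddCommGroup ρ.Expo := inferInstanceAs (AddCommGroup (Fin d → ℝ))

/-- The duality pairing `⟨w, u⟩` of `w ∈ N_ℝ` and `u ∈ M_ℝ`. -/
def pair (w : Fin d → ℝ) : ρ.Expo →+ ℝ where
  toFun u := ∑ i, w i * (show Fin d → ℝ from u) i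
  map_zero' := Finset.sum_eq_zero fun i _ => mul_zero (w i)
  map_add' u v := by
    rw [← Finset.sum_add_distrib]
    exact Finset.sum_congr rfl fun i _ => mul_add (w i) _ _

theorem pair_add_left (w w' : Fin d → ℝ) (u : ρ.Expo) :
    ρ.pair (w + w') u = ρ.pair w u + ρ.pair w' u := by
  change ∑ i, (w i + w' i) * (show Fin d → ℝ from u) i = _
  simp only [add_mul, Finset.sum_add_distrib]
  rfl

/-- The dual cone `ρ^∨ ⊂ M_ℝ`. -/
def dualCone : AddSubmonoid ρ.Expo where
  carrier := {u | ∀ w ∈ ρ.cone, 0 ≤ ρ.pair w u}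
  zero_mem' w _ := by simp
  add_mem' hu hv w hw := by rw [map_add]; exact add_nonneg (hu w hw) (hv w hw)

theorem eq_zero_of_pair {u : ρ.Expo} (h : ∀ w ∈ ρ.cone, ρ.pair w u = 0) : u = 0 := by
  have h2 : ∀ w : Fin d → ℝ, ρ.pair w u = 0 := by
    intro w
    have hw : w ∈ Submodule.span ℝ (ρ.cone : Set (Fin d → ℝ)) := by
      rw [ρ.full_dim]; trivial
    induction hw using Submodule.span_induction with
    | mem x hx => exact h x hx
    | zero =>
      change ∑ i, (0 : ℝ) * (show Fin d → ℝ from u) i = 0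
      simp
    | add x y _ _ hx hy => rw [pair_add_left, hx, hy, add_zero]
    | smul a x _ hx =>
      change ∑ i, (a * x i) * (show Fin d → ℝ from u) i = 0
      simp only [mul_assoc]
      rw [← Finset.mul_sum]
      exact mul_eq_zero_of_right a hx
  have h3 : ∑ i, (show Fin d → ℝ from u) i * (show Fin d → ℝ from u) i = 0 := h2 u
  funext i
  exact mul_self_eq_zero.1
    ((Finset.sum_eq_zero_iff_of_nonneg fun i _ => mul_self_nonneg _).1 h3 i (Finset.mem_univ i))

instance : PartialOrder ρ.Expo where
  le u u' := u' - u ∈ ρ.dualCone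
  le_refl u := by rw [sub_self]; exact zero_mem _
  le_trans u v w huv hvw := by
    have := add_mem hvw huv
    rwa [sub_add_sub_cancel] at this
  le_antisymm u v huv hvu := by
    refine (sub_eq_zero.1 (ρ.eq_zero_of_pair fun w hw => ?_)).symm
    refine le_antisymm ?_ (huv w hw)
    have := hvu w hw
    rw [← neg_sub, map_neg] at this
    linarith

theorem le_def {u v : ρ.Expo} : u ≤ v ↔ v - u ∈ ρ.dualCone := Iff.rfl

instance : IsOrderedAddMonoid ρ.Expo where
  add_le_add_left u v h w := by
    rw [le_def] at h ⊢
    rwa [add_sub_add_right_eq_sub]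

instance : AddCommMonoid ρ.Expo := AddCommGroup.toAddCommMonoid

instance : IsOrderedCancelAddMonoid ρ.Expo := IsOrderedAddMonoid.toIsOrderedCancelAddMonoid

/-- The lattice `M = ℤ^d`. -/
def M : AddSubgroup ρ.Expo :=
  AddMonoidHom.range (G := Fin d → ℤ) (N := ρ.Expo)
    { toFun := fun m => (fun i => (m i : ℝ) : Fin d → ℝ)
      map_zero' := funext fun _ => Int.cast_zero
      map_add' := fun m m' => funext fun i => Int.cast_add (m i) (m' i) }

/-- The lattice `(1/k) M`, for `k ≥ 1`. -/
def fracM (k : ℕ) : AddSubgroup ρ.Expo := ρ.M.comap (nsmulAddMonoidHom k)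

/-- The semigroup `ρ^∨ ∩ L` of a lattice `L`. -/
def semigroup (L : AddSubgroup ρ.Expo) : AddSubmonoid ρ.Expo := ρ.dualCone ⊓ L.toAddSubmonoid

/-- Series with exponents in `M_ℝ` whose supports are partially well ordered for `≤_ρ`. All formal
series with exponents in `ρ^∨ ∩ L`, for a lattice `L`, are of this kind. -/
abbrev Series : Type := HahnSeries ρ.Expo ℂ

/-- A series is absolutely convergent at some point of the torus with coordinates
`|X^u| = exp (-⟨ξ, u⟩)`, `ξ ∈ ρ`. -/
def IsConvergent (φ : ρ.Series) : Prop :=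
  ∃ ξ ∈ ρ.cone, Summable fun u : ρ.Expo => ‖φ.coeff u‖ * Real.exp (-ρ.pair ξ u)

theorem weaken {φ : ρ.Series} (hs : ∀ u ∈ φ.support, u ∈ ρ.dualCone) {ξ : Fin d → ℝ}
    (h : Summable fun u : ρ.Expo => ‖φ.coeff u‖ * Real.exp (-ρ.pair ξ u)) {ξ' : Fin d → ℝ}
    (hξ' : ξ' ∈ ρ.cone) :
    Summable fun u : ρ.Expo => ‖φ.coeff u‖ * Real.exp (-ρ.pair (ξ + ξ') u) := by
  refine h.of_nonneg_of_le (fun u => by positivity) fun u => ?_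
  by_cases hu : φ.coeff u = 0
  · simp [hu]
  · have := hs u hu ξ' hξ'
    gcongr
    rw [pair_add_left]
    linarith

theorem summable_mul {φ ψ : ρ.Series} {ξ : Fin d → ℝ}
    (h : Summable fun u : ρ.Expo => ‖φ.coeff u‖ * Real.exp (-ρ.pair ξ u))
    (h' : Summable fun u : ρ.Expo => ‖ψ.coeff u‖ * Real.exp (-ρ.pair ξ u)) :
    Summable fun u : ρ.Expo => ‖(φ * ψ).coeff u‖ * Real.exp (-ρ.pair ξ u) := by
  classical
  have hp := h.mul_of_nonneg h' (fun u => by positivity) (fun u => by positivity)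
  let e : ρ.Expo × ρ.Expo ≃ ρ.Expo × ρ.Expo :=
    { toFun := fun p => (p.2, p.1 - p.2)
      invFun := fun p => (p.1 + p.2, p.1)
      left_inv := fun p => by simp
      right_inv := fun p => by simp }
  have hq := (e.summable_iff).2 hp
  have hr := hq.prod
  refine hr.of_nonneg_of_le (fun u => by positivity) fun u => ?_
  have hf := hq.prod_factor u
  rw [HahnSeries.coeff_mul]
  calc ‖∑ ij ∈ Finset.antidiagonal φ.isPWO_support ψ.isPWO_support u,
          φ.coeff ij.1 * ψ.coeff ij.2‖ * Real.exp (-ρ.pair ξ u)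
      ≤ (∑ ij ∈ Finset.antidiagonal φ.isPWO_support ψ.isPWO_support u,
          ‖φ.coeff ij.1‖ * ‖ψ.coeff ij.2‖) * Real.exp (-ρ.pair ξ u) := by
        gcongr
        exact norm_sum_le_of_le _ fun ij _ => norm_mul_le _ _
    _ = ∑ ij ∈ Finset.antidiagonal φ.isPWO_support ψ.isPWO_support u,
          (fun v => ‖φ.coeff v‖ * Real.exp (-ρ.pair ξ v) *
            (‖ψ.coeff (u - v)‖ * Real.exp (-ρ.pair ξ (u - v)))) ij.1 := by
        rw [Finset.sum_mul]
        refine Finset.sum_congr rfl fun ij hij => ?_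
        obtain ⟨-, -, hij⟩ := Finset.mem_antidiagonal.1 hij
        subst hij
        simp only [add_sub_cancel_left, map_add, neg_add, Real.exp_add]
        ring
    _ = ∑ v ∈ (Finset.antidiagonal φ.isPWO_support ψ.isPWO_support u).image Prod.fst,
          ‖φ.coeff v‖ * Real.exp (-ρ.pair ξ v) *
            (‖ψ.coeff (u - v)‖ * Real.exp (-ρ.pair ξ (u - v))) := by
        rw [Finset.sum_image]
        intro a ha b hb hab
        have ha' := (Finset.mem_antidiagonal.1 ha).2.2
        have hb' := (Finset.mem_antidiagonal.1 hb).2.2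
        refine Prod.ext hab ?_
        rw [← hb', hab] at ha'
        exact add_left_cancel ha'
    _ ≤ _ := hf.sum_le_tsum _ fun v _ => by positivity

/-- The algebra `ℂ{ρ^∨ ∩ L}` of convergent series with exponents in `ρ^∨ ∩ L`: the analytic algebra
of the affine toric variety of the semigroup `ρ^∨ ∩ L` at its zero-dimensional orbit. -/
def conv (L : AddSubgroup ρ.Expo) : Subalgebra ℂ ρ.Series where
  carrier := {φ | (∀ u ∈ φ.support, u ∈ ρ.semigroup L) ∧ ρ.IsConvergent φ}
  mul_mem' := by
    rintro φ ψ ⟨h1, ξ, hξ, h2⟩ ⟨h1', ξ', hξ', h2'⟩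
    refine ⟨fun u hu => ?_, ξ + ξ', add_mem hξ hξ', ?_⟩
    · obtain ⟨a, ha, b, hb, rfl⟩ := HahnSeries.support_mul_subset hu
      exact add_mem (h1 a ha) (h1' b hb)
    · refine ρ.summable_mul (ρ.weaken (fun u hu => (h1 u hu).1) h2 hξ') ?_
      rw [add_comm ξ]
      exact ρ.weaken (fun u hu => (h1' u hu).1) h2' hξ
  add_mem' := by
    rintro φ ψ ⟨h1, ξ, hξ, h2⟩ ⟨h1', ξ', hξ', h2'⟩
    refine ⟨fun u hu => ?_, ξ + ξ', add_mem hξ hξ', ?_⟩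
    · rcases HahnSeries.support_add_subset _ _ hu with hu | hu
      exacts [h1 u hu, h1' u hu]
    · have a := ρ.weaken (fun u hu => (h1 u hu).1) h2 hξ'
      have b := ρ.weaken (fun u hu => (h1' u hu).1) h2' hξ
      rw [add_comm ξ'] at b
      refine (a.add b).of_nonneg_of_le (fun u => by positivity) fun u => ?_
      rw [← add_mul]
      gcongr
      exact norm_add_le _ _
  algebraMap_mem' r := by
    have hz : ∀ u : ρ.Expo, u ≠ 0 → (algebraMap ℂ ρ.Series r).coeff u = 0 := fun u hu => by
      rw [HahnSeries.algebraMap_apply]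
      exact HahnSeries.coeff_single_of_ne hu
    refine ⟨fun u hu => ?_, 0, zero_mem _, ?_⟩
    · have : u = 0 := by
        by_contra h
        exact hu (hz u h)
      rw [this]
      exact zero_mem _
    · refine summable_of_ne_finset_zero (s := {0}) fun u hu => ?_
      rw [hz u (by simpa using hu)]
      simp

instance (L : AddSubgroup ρ.Expo) : CommRing (ρ.conv L) := Subalgebra.toCommRing _

instance (L : AddSubgroup ρ.Expo) : Algebra ℂ (ρ.conv L) := Subalgebra.algebra _

instance (L : AddSubgroup ρ.Expo) : Algebra (ρ.conv L) ρ.Series := Subalgebra.toAlgebra _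

/-! ### Quasi-ordinary polynomials, characteristic exponents -/

/-- `φ = X^λ H` where `H` is a convergent series with (fractional) exponents in some `ρ^∨ ∩ (1/k)M`
and non-zero constant term. -/
def IsMonomialTimesUnit (φ : ρ.Series) (lam : ρ.Expo) : Prop :=
  ∃ k : ℕ, 0 < k ∧ ∃ H ∈ ρ.conv (ρ.fracM k), H.coeff 0 ≠ 0 ∧ φ = HahnSeries.single lam 1 * H

/-- The polynomial ring `ℂ{ρ^∨ ∩ M}[Y]`. -/
abbrev Poly : Type := Polynomial (ρ.conv ρ.M)

/-- Quasi-ordinary polynomials of `ℂ{ρ^∨ ∩ M}[Y]`: the leading coefficient is invertible and the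
discriminant is of the form `X^δ H` with `δ ∈ ρ^∨ ∩ M`, `H ∈ ℂ{ρ^∨ ∩ M}` and `H(o) ≠ 0`. -/
def IsQuasiOrdinary (f : ρ.Poly) : Prop :=
  IsUnit f.leadingCoeff ∧ ∃ δ ∈ ρ.semigroup ρ.M, ∃ H ∈ ρ.conv ρ.M, H.coeff 0 ≠ 0 ∧
    ((f.discr : ρ.conv ρ.M) : ρ.Series) = HahnSeries.single δ 1 * H

/-- `z` is a root of `f`, as a convergent fractional power series. -/
def IsBranchOf (f : ρ.Poly) (z : ρ.Series) : Prop :=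
  (∃ k : ℕ, 0 < k ∧ z ∈ ρ.conv (ρ.fracM k)) ∧ Polynomial.aeval z f = 0

/-- The set of characteristic exponents of `f`: those `λ` such that `z - z' = X^λ · unit` for two
different roots of `f`. -/
def charExponents (f : ρ.Poly) : Set ρ.Expo :=
  {lam | ∃ z z', z ≠ z' ∧ ρ.IsBranchOf f z ∧ ρ.IsBranchOf f z' ∧ ρ.IsMonomialTimesUnit (z - z') lam}

/-- `f` and `q` have order of coincidence `λ`: their product is quasi-ordinary and `λ` is the largest
of the exponents of the differences between a root of `f` and a root of `q`. -/
def HasOrderOfCoincidence (f q : ρ.Poly) (lam : ρ.Expo) : Prop :=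
  ρ.IsQuasiOrdinary (f * q) ∧
    IsGreatest {μ | ∃ z z', ρ.IsBranchOf f z ∧ ρ.IsBranchOf q z' ∧
      ρ.IsMonomialTimesUnit (z - z') μ} lam

/-- The filtration of the ring of series (indexed by a semigroup `S` of real numbers) defined by
`η`: the term of index `j` consists of the series all of whose exponents satisfy `⟨η, u⟩ ≥ j`. -/
def etaFilt (η : Fin d → ℝ) (S : AddSubmonoid ℝ) : Filt S ρ.Series where
  F j :=
    { carrier := {φ | ∀ u ∈ φ.support, (j : ℝ) ≤ ρ.pair η u}
      zero_mem' := fun u hu => absurd rfl hu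
      add_mem' := fun h h' u hu => (HahnSeries.support_add_subset _ _ hu).elim (h u) (h' u)
      smul_mem' := fun c φ h u hu => h u fun h0 => hu (by simp [h0]) }
  anti _ _ h _ hφ u hu := le_trans h (hφ u hu)
  one_mem u hu := by
    rw [HahnSeries.support_one] at hu
    rw [Set.mem_singleton_iff.1 hu]
    simp
  mul_mem hx hy u hu := by
    obtain ⟨a, ha, b, hb, rfl⟩ := HahnSeries.support_mul_subset hu
    rw [map_add]
    exact add_le_add (hx a ha) (hy b hb)

/-- The weighted filtration of `ℂ{ρ^∨ ∩ M}[U_1, …, U_g]` defined by `η`, where the weight of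
`X^α U^v` is `α + ∑ v_i γ_i`: the term of index `j` consists of the polynomials all of whose terms
have weights `w` with `⟨η, w⟩ ≥ j`. -/
def weightFilt {g : ℕ} (γ : Fin g → ρ.Expo) (η : Fin d → ℝ) (S : AddSubmonoid ℝ) :
    Filt S (MvPolynomial (Fin g) (ρ.conv ρ.M)) where
  F j :=
    { carrier := {P : MvPolynomial (Fin g) (ρ.conv ρ.M) | ∀ (v : Fin g →₀ ℕ),
        ∀ α ∈ ((P.coeff v : ρ.conv ρ.M) : ρ.Series).support, (j : ℝ) ≤ ρ.pair η (α + ∑ i, v i • γ i)}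
      zero_mem' := fun v u hu => absurd (by simp) hu
      add_mem' := fun {P Q} h h' v u hu =>
        (HahnSeries.support_add_subset ((P.coeff v : ρ.conv ρ.M) : ρ.Series)
          ((Q.coeff v : ρ.conv ρ.M) : ρ.Series) (by simpa using hu)).elim (h v u) (h' v u)
      smul_mem' := fun c P h v u hu => h v u fun h0 => hu (by simp [h0]) }
  anti _ _ h _ hP v u hu := le_trans h (hP v u hu)
  one_mem v u hu := by
    rw [MvPolynomial.coeff_one] at hu
    split_ifs at hu with h
    · subst h
      rw [OneMemClass.coe_one, HahnSeries.support_one] at hu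
      rw [Set.mem_singleton_iff.1 hu]
      simp
    · exact absurd (by simp) hu
  mul_mem := by
    intro i j P Q hP hQ v u hu
    rw [MvPolynomial.coeff_mul] at hu
    have : ∃ x ∈ Finset.HasAntidiagonal.antidiagonal v,
        (((P.coeff x.1 : ρ.conv ρ.M) : ρ.Series) *
          ((Q.coeff x.2 : ρ.conv ρ.M) : ρ.Series)).coeff u ≠ 0 := by
      by_contra hcon
      push Not at hcon
      refine hu ?_
      rw [AddSubmonoidClass.coe_finsetSum, HahnSeries.coeff_sum]
      exact Finset.sum_eq_zero hcon
    obtain ⟨x, hx, hxu⟩ := this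
    obtain ⟨a, ha, b, hb, rfl⟩ := HahnSeries.support_mul_subset hxu
    rw [← Finset.HasAntidiagonal.mem_antidiagonal.1 hx]
    have e : a + b + ∑ i, (x.1 + x.2) i • γ i =
        (a + ∑ i, x.1 i • γ i) + (b + ∑ i, x.2 i • γ i) := by
      simp only [Finsupp.add_apply, add_smul, Finset.sum_add_distrib]
      abel
    refine le_trans (add_le_add (hP _ a ha) (hQ _ b hb)) ?_
    rw [← map_add]
    exact le_of_eq (congrArg _ e.symm)

/-- The homogeneous components of `ℂ[Λ]` with respect to `η`: the component of degree `j` is spanned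
by the monomials `X^u`, `u ∈ Λ`, `⟨η, u⟩ = j`. -/
def etaGrade (η : Fin d → ℝ) (S : AddSubmonoid ℝ) (Λ : AddSubmonoid ρ.Expo) (j : S) :
    Submodule ℂ (AddMonoidAlgebra ℂ Λ) :=
  AddMonoidAlgebra.gradeBy ℂ (fun u : Λ => ρ.pair η u) (j : ℝ)

/-- The homogeneous components of `ℂ[ρ^∨ ∩ M][U_1, …, U_g]` with respect to `η`: the component of
degree `j` is spanned by the monomials `X^α U^v` with `⟨η, α + ∑ v_i γ_i⟩ = j`. -/
def weightGrade {g : ℕ} (γ : Fin g → ρ.Expo) (η : Fin d → ℝ) (S : AddSubmonoid ℝ) (j : S) :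
    Submodule ℂ (MvPolynomial (Fin g) (AddMonoidAlgebra ℂ (ρ.semigroup ρ.M))) :=
  Submodule.span ℂ
    {P | ∃ (α : ρ.semigroup ρ.M) (v : Fin g →₀ ℕ),
      ρ.pair η ((α : ρ.Expo) + ∑ i, v i • γ i) = (j : ℝ) ∧
        P = MvPolynomial.monomial v (AddMonoidAlgebra.single α 1)}

end ToricCone

/-! ### Toric quasi-ordinary branches, the semigroup `Γ`, semi-roots -/

/-- A toric quasi-ordinary branch `ζ` with `g ≥ 1` characteristic exponents. -/
structure Branch {d : ℕ} (ρ : ToricCone d) where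
  /-- the minimal polynomial -/
  f : ρ.Poly
  monic : f.Monic
  irreducible : Irreducible f
  quasiOrdinary : ρ.IsQuasiOrdinary f
  /-- `f(o, Y) = Y^n` -/
  special_fibre : ∀ k < f.natDegree, (f.coeff k : ρ.Series).coeff 0 = 0
  /-- the root `ζ ∈ ℂ{ρ^∨ ∩ (1/n)M}` of `f`, where `n = deg f` -/
  ζ : ρ.Series
  ζ_mem : ζ ∈ ρ.conv (ρ.fracM f.natDegree)
  root : Polynomial.aeval ζ f = 0
  /-- the number of characteristic exponents -/
  g : ℕ
  g_pos : 0 < g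
  /-- the characteristic exponents `λ_1 < … < λ_g` (here `lam i` is `λ_{i+1}`) -/
  lam : Fin g → ρ.Expo
  lam_strictMono : StrictMono lam
  range_lam : Set.range lam = ρ.charExponents f

namespace Branch

variable {d : ℕ} {ρ : ToricCone d} (Z : Branch ρ)

/-- The characteristic lattices `M_i = M + ℤ λ_1 + … + ℤ λ_i`. -/
def lattice (i : ℕ) : AddSubgroup ρ.Expo :=
  ρ.M ⊔ AddSubgroup.closure {u | ∃ k : Fin Z.g, (k : ℕ) < i ∧ u = Z.lam k}

/-- `charInt i` is the characteristic integer `n_{i+1} = # M_{i+1} / M_i`. -/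
def charInt (i : ℕ) : ℕ := (Z.lattice i).relIndex (Z.lattice (i + 1))

/-- `gammaAux i` is `γ_{i+1}`, where `γ_1 = λ_1` and `γ_{j+1} = n_j γ_j + λ_{j+1} - λ_j`. -/
def gammaAux : (i : ℕ) → i < Z.g → ρ.Expo
  | 0, h => Z.lam ⟨0, h⟩
  | i + 1, h => Z.charInt i • gammaAux i (Nat.lt_of_succ_lt h) + Z.lam ⟨i + 1, h⟩ -
      Z.lam ⟨i, Nat.lt_of_succ_lt h⟩

/-- The elements `γ_1, …, γ_g` (here `gamma i` is `γ_{i+1}`). -/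
def gamma (i : Fin Z.g) : ρ.Expo := Z.gammaAux i i.2

/-- The semigroup `Γ = ρ^∨ ∩ M + γ_1 ℤ_{≥0} + … + γ_g ℤ_{≥0}`. -/
def Gam : AddSubmonoid ρ.Expo :=
  ρ.semigroup ρ.M ⊔ AddSubmonoid.closure (Set.range Z.gamma)

/-- The semigroup `ρ^∨ ∩ M_g`. -/
abbrev bigSemigroup : AddSubmonoid ρ.Expo := ρ.semigroup (Z.lattice Z.g)

/-- The algebra `ℂ{ρ^∨ ∩ M_g}`. -/
abbrev bigRing : Subalgebra ℂ ρ.Series := ρ.conv (Z.lattice Z.g)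

/-- The analytic algebra `R = ℂ{ρ^∨ ∩ M}[ζ]`. -/
def R : Subalgebra ℂ ρ.Series :=
  (Algebra.adjoin (ρ.conv ρ.M) ({Z.ζ} : Set ρ.Series)).restrictScalars ℂ

instance : CommRing Z.R := Subalgebra.toCommRing _

instance : Algebra ℂ Z.R := Subalgebra.algebra _

/-- `q` is a `j`-th semi-root of `f`: an irreducible quasi-ordinary polynomial of degree
`n_0 n_1 ⋯ n_j` (with `n_0 = 1`) whose order of coincidence with `f` is `λ_{j+1}`. -/
def IsSemiRoot (j : Fin Z.g) (q : ρ.Poly) : Prop :=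
  Irreducible q ∧ ρ.IsQuasiOrdinary q ∧ q.natDegree = ∏ i ∈ Finset.range j, Z.charInt i ∧
    ρ.HasOrderOfCoincidence Z.f q (Z.lam j)

/-- The homomorphism `Ψ₀ : ℂ{ρ^∨ ∩ M}[U_1, …, U_g] → R` of `ℂ{ρ^∨ ∩ M}`-algebras,
`U_j ↦ q_{j-1}(ζ)`. -/
def Psi (q : Fin Z.g → ρ.Poly) : MvPolynomial (Fin Z.g) (ρ.conv ρ.M) →ₐ[ℂ] Z.R :=
  ((MvPolynomial.aeval (R := ρ.conv ρ.M) (S₁ := ρ.Series)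
    (fun j => Polynomial.aeval Z.ζ (q j))).restrictScalars ℂ).codRestrict Z.R (by
      intro P
      change MvPolynomial.aeval _ P ∈ Algebra.adjoin (ρ.conv ρ.M) ({Z.ζ} : Set ρ.Series)
      induction P using MvPolynomial.induction_on with
      | C a => rw [MvPolynomial.aeval_C]; exact Subalgebra.algebraMap_mem _ a
      | add P Q hP hQ => rw [map_add]; exact add_mem hP hQ
      | mul_X P i hP =>
        rw [map_mul, MvPolynomial.aeval_X]
        exact mul_mem hP (Polynomial.aeval_mem_adjoin_singleton _ _))

/-- The index set `η(ρ^∨ ∩ M_g)` of the filtrations defined by `η`. -/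
def degrees (η : Fin d → ℝ) : AddSubmonoid ℝ := Z.bigSemigroup.map (ρ.pair η)

/-- The map `ρ^∨ ∩ M_g → η(ρ^∨ ∩ M_g)`, `u ↦ ⟨η, u⟩`. -/
def deg (η : Fin d → ℝ) (u : Z.bigSemigroup) : Z.degrees η :=
  ⟨ρ.pair η u, u, u.2, rfl⟩

/-- The filtration of `ℂ{ρ^∨ ∩ M_g}` defined by `η`. -/
def filtBig (η : Fin d → ℝ) : Filt (Z.degrees η) Z.bigRing :=
  (ρ.etaFilt η (Z.degrees η)).comap Z.bigRing.val

/-- The filtration of `R` defined by `η`. -/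
def filtR (η : Fin d → ℝ) : Filt (Z.degrees η) Z.R :=
  (ρ.etaFilt η (Z.degrees η)).comap Z.R.val

/-- The weighted filtration of `ℂ{ρ^∨ ∩ M}[U_1, …, U_g]` defined by `η`. -/
def filtU (η : Fin d → ℝ) : Filt (Z.degrees η) (MvPolynomial (Fin Z.g) (ρ.conv ρ.M)) :=
  ρ.weightFilt Z.gamma η (Z.degrees η)

/-- The homomorphism `ℂ[ρ^∨ ∩ M][U_1, …, U_g] → ℂ[Γ]`, `X^α U^v ↦ X^{α + ∑ v_i γ_i}`. -/
def monomialMap :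
    MvPolynomial (Fin Z.g) (AddMonoidAlgebra ℂ (ρ.semigroup ρ.M)) →ₐ[ℂ] AddMonoidAlgebra ℂ Z.Gam :=
  MvPolynomial.aevalTower
    (AddMonoidAlgebra.mapDomainAlgHom ℂ ℂ
      (AddSubmonoid.inclusion (le_sup_left : ρ.semigroup ρ.M ≤ Z.Gam)))
    (fun i => AddMonoidAlgebra.single
      ⟨Z.gamma i, (le_sup_right : _ ≤ Z.Gam) (AddSubmonoid.subset_closure ⟨i, rfl⟩)⟩ 1)

end Branch

end ToricQO

end

/-!
The group `N` acts on series with fractional exponents by monodromy, `w` multiplying `X^u` by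
`e^{2πi⟨w, u⟩}`, and the roots of an irreducible polynomial form one orbit. Stabilizers and orbits
are governed by annihilators of the lattices `M_j`, whose indices are the products of the `n_i`;
counting the conjugates of `ζ` according to their order of contact with a root of `q_j` shows that
`q_j(ζ)` has least exponent `γ_{j+1}`. By Euclidean division by the semi-roots, each element of `R`
is a sum `∑ c_v ∏ q_{i-1}(ζ)^{v_i}` with `v_i < n_i`. The exponents `α + ∑ v_i γ_i` with `v_i < n_i`
are pairwise distinct, so no cancellation of initial forms can occur in such a sum: the initial
forms of the elements of `R` have all their exponents in `Γ`.
-/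

noncomputable section

open Function (Injective)
open Polynomial Real

namespace ToricQO

/-! ### Least exponents of Hahn series -/

theorem exists_mem_support_isMinOn {Γ Δ R : Type*} [PartialOrder Γ] [LinearOrder Δ] [Zero R]
    {κ : Γ → Δ} (hκ : Monotone κ) {x : HahnSeries Γ R} (hx : x ≠ 0) :
    ∃ a ∈ x.support, IsMinOn κ x.support a := by
  obtain ⟨a, ha, hmin⟩ := (x.isPWO_support.image_of_monotone hκ).exists_minimalFor κ _
    (HahnSeries.support_nonempty_iff.2 hx)
  exact ⟨a, ha, fun u hu => (le_total (κ a) (κ u)).elim id fun h => hmin hu h⟩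

section LeastExponent

variable {Γ Δ R : Type*} [AddCommMonoid Γ] [PartialOrder Γ] [IsOrderedCancelAddMonoid Γ]

section Mul

variable [AddCommMonoid Δ] [PartialOrder Δ] [IsOrderedCancelAddMonoid Δ]
  [NonUnitalNonAssocSemiring R] {x y : HahnSeries Γ R} {a b : Γ}

theorem coeff_mul_add_of_isMinOn {κ : Γ →+ Δ} (hκ : Injective κ) (ha : IsMinOn κ x.support a)
    (hb : IsMinOn κ y.support b) : (x * y).coeff (a + b) = x.coeff a * y.coeff b := by
  classical
  rw [HahnSeries.coeff_mul, Finset.sum_eq_single (a, b)]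
  · rintro ⟨u, v⟩ huv hne
    obtain ⟨hu, hv, hsum⟩ := Finset.mem_antidiagonal.1 huv
    have hκuv : κ a + κ b = κ u + κ v := by rw [← map_add, ← map_add, ← hsum]
    obtain ⟨hau, hbv⟩ := (add_eq_add_iff_eq_and_eq (ha hu) (hb hv)).1 hκuv
    exact absurd (Prod.ext (hκ hau).symm (hκ hbv).symm) hne
  · intro h
    by_contra h0
    exact h (Finset.mem_antidiagonal.2 ⟨left_ne_zero_of_mul h0, right_ne_zero_of_mul h0, rfl⟩)

theorem coeff_mul_add_of_mem_lowerBounds (ha : a ∈ lowerBounds x.support)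
    (hb : b ∈ lowerBounds y.support) : (x * y).coeff (a + b) = x.coeff a * y.coeff b :=
  coeff_mul_add_of_isMinOn (κ := AddMonoidHom.id Γ) Function.injective_id (fun _ h => ha h)
    fun _ h => hb h

theorem add_mem_lowerBounds_support_mul (ha : a ∈ lowerBounds x.support)
    (hb : b ∈ lowerBounds y.support) : a + b ∈ lowerBounds (x * y).support :=
  lowerBounds_mono_set HahnSeries.support_mul_subset (add_mem_lowerBounds_add ha hb)

theorem isLeast_support_mul [NoZeroDivisors R] (ha : IsLeast x.support a)
    (hb : IsLeast y.support b) : IsLeast (x * y).support (a + b) := by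
  refine ⟨?_, add_mem_lowerBounds_support_mul ha.2 hb.2⟩
  rw [HahnSeries.mem_support, coeff_mul_add_of_mem_lowerBounds ha.2 hb.2]
  exact mul_ne_zero ha.1 hb.1

end Mul

theorem noZeroDivisors_of_monotone_injective [AddCommMonoid Δ] [LinearOrder Δ]
    [IsOrderedCancelAddMonoid Δ] [NonUnitalNonAssocSemiring R] [NoZeroDivisors R] {κ : Γ →+ Δ}
    (hmono : Monotone κ) (hinj : Injective κ) : NoZeroDivisors (HahnSeries Γ R) where
  eq_zero_or_eq_zero_of_mul_eq_zero {x y} h := by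
    by_contra! hne
    obtain ⟨a, ha, hmina⟩ := exists_mem_support_isMinOn hmono hne.1
    obtain ⟨b, hb, hminb⟩ := exists_mem_support_isMinOn hmono hne.2
    have hcoeff := coeff_mul_add_of_isMinOn hinj hmina hminb
    rw [h, HahnSeries.coeff_zero] at hcoeff
    exact mul_ne_zero ha hb hcoeff.symm

theorem sum_mem_lowerBounds_support_prod [CommSemiring R] {ι : Type*} {s : Finset ι}
    {x : ι → HahnSeries Γ R} {a : ι → Γ} (h : ∀ i ∈ s, a i ∈ lowerBounds (x i).support) :
    ∑ i ∈ s, a i ∈ lowerBounds (∏ i ∈ s, x i).support := by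
  classical
  induction s using Finset.induction_on with
  | empty => exact fun u hu => (HahnSeries.support_single_subset hu).ge
  | insert i s hi ih =>
    rw [Finset.prod_insert hi, Finset.sum_insert hi]
    exact add_mem_lowerBounds_support_mul (h i (Finset.mem_insert_self i s))
      (ih fun k hk => h k (Finset.mem_insert_of_mem hk))

theorem coeff_prod_sum_of_mem_lowerBounds [CommSemiring R] {ι : Type*} {s : Finset ι}
    {x : ι → HahnSeries Γ R} {a : ι → Γ} (h : ∀ i ∈ s, a i ∈ lowerBounds (x i).support) :
    (∏ i ∈ s, x i).coeff (∑ i ∈ s, a i) = ∏ i ∈ s, (x i).coeff (a i) := by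
  classical
  induction s using Finset.induction_on with
  | empty => simp
  | insert i s hi ih =>
    have hs : ∀ k ∈ s, a k ∈ lowerBounds (x k).support := fun k hk =>
      h k (Finset.mem_insert_of_mem hk)
    rw [Finset.prod_insert hi, Finset.sum_insert hi, Finset.prod_insert hi,
      coeff_mul_add_of_mem_lowerBounds (h i (Finset.mem_insert_self i s))
        (sum_mem_lowerBounds_support_prod hs), ih hs]

theorem nsmul_mem_lowerBounds_support_pow [CommSemiring R] {x : HahnSeries Γ R} {a : Γ}
    (h : a ∈ lowerBounds x.support) (n : ℕ) : n • a ∈ lowerBounds (x ^ n).support := by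
  simpa only [Finset.sum_const, Finset.prod_const, Finset.card_range] using
    sum_mem_lowerBounds_support_prod (s := Finset.range n) fun _ _ => h

theorem coeff_pow_nsmul_of_mem_lowerBounds [CommSemiring R] {x : HahnSeries Γ R} {a : Γ}
    (h : a ∈ lowerBounds x.support) (n : ℕ) : (x ^ n).coeff (n • a) = x.coeff a ^ n := by
  simpa only [Finset.sum_const, Finset.prod_const, Finset.card_range] using
    coeff_prod_sum_of_mem_lowerBounds (s := Finset.range n) fun _ _ => h

theorem isLeast_support_prod [CommSemiring R] [NoZeroDivisors R] [Nontrivial R] {ι : Type*}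
    {s : Finset ι} {x : ι → HahnSeries Γ R} {a : ι → Γ}
    (h : ∀ i ∈ s, IsLeast (x i).support (a i)) :
    IsLeast (∏ i ∈ s, x i).support (∑ i ∈ s, a i) := by
  have hle : ∀ i ∈ s, a i ∈ lowerBounds (x i).support := fun i hi => (h i hi).2
  refine ⟨?_, sum_mem_lowerBounds_support_prod hle⟩
  rw [HahnSeries.mem_support, coeff_prod_sum_of_mem_lowerBounds hle]
  exact Finset.prod_ne_zero_iff.2 fun i hi => (h i hi).1

end LeastExponent

theorem isLeast_support_add_of_lt {Γ R : Type*} [PartialOrder Γ] [AddMonoid R]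
    {x y : HahnSeries Γ R} {a b : Γ} (ha : IsLeast x.support a) (hb : b ∈ lowerBounds y.support)
    (hab : a < b) : IsLeast (x + y).support a := by
  have hya : y.coeff a = 0 := by
    by_contra h
    exact (hb h).not_gt hab
  refine ⟨by simpa [hya] using ha.1, fun u hu => ?_⟩
  exact (HahnSeries.support_add_subset _ _ hu).elim (fun h => ha.2 h) fun h => hab.le.trans (hb h)

namespace ToricCone

variable {d : ℕ} (ρ : ToricCone d)

/-! ### Monomial orders refining `≤_ρ` -/

theorem pair_monotone {w : Fin d → ℝ} (hw : w ∈ ρ.cone) : Monotone (ρ.pair w) := fun u v huv => by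
  rw [← sub_nonneg, ← map_sub]
  exact huv w hw

theorem interior_cone_nonempty : (interior (ρ.cone : Set (Fin d → ℝ))).Nonempty := by
  have hconvex : Convex ℝ (ρ.cone : Set (Fin d → ℝ)) := ρ.cone.toConvexCone.convex
  rw [hconvex.interior_nonempty_iff_affineSpan_eq_top,
    AffineSubspace.affineSpan_eq_top_iff_vectorSpan_eq_top_of_nonempty _ _ _ ⟨0, ρ.cone.zero_mem⟩,
    vectorSpan_eq_span_vsub_set_right ℝ ρ.cone.zero_mem]
  simpa using ρ.full_dim

/-- The pairing with a nonzero `u ∈ ρ^∨` is an open map to `ℝ`, so it maps the interior of `ρ` into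
the interior of `[0, ∞)`. -/
theorem pair_pos_of_mem_interior {η : Fin d → ℝ} (hη : η ∈ interior (ρ.cone : Set (Fin d → ℝ)))
    {u : ρ.Expo} (hu : u ∈ ρ.dualCone) (hu0 : u ≠ 0) : 0 < ρ.pair η u := by
  let pairRight : (Fin d → ℝ) →ₗ[ℝ] ℝ := Fintype.linearCombination ℝ (show Fin d → ℝ from u)
  have hne : pairRight ≠ 0 := fun h => hu0 (ρ.eq_zero_of_pair fun w _ => LinearMap.congr_fun h w)
  have hopen : IsOpenMap pairRight :=
    pairRight.isOpenMap_of_finiteDimensional (LinearMap.surjective hne)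
  have hsub : pairRight '' interior (ρ.cone : Set (Fin d → ℝ)) ⊆ Set.Ici 0 := by
    rintro _ ⟨w, hw, rfl⟩
    exact hu w (interior_subset hw)
  have hpos := (hopen _ isOpen_interior).subset_interior_iff.2 hsub ⟨η, hη, rfl⟩
  rwa [interior_Ici] at hpos

/-- Exponents are compared by `w`, then by an interior point of `ρ`, which makes the comparison
strictly monotone, then lexicographically, which makes it total. -/
theorem exists_monomialOrder {w : Fin d → ℝ} (hw : w ∈ ρ.cone) :
    ∃ κ : ρ.Expo →+ ℝ ×ₗ (ℝ ×ₗ Lex (Fin d → ℝ)), Injective κ ∧ Monotone κ ∧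
      ∀ u v, κ u ≤ κ v → ρ.pair w u ≤ ρ.pair w v := by
  obtain ⟨η, hη⟩ := ρ.interior_cone_nonempty
  let κ : ρ.Expo →+ ℝ ×ₗ (ℝ ×ₗ Lex (Fin d → ℝ)) :=
    { toFun := fun u => toLex (ρ.pair w u, toLex (ρ.pair η u, toLex (show Fin d → ℝ from u)))
      map_zero' := by rw [map_zero, map_zero]; rfl
      map_add' := fun u v => by rw [map_add, map_add]; rfl }
  refine ⟨κ, fun u v h => congrArg (fun x => (ofLex (ofLex x).2).2) h, fun u v huv => ?_,
    fun u v h => ?_⟩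
  · obtain rfl | hne := eq_or_ne u v
    · exact le_rfl
    have hlt : ρ.pair η u < ρ.pair η v := by
      have := ρ.pair_pos_of_mem_interior hη huv (sub_ne_zero.2 hne.symm)
      rwa [map_sub, sub_pos] at this
    refine Prod.Lex.toLex_le_toLex.2 ((ρ.pair_monotone hw huv).lt_or_eq.imp_right fun h => ⟨h, ?_⟩)
    exact Prod.Lex.toLex_le_toLex.2 (Or.inl hlt)
  · exact (Prod.Lex.toLex_le_toLex.1 h).elim le_of_lt fun h => h.1.le

instance : NoZeroDivisors ρ.Series := by
  obtain ⟨κ, hinj, hmono, -⟩ := ρ.exists_monomialOrder ρ.cone.zero_mem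
  exact noZeroDivisors_of_monotone_injective hmono hinj

instance : IsDomain ρ.Series := NoZeroDivisors.to_isDomain _

instance (L : AddSubgroup ρ.Expo) : IsDomain (ρ.conv L) := Subalgebra.isDomain _

/-! ### Series with a least exponent -/

variable {ρ}

theorem exists_add_eq_of_isLeast_support_mul {φ ψ : ρ.Series} {c : ρ.Expo}
    (h : IsLeast (φ * ψ).support c) {w : Fin d → ℝ} (hw : w ∈ ρ.cone) :
    ∃ a ∈ φ.support, ∃ b ∈ ψ.support, a + b = c ∧
      IsMinOn (ρ.pair w) φ.support a ∧ IsMinOn (ρ.pair w) ψ.support b := by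
  have hne : φ * ψ ≠ 0 := HahnSeries.support_nonempty_iff.1 ⟨c, h.1⟩
  obtain ⟨κ, hinj, hmono, hpair⟩ := ρ.exists_monomialOrder hw
  obtain ⟨a, ha, hmina⟩ := exists_mem_support_isMinOn hmono (left_ne_zero_of_mul hne)
  obtain ⟨b, hb, hminb⟩ := exists_mem_support_isMinOn hmono (right_ne_zero_of_mul hne)
  refine ⟨a, ha, b, hb, hinj (le_antisymm ?_ (hmono (h.2 ?_))),
    fun u hu => hpair _ _ (hmina hu), fun u hu => hpair _ _ (hminb hu)⟩
  · obtain ⟨x, hx, y, hy, rfl⟩ := HahnSeries.support_mul_subset h.1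
    simp only [map_add]
    exact add_le_add (hmina hx) (hminb hy)
  · rw [HahnSeries.mem_support, coeff_mul_add_of_isMinOn hinj hmina hminb]
    exact mul_ne_zero ha hb

theorem exists_isLeast_support_of_mul {φ ψ : ρ.Series} {c : ρ.Expo}
    (h : IsLeast (φ * ψ).support c) : ∃ a, IsLeast φ.support a := by
  obtain ⟨a, ha, b, hb, hab, -, -⟩ := exists_add_eq_of_isLeast_support_mul h ρ.cone.zero_mem
  refine ⟨a, ha, fun u hu w hw => ?_⟩
  obtain ⟨a', -, b', -, hab', hmina, hminb⟩ := exists_add_eq_of_isLeast_support_mul h hw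
  have hua : ρ.pair w a' ≤ ρ.pair w u := hmina hu
  have hbb : ρ.pair w b' ≤ ρ.pair w b := hminb hb
  have hsum : ρ.pair w a + ρ.pair w b = ρ.pair w a' + ρ.pair w b' := by
    rw [← map_add, ← map_add, hab, hab']
  rw [map_sub]
  linarith

theorem IsMonomialTimesUnit.isLeast_support {φ : ρ.Series} {a : ρ.Expo}
    (h : ρ.IsMonomialTimesUnit φ a) : IsLeast φ.support a := by
  obtain ⟨k, -, H, hH, h0, rfl⟩ := h
  have hmonomial : IsLeast (HahnSeries.single a (1 : ℂ)).support a := by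
    rw [HahnSeries.support_single_of_ne one_ne_zero]
    exact isLeast_singleton
  have hunit : IsLeast H.support 0 := ⟨h0, fun u hu => by
    rw [le_def, sub_zero]
    exact (hH.1 u hu).1⟩
  simpa using isLeast_support_mul hmonomial hunit

theorem IsConvergent.single_mul {φ : ρ.Series} (h : ρ.IsConvergent φ) (a : ρ.Expo) :
    ρ.IsConvergent (HahnSeries.single a 1 * φ) := by
  obtain ⟨ξ, hξ, hs⟩ := h
  refine ⟨ξ, hξ, ((((Equiv.subRight a).summable_iff.2 hs).mul_right
    (Real.exp (-ρ.pair ξ a))).congr fun u => ?_)⟩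
  have hcoeff : (HahnSeries.single a 1 * φ).coeff u = φ.coeff (u - a) := by
    simpa using HahnSeries.coeff_single_mul_add (r := (1 : ℂ)) (x := φ) (a := u - a) (b := a)
  rw [hcoeff, Function.comp_apply, Equiv.subRight_apply, mul_assoc, ← Real.exp_add, ← neg_add,
    ← map_add, sub_add_cancel]

theorem isMonomialTimesUnit_of_isLeast_support {φ : ρ.Series} {a : ρ.Expo}
    (h : IsLeast φ.support a) {k : ℕ} (hk : 0 < k) (hφ : φ ∈ ρ.conv (ρ.fracM k)) :
    ρ.IsMonomialTimesUnit φ a := by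
  have hcoeff (u) : (HahnSeries.single (-a) (1 : ℂ) * φ).coeff u = φ.coeff (u + a) := by
    simpa using HahnSeries.coeff_single_mul_add (r := (1 : ℂ)) (x := φ) (a := u + a) (b := -a)
  refine ⟨k, hk, HahnSeries.single (-a) 1 * φ, ⟨fun u hu => ⟨?_, ?_⟩, hφ.2.single_mul _⟩, ?_, ?_⟩
  · rw [HahnSeries.mem_support, hcoeff] at hu
    simpa [le_def] using h.2 hu
  · rw [HahnSeries.mem_support, hcoeff] at hu
    simpa using (ρ.fracM k).sub_mem (hφ.1 _ hu).2 (hφ.1 _ h.1).2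
  · rw [hcoeff, zero_add]
    exact h.1
  · rw [← mul_assoc, HahnSeries.single_mul_single]
    simp

end ToricCone

/-! ### Monodromy and conjugates of fractional power series -/

section Twist

variable {Γ R : Type*} [AddCommGroup Γ] [PartialOrder Γ] [CommSemiring R]

/-- The series `∑ χ(u) c_u X^u`, for a series `∑ c_u X^u`. -/
def twistFun (χ : AddChar Γ R) (x : HahnSeries Γ R) : HahnSeries Γ R where
  coeff u := χ u * x.coeff u
  isPWO_support' := x.isPWO_support.mono fun _ hu => right_ne_zero_of_mul hu

theorem support_twistFun (χ : AddChar Γ R) (x : HahnSeries Γ R) :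
    (twistFun χ x).support = x.support := by
  ext u
  exact (χ.val_isUnit u).mul_right_eq_zero.not

variable [IsOrderedCancelAddMonoid Γ]

/-- The endomorphism `X^u ↦ χ(u) X^u` of the ring of Hahn series defined by a character `χ` of the
group of exponents. -/
def twist : AddChar Γ R →* (HahnSeries Γ R →+* HahnSeries Γ R) where
  toFun χ :=
    { toFun := twistFun χ
      map_zero' := HahnSeries.ext (funext fun u => mul_zero (χ u))
      map_add' := fun x y => HahnSeries.ext (funext fun u => mul_add (χ u) (x.coeff u) (y.coeff u))
      map_one' := by
        ext u
        change χ u * _ = _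
        by_cases hu : u = 0 <;> simp [HahnSeries.coeff_one, hu]
      map_mul' := fun x y => by
        ext u
        change χ u * _ = _
        rw [HahnSeries.coeff_mul, HahnSeries.coeff_mul, Finset.mul_sum]
        refine Finset.sum_congr (by ext; simp only [Finset.mem_antidiagonal, support_twistFun]) ?_
        intro v hv
        rw [← (Finset.mem_antidiagonal.1 hv).2.2, AddChar.map_add_eq_mul]
        exact mul_mul_mul_comm _ _ _ _ }
  map_one' := RingHom.ext fun x => HahnSeries.ext (funext fun u => one_mul (x.coeff u))
  map_mul' χ χ' :=
    RingHom.ext fun x => HahnSeries.ext (funext fun u => mul_assoc (χ u) (χ' u) (x.coeff u))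

theorem support_twist (χ : AddChar Γ R) (x : HahnSeries Γ R) :
    (twist χ x).support = x.support := support_twistFun χ x

end Twist

theorem map_prod_X_sub_C_of_bijOn {R : Type*} [CommRing R] {σ : R →+* R} {s : Finset R}
    (hσ : Set.BijOn σ s s) : (∏ y ∈ s, (X - C y)).map σ = ∏ y ∈ s, (X - C y) := by
  simp only [Polynomial.map_prod, Polynomial.map_sub, map_X, map_C]
  exact Finset.prod_nbij σ hσ.mapsTo hσ.injOn hσ.surjOn fun _ _ => rfl

theorem sub_dvd_algebraMap_leadingCoeff_mul_discr {A B : Type*} [CommRing A] [CommRing B]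
    [Algebra A B] {p : A[X]} (hp : 0 < p.natDegree) {z z' : B}
    (h : (X - C z) * (X - C z') ∣ p.map (algebraMap A B)) :
    z - z' ∣ algebraMap A B (p.leadingCoeff * p.discr) := by
  obtain ⟨r, hr⟩ := h
  have hroot : aeval z p = 0 := by
    rw [aeval_def, ← eval_map, hr]
    simp
  have hderiv : aeval z (derivative p) = (z - z') * r.eval z := by
    rw [aeval_def, ← eval_map, ← derivative_map, hr]
    simp [derivative_mul]
  obtain ⟨a, b, -, -, hab⟩ := exists_mul_add_mul_eq_C_resultant p (derivative p) le_rfl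
    (natDegree_derivative_le p) (by omega)
  rw [resultant_deriv (natDegree_pos_iff_degree_pos.1 hp)] at hab
  have hz := congrArg (aeval z) hab
  rw [map_add, map_mul, map_mul, hroot, hderiv, zero_mul, zero_add, aeval_C, mul_assoc, mul_assoc,
    map_mul] at hz
  have hsign : IsUnit (algebraMap A B ((-1) ^ (p.natDegree * (p.natDegree - 1) / 2))) :=
    (isUnit_one.neg.pow _).map _
  exact hsign.dvd_mul_left.1 ⟨_, hz.symm⟩

namespace ToricCone

variable {d : ℕ} (ρ : ToricCone d)

/-- The characters `u ↦ e^{2πi⟨w, u⟩}` of `M_ℝ`, for `w ∈ N`, as a character of `N`. -/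
def monodromyChar : AddChar (Fin d → ℤ) (AddChar ρ.Expo ℂ) where
  toFun w := (Circle.coeHom.compAddChar fourierChar).compAddMonoidHom
    (ρ.pair fun i => (w i : ℝ))
  map_zero_eq_one' := DFunLike.ext _ _ fun u => by
    have h : ρ.pair (fun i => (((0 : Fin d → ℤ) i : ℤ) : ℝ)) u = 0 := by simp [pair]
    change Circle.coeHom (fourierChar _) = 1
    rw [h, AddChar.map_zero_eq_one, map_one]
  map_add_eq_mul' w w' := DFunLike.ext _ _ fun u => by
    have h : ρ.pair (fun i => (((w + w') i : ℤ) : ℝ)) u =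
        ρ.pair (fun i => (w i : ℝ)) u + ρ.pair (fun i => (w' i : ℝ)) u := by
      rw [← pair_add_left]
      simp [pair]
    change Circle.coeHom (fourierChar _) = _
    rw [h, AddChar.map_add_eq_mul, map_mul]
    rfl

theorem monodromyChar_apply (w : Fin d → ℤ) (u : ρ.Expo) :
    ρ.monodromyChar w u = fourierChar (ρ.pair (fun i => (w i : ℝ)) u) := rfl

theorem norm_monodromyChar (w : Fin d → ℤ) (u : ρ.Expo) : ‖ρ.monodromyChar w u‖ = 1 :=
  Circle.norm_coe _

theorem monodromyChar_eq_one_iff {w : Fin d → ℤ} {u : ρ.Expo} :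
    ρ.monodromyChar w u = 1 ↔ ∃ m : ℤ, ρ.pair (fun i => (w i : ℝ)) u = m := by
  rw [monodromyChar_apply, fourierChar_apply, Complex.exp_eq_one_iff]
  refine exists_congr fun m => ?_
  rw [show ((2 * π * ρ.pair (fun i => (w i : ℝ)) u : ℝ) : ℂ) * Complex.I =
    (ρ.pair (fun i => (w i : ℝ)) u : ℂ) * (2 * π * Complex.I) by push_cast; ring,
    mul_left_inj' Complex.two_pi_I_ne_zero]
  exact_mod_cast Iff.rfl

theorem mem_M_iff_forall_monodromyChar_eq_one {u : ρ.Expo} :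
    u ∈ ρ.M ↔ ∀ w, ρ.monodromyChar w u = 1 := by
  simp only [monodromyChar_eq_one_iff]
  constructor
  · rintro ⟨m, rfl⟩ w
    exact ⟨∑ i, w i * m i, by push_cast; rfl⟩
  · intro h
    choose m hm using fun i => h (Pi.single i 1)
    refine ⟨m, funext fun i => ?_⟩
    change ((m i : ℤ) : ℝ) = (show Fin d → ℝ from u) i
    rw [← hm i]
    simpa [pair, Pi.single_apply] using Finset.sum_ite_eq' Finset.univ i (show Fin d → ℝ from u)

/-- The monodromy `X^u ↦ e^{2πi⟨w, u⟩} X^u` along the loop `w ∈ N = π₁` of the torus; it fixes the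
series with exponents in `M`. -/
def monodromy (w : Fin d → ℤ) : ρ.Series →ₐ[ρ.conv ρ.M] ρ.Series where
  __ := twist (ρ.monodromyChar w)
  commutes' a := by
    ext u
    change ρ.monodromyChar w u * (a : ρ.Series).coeff u = (a : ρ.Series).coeff u
    by_cases hu : (a : ρ.Series).coeff u = 0
    · rw [hu, mul_zero]
    · rw [ρ.mem_M_iff_forall_monodromyChar_eq_one.1 (a.2.1 u hu).2 w, one_mul]

theorem coeff_monodromy (w : Fin d → ℤ) (φ : ρ.Series) (u : ρ.Expo) :
    (ρ.monodromy w φ).coeff u = ρ.monodromyChar w u * φ.coeff u := rfl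

theorem support_monodromy (w : Fin d → ℤ) (φ : ρ.Series) :
    (ρ.monodromy w φ).support = φ.support := support_twist _ φ

theorem monodromy_mem_conv {L : AddSubgroup ρ.Expo} (w : Fin d → ℤ) {φ : ρ.Series}
    (hφ : φ ∈ ρ.conv L) : ρ.monodromy w φ ∈ ρ.conv L := by
  obtain ⟨hsupp, ξ, hξ, hsum⟩ := hφ
  refine ⟨by rwa [support_monodromy], ξ, hξ, ?_⟩
  simpa only [coeff_monodromy, norm_mul, norm_monodromyChar, one_mul] using hsum

theorem mem_conv_M_of_forall_monodromy_eq {L : AddSubgroup ρ.Expo} {φ : ρ.Series}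
    (hφ : φ ∈ ρ.conv L) (h : ∀ w, ρ.monodromy w φ = φ) : φ ∈ ρ.conv ρ.M := by
  refine ⟨fun u hu => ⟨(hφ.1 u hu).1, ρ.mem_M_iff_forall_monodromyChar_eq_one.2 fun w => ?_⟩, hφ.2⟩
  have hcoeff := congrArg (fun ψ : ρ.Series => ψ.coeff u) (h w)
  exact mul_right_cancel₀ hu (by simpa [coeff_monodromy] using hcoeff)

instance : AddAction (Fin d → ℤ) ρ.Series where
  vadd w φ := ρ.monodromy w φ
  zero_vadd φ := by
    change twist (ρ.monodromyChar 0) φ = φ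
    rw [AddChar.map_zero_eq_one, map_one, RingHom.one_def, RingHom.id_apply]
  add_vadd w w' φ := by
    change twist (ρ.monodromyChar (w + w')) φ = _
    rw [AddChar.map_add_eq_mul, map_mul]
    rfl

theorem vadd_eq_monodromy (w : Fin d → ℤ) (φ : ρ.Series) : w +ᵥ φ = ρ.monodromy w φ := rfl

theorem algebraMap_conv_injective (L : AddSubgroup ρ.Expo) :
    Injective (algebraMap (ρ.conv L) ρ.Series) :=
  Subtype.val_injective

theorem aeval_vadd_eq_zero {p : ρ.Poly} {z : ρ.Series} (h : aeval z p = 0) (w : Fin d → ℤ) :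
    aeval (w +ᵥ z) p = 0 := by
  rw [vadd_eq_monodromy, aeval_algHom_apply, h, map_zero]

theorem finite_orbit {p : ρ.Poly} (hp : p ≠ 0) {z : ρ.Series} (h : aeval z p = 0) :
    (AddAction.orbit (Fin d → ℤ) z).Finite := by
  refine (p.rootSet_finite ρ.Series).subset ?_
  rintro _ ⟨w, rfl⟩
  exact mem_rootSet.2 ⟨hp, ρ.aeval_vadd_eq_zero h w⟩

theorem exists_map_eq_prod_orbit {L : AddSubgroup ρ.Expo} {z : ρ.Series} (hz : z ∈ ρ.conv L)
    (hfin : (AddAction.orbit (Fin d → ℤ) z).Finite) :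
    ∃ h : ρ.Poly, h.Monic ∧ h.map (algebraMap _ ρ.Series) = ∏ y ∈ hfin.toFinset, (X - C y) := by
  set P : ρ.Series[X] := ∏ y ∈ hfin.toFinset, (X - C y)
  have hliftsL : P ∈ lifts (algebraMap (ρ.conv L) ρ.Series) := by
    refine prod_mem fun y hy => ?_
    obtain ⟨w, rfl⟩ := hfin.mem_toFinset.1 hy
    refine (mem_lifts _).2 ⟨X - C ⟨_, ρ.monodromy_mem_conv w hz⟩, ?_⟩
    simp only [Polynomial.map_sub, map_X, map_C]
    rfl
  have hfixed (w : Fin d → ℤ) : P.map (ρ.monodromy w : ρ.Series →+* ρ.Series) = P := by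
    refine map_prod_X_sub_C_of_bijOn ?_
    rw [hfin.coe_toFinset]
    exact ⟨AddAction.mapsTo_vadd_orbit w z, (AddAction.injective w).injOn,
      fun y hy => ⟨-w +ᵥ y, AddAction.mapsTo_vadd_orbit (-w) z hy, vadd_neg_vadd w y⟩⟩
  have hlifts : P ∈ lifts (algebraMap (ρ.conv ρ.M) ρ.Series) := by
    rw [lifts_iff_coeff_lifts] at hliftsL ⊢
    intro n
    obtain ⟨c, hc⟩ := hliftsL n
    have hcoeff : P.coeff n ∈ ρ.conv L := hc ▸ c.2
    refine ⟨⟨_, ρ.mem_conv_M_of_forall_monodromy_eq hcoeff fun w => ?_⟩, rfl⟩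
    exact (coeff_map _ n).symm.trans (congrArg (fun Q : ρ.Series[X] => Q.coeff n) (hfixed w))
  obtain ⟨h, hmap, -, hmonic⟩ :=
    lifts_and_natDegree_eq_and_monic hlifts (monic_prod_of_monic _ _ fun y _ => monic_X_sub_C y)
  exact ⟨h, hmonic, hmap⟩

theorem map_eq_C_mul_prod_orbit {p : ρ.Poly} (hp : Irreducible p) {L : AddSubgroup ρ.Expo}
    {z : ρ.Series} (hz : z ∈ ρ.conv L) (hroot : aeval z p = 0)
    (hfin : (AddAction.orbit (Fin d → ℤ) z).Finite) :
    ∃ c : ρ.conv ρ.M, IsUnit c ∧ p.map (algebraMap _ ρ.Series) =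
      C (c : ρ.Series) * ∏ y ∈ hfin.toFinset, (X - C y) := by
  obtain ⟨h, hmonic, hmap⟩ := ρ.exists_map_eq_prod_orbit hz hfin
  have hinj := ρ.algebraMap_conv_injective ρ.M
  have hp0 : p.map (algebraMap (ρ.conv ρ.M) ρ.Series) ≠ 0 :=
    (Polynomial.map_ne_zero_iff hinj).2 hp.ne_zero
  have hdvd : h ∣ p := by
    rw [← map_dvd_map _ hinj hmonic, hmap]
    refine (Multiset.prod_X_sub_C_dvd_iff_le_roots hp0 hfin.toFinset.val).2 ?_
    refine (Multiset.le_iff_subset hfin.toFinset.nodup).2 fun y hy => ?_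
    obtain ⟨w, rfl⟩ := hfin.mem_toFinset.1 hy
    rw [mem_roots hp0, IsRoot, eval_map, ← aeval_def]
    exact ρ.aeval_vadd_eq_zero hroot w
  have hnu : ¬ IsUnit h := fun hu => by
    rw [hmonic.eq_one_of_isUnit hu, Polynomial.map_one] at hmap
    have hz' : z ∈ hfin.toFinset := hfin.mem_toFinset.2 (AddAction.mem_orbit_self z)
    have heval := congrArg (eval z) hmap
    rw [eval_one, eval_prod, Finset.prod_eq_zero hz' (by simp)] at heval
    exact one_ne_zero heval
  obtain ⟨k, rfl⟩ := hdvd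
  obtain ⟨c, hc, rfl⟩ := isUnit_iff.1 ((hp.isUnit_or_isUnit rfl).resolve_left hnu)
  refine ⟨c, hc, ?_⟩
  rw [mul_comm h, Polynomial.map_mul, hmap, map_C]
  rfl

variable {ρ}

theorem zero_mem_lowerBounds_support {L : AddSubgroup ρ.Expo} {φ : ρ.Series} (hφ : φ ∈ ρ.conv L) :
    0 ∈ lowerBounds φ.support := fun u hu => by
  rw [le_def, sub_zero]
  exact (hφ.1 u hu).1

theorem isLeast_support_zero_of_isUnit {L : AddSubgroup ρ.Expo} {c : ρ.conv L} (hc : IsUnit c) :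
    IsLeast (c : ρ.Series).support 0 := by
  obtain ⟨c', hc'⟩ := hc.exists_right_inv
  have hmul : (c : ρ.Series) * c' = 1 := congrArg Subtype.val hc'
  have hcoeff := coeff_mul_add_of_mem_lowerBounds (zero_mem_lowerBounds_support c.2)
    (zero_mem_lowerBounds_support c'.2)
  rw [hmul, add_zero, HahnSeries.coeff_one, if_pos rfl] at hcoeff
  exact ⟨left_ne_zero_of_mul (hcoeff ▸ one_ne_zero), zero_mem_lowerBounds_support c.2⟩

theorem M_le_fracM (k : ℕ) : ρ.M ≤ ρ.fracM k := fun _ hu => ρ.M.nsmul_mem hu k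

theorem conv_mono {L L' : AddSubgroup ρ.Expo} (h : L ≤ L') : ρ.conv L ≤ ρ.conv L' :=
  fun _ hφ => ⟨fun u hu => ⟨(hφ.1 u hu).1, h (hφ.1 u hu).2⟩, hφ.2⟩

theorem IsQuasiOrdinary.exists_isLeast_support_sub {p : ρ.Poly} (hp : ρ.IsQuasiOrdinary p)
    {z z' : ρ.Series} (h : (X - C z) * (X - C z') ∣ p.map (algebraMap _ ρ.Series)) :
    ∃ a, IsLeast (z - z').support a := by
  obtain ⟨hu, δ, -, H, hH, hH0, hdiscr⟩ := hp
  have hdiscr' : IsLeast (p.discr : ρ.Series).support δ :=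
    IsMonomialTimesUnit.isLeast_support
      ⟨1, one_pos, H, conv_mono (M_le_fracM 1) hH, hH0, hdiscr⟩
  have hroot : aeval z p = 0 := by
    rw [aeval_def, ← eval_map]
    exact eval_eq_zero_of_dvd_of_eval_eq_zero h (by simp)
  have hp0 : p ≠ 0 := leadingCoeff_ne_zero.1 hu.ne_zero
  have hdeg : 0 < p.natDegree := natDegree_pos_of_aeval_root hp0 hroot
    ((injective_iff_map_eq_zero _).1 (ρ.algebraMap_conv_injective ρ.M))
  obtain ⟨r, hr⟩ := sub_dvd_algebraMap_leadingCoeff_mul_discr hdeg h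
  have hleast : IsLeast ((z - z') * r).support (0 + δ) :=
    hr ▸ isLeast_support_mul (isLeast_support_zero_of_isUnit hu) hdiscr'
  exact exists_isLeast_support_of_mul hleast

end ToricCone

/-! ### Annihilators of lattices -/

theorem relIndex_sup_zmultiples {G : Type*} [AddCommGroup G] (H : AddSubgroup G) (a : G) :
    H.relIndex (H ⊔ AddSubgroup.zmultiples a) = addOrderOf (a : G ⧸ H) := by
  rw [AddSubgroup.relIndex_sup_left, ← Nat.card_zmultiples]
  conv_lhs => rw [← QuotientAddGroup.ker_mk' H]
  rw [AddSubgroup.relIndex_ker, AddMonoidHom.map_zmultiples]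
  rfl

namespace ToricCone

variable {d : ℕ} (ρ : ToricCone d)

/-- The exponents of the monomials which are invariant under the monodromy of `w`. -/
def invariantExpo (w : Fin d → ℤ) : AddSubgroup ρ.Expo :=
  (ρ.monodromyChar w).toAddMonoidHom.ker

theorem mem_invariantExpo {w : Fin d → ℤ} {u : ρ.Expo} :
    u ∈ ρ.invariantExpo w ↔ ρ.monodromyChar w u = 1 := Iff.rfl

/-- The eigenvalue of `X^u` under the monodromy of `w`, as a homomorphism in `w`. -/
def eigenvalueHom (u : ρ.Expo) : (Fin d → ℤ) →+ Additive ℂˣ :=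
  AddMonoidHom.mk' (fun w => Additive.ofMul ((ρ.monodromyChar w).val_isUnit u).unit) fun w w' =>
    congrArg Additive.ofMul (Units.ext (by simp [AddChar.map_add_eq_mul]))

theorem mem_ker_eigenvalueHom {w : Fin d → ℤ} {u : ρ.Expo} :
    w ∈ (ρ.eigenvalueHom u).ker ↔ ρ.monodromyChar w u = 1 :=
  Units.ext_iff

/-- The elements of `N` whose monodromy is trivial on the series with exponents in `L`. -/
def ann (L : AddSubgroup ρ.Expo) : AddSubgroup (Fin d → ℤ) :=
  ⨅ u : L, (ρ.eigenvalueHom u).ker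

variable {ρ}

theorem mem_ann {L : AddSubgroup ρ.Expo} {w : Fin d → ℤ} :
    w ∈ ρ.ann L ↔ L ≤ ρ.invariantExpo w := by
  simp only [ann, AddSubgroup.mem_iInf, mem_ker_eigenvalueHom, Subtype.forall, SetLike.le_def,
    mem_invariantExpo]

theorem ann_anti {L L' : AddSubgroup ρ.Expo} (h : L ≤ L') : ρ.ann L' ≤ ρ.ann L :=
  fun _ hw => mem_ann.2 (h.trans (mem_ann.1 hw))

theorem ann_M : ρ.ann ρ.M = ⊤ :=
  eq_top_iff.2 fun w _ => mem_ann.2 fun _ hu => ρ.mem_M_iff_forall_monodromyChar_eq_one.1 hu w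

theorem ann_sup_zmultiples (L : AddSubgroup ρ.Expo) (a : ρ.Expo) :
    ρ.ann (L ⊔ AddSubgroup.zmultiples a) = (ρ.eigenvalueHom a).ker ⊓ ρ.ann L := by
  ext w
  rw [AddSubgroup.mem_inf, mem_ann, mem_ann, sup_le_iff, and_comm, AddSubgroup.zmultiples_le,
    mem_invariantExpo, mem_ker_eigenvalueHom]

variable (ρ) in
/-- The exponent `m / k` of `(1/k)M`. -/
def fracPoint (k : ℕ) : (Fin d → ℤ) →+ ρ.Expo where
  toFun m := (fun i => (m i : ℝ) / k : Fin d → ℝ)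
  map_zero' := funext fun i => by
    change (((0 : Fin d → ℤ) i : ℤ) : ℝ) / k = 0
    simp
  map_add' m m' := funext fun i => by
    change ((m i + m' i : ℤ) : ℝ) / k = m i / k + m' i / k
    rw [Int.cast_add, add_div]

theorem mem_fracM_iff_mem_range_fracPoint {k : ℕ} (hk : 0 < k) {u : ρ.Expo} :
    u ∈ ρ.fracM k ↔ u ∈ (ρ.fracPoint k).range := by
  have hk0 : (k : ℝ) ≠ 0 := by positivity
  refine exists_congr fun m => (funext_iff.trans (forall_congr' fun i => ?_)).trans
    (funext_iff (f := ρ.fracPoint k m) (g := u)).symm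
  change (m i : ℝ) = (k • (show Fin d → ℝ from u)) i ↔ (m i : ℝ) / k = (show Fin d → ℝ from u) i
  rw [div_eq_iff hk0, Pi.smul_apply, nsmul_eq_mul, mul_comm]

theorem pair_fracPoint (w : Fin d → ℝ) (k : ℕ) (m : Fin d → ℤ) :
    ρ.pair w (ρ.fracPoint k m) = (∑ i, w i * m i) / k := by
  change ∑ i, w i * ((m i : ℝ) / k) = _
  rw [Finset.sum_div]
  exact Finset.sum_congr rfl fun i _ => (mul_div_assoc (w i) (m i : ℝ) (k : ℝ)).symm

/-- A character of `(1/k)M` trivial on `M` maps `e_i / k` to `w_i / k` modulo `ℤ` for some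
`w ∈ N`, hence is the monodromy of `w`. -/
theorem exists_forall_monodromyChar_eq_one_iff {k : ℕ} (hk : 0 < k)
    {ψ : ρ.Expo →+ AddCircle (1 : ℚ)} (hψ : ρ.M ≤ ψ.ker) :
    ∃ w, ∀ u ∈ ρ.fracM k, ρ.monodromyChar w u = 1 ↔ ψ u = 0 := by
  have hkq : (k : ℚ) ≠ 0 := by positivity
  have hbasis (i) : ∃ z : ℤ, ψ (ρ.fracPoint k (Pi.single i 1)) =
      ((z / k : ℚ) : AddCircle (1 : ℚ)) := by
    obtain ⟨x, hx⟩ := QuotientAddGroup.mk_surjective (ψ (ρ.fracPoint k (Pi.single i 1)))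
    have hkx : ((k • x : ℚ) : AddCircle (1 : ℚ)) = 0 := by
      change k • (QuotientAddGroup.mk x : AddCircle (1 : ℚ)) = 0
      rw [hx, ← map_nsmul]
      exact hψ ((mem_fracM_iff_mem_range_fracPoint hk).2 ⟨_, rfl⟩)
    obtain ⟨z, hz⟩ := (AddCircle.coe_eq_zero_iff 1).1 hkx
    refine ⟨z, hx.symm.trans (congrArg _ ((eq_div_iff hkq).2 ?_))⟩
    simpa [mul_comm] using hz.symm
  choose w hw using hbasis
  refine ⟨w, fun u hu => ?_⟩
  obtain ⟨m, rfl⟩ := (mem_fracM_iff_mem_range_fracPoint hk).1 hu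
  have hψm : ψ (ρ.fracPoint k m) = (((∑ i, w i * m i) / k : ℚ) : AddCircle (1 : ℚ)) := by
    conv_lhs => rw [pi_eq_sum_univ' m]
    rw [map_sum, map_sum]
    push_cast
    rw [Finset.sum_div]
    refine Eq.trans (Finset.sum_congr rfl fun i _ => ?_)
      (map_sum (QuotientAddGroup.mk' (AddSubgroup.zmultiples (1 : ℚ))) _ _).symm
    rw [map_zsmul, map_zsmul, hw i, ← AddCircle.coe_zsmul, zsmul_eq_mul, mul_div_left_comm,
      mul_div_assoc]
    rfl
  rw [hψm, AddCircle.coe_eq_zero_iff, monodromyChar_eq_one_iff, pair_fracPoint]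
  refine exists_congr fun z => ?_
  rw [zsmul_one, eq_comm]
  exact_mod_cast Iff.rfl

theorem exists_mem_ann_monodromyChar_ne_one {L : AddSubgroup ρ.Expo} {k : ℕ} (hk : 0 < k)
    (hM : ρ.M ≤ L) (hL : L ≤ ρ.fracM k) {u : ρ.Expo} (hu : u ∈ ρ.fracM k) (huL : u ∉ L) :
    ∃ w ∈ ρ.ann L, ρ.monodromyChar w u ≠ 1 := by
  obtain ⟨c, hc⟩ := CharacterModule.exists_character_apply_ne_zero_of_ne_zero
    ((QuotientAddGroup.eq_zero_iff u).not.2 huL)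
  let ψ : ρ.Expo →+ AddCircle (1 : ℚ) := AddMonoidHom.comp c (QuotientAddGroup.mk' L)
  have hψL : L ≤ ψ.ker := fun v hv =>
    (congrArg c ((QuotientAddGroup.eq_zero_iff v).2 hv)).trans (map_zero c)
  obtain ⟨w, hw⟩ := exists_forall_monodromyChar_eq_one_iff hk (hM.trans hψL)
  exact ⟨w, mem_ann.2 fun v hv => (hw v (hL hv)).2 (hψL hv), (hw u hu).not.2 hc⟩

/-- The eigenvalues of `X^a` under `ann L` are `n`-th roots of unity, where `n` is the order of `a`
modulo `L`; they are all of them because `L` is the annihilator of `ann L`. -/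
theorem relIndex_ann_sup_zmultiples {L : AddSubgroup ρ.Expo} {k : ℕ} (hk : 0 < k) (hM : ρ.M ≤ L)
    (hL : L ≤ ρ.fracM k) {a : ρ.Expo} (ha : a ∈ ρ.fracM k) :
    (ρ.ann (L ⊔ AddSubgroup.zmultiples a)).relIndex (ρ.ann L) =
      L.relIndex (L ⊔ AddSubgroup.zmultiples a) := by
  rw [relIndex_sup_zmultiples, ann_sup_zmultiples, AddSubgroup.inf_relIndex_right,
    AddSubgroup.relIndex_ker]
  set n := addOrderOf (a : ρ.Expo ⧸ L)
  have hna : n • a ∈ L :=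
    (QuotientAddGroup.eq_zero_iff (n • a)).1 (addOrderOf_nsmul_eq_zero (a : ρ.Expo ⧸ L))
  have hfin : IsOfFinAddOrder (a : ρ.Expo ⧸ L) :=
    isOfFinAddOrder_iff_nsmul_eq_zero.2 ⟨k, hk, (QuotientAddGroup.eq_zero_iff _).2 (hM ha)⟩
  have : NeZero n := ⟨hfin.addOrderOf_pos.ne'⟩
  refine Nat.dvd_antisymm ?_ (addOrderOf_dvd_of_nsmul_eq_zero ?_)
  · have hle : (ρ.ann L).map (ρ.eigenvalueHom a) ≤ (rootsOfUnity n ℂ).toAddSubgroup := by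
      rintro _ ⟨w, hw, rfl⟩
      refine (mem_rootsOfUnity n _).2 (Units.ext ?_)
      change ρ.monodromyChar w a ^ n = 1
      rw [← AddChar.map_nsmul_eq_pow]
      exact mem_ann.1 hw hna
    refine (AddSubgroup.card_dvd_of_le hle).trans (dvd_of_eq ?_)
    exact Complex.card_rootsOfUnity n
  · set S := (ρ.ann L).map (ρ.eigenvalueHom a)
    refine (QuotientAddGroup.eq_zero_iff (Nat.card S • a)).2 ?_
    by_contra hnot
    obtain ⟨w, hw, hne⟩ := exists_mem_ann_monodromyChar_ne_one hk hM hL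
      ((ρ.fracM k).nsmul_mem ha (Nat.card S)) hnot
    have hcard : Nat.card S • (⟨ρ.eigenvalueHom a w, w, hw, rfl⟩ : S) = 0 := card_nsmul_eq_zero'
    refine hne ?_
    rw [AddChar.map_nsmul_eq_pow]
    exact congrArg (fun x : S => (x.1.toMul : ℂ)) hcard

end ToricCone

/-! ### Conjugates of a branch and characteristic lattices -/

theorem X_sub_C_mul_X_sub_C_dvd {A : Type*} [CommRing A] [IsDomain A] {p : A[X]} {a b : A}
    (hab : a ≠ b) (ha : p.IsRoot a) (hb : p.IsRoot b) : (X - C a) * (X - C b) ∣ p := by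
  obtain ⟨r, rfl⟩ := dvd_iff_isRoot.2 ha
  refine mul_dvd_mul_left _ (dvd_iff_isRoot.2 ((root_mul.1 hb).resolve_left fun h => hab ?_))
  exact (root_X_sub_C.1 h)

namespace ToricCone

variable {d : ℕ} {ρ : ToricCone d}

theorem isRoot_map_of_aeval_eq_zero {p : ρ.Poly} {z : ρ.Series} (hz : aeval z p = 0) :
    (p.map (algebraMap _ ρ.Series)).IsRoot z := by
  rwa [IsRoot, eval_map_algebraMap]

theorem IsQuasiOrdinary.exists_isLeast_support_sub_of_ne {p : ρ.Poly} (hp : ρ.IsQuasiOrdinary p)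
    {z z' : ρ.Series} (hz : aeval z p = 0) (hz' : aeval z' p = 0) (hne : z ≠ z') :
    ∃ a, IsLeast (z - z').support a :=
  hp.exists_isLeast_support_sub <| X_sub_C_mul_X_sub_C_dvd hne
    (isRoot_map_of_aeval_eq_zero hz) (isRoot_map_of_aeval_eq_zero hz')

theorem IsQuasiOrdinary.exists_isLeast_support_sub_of_mul {p q : ρ.Poly}
    (hpq : ρ.IsQuasiOrdinary (p * q)) {z z' : ρ.Series} (hz : aeval z p = 0)
    (hz' : aeval z' q = 0) : ∃ a, IsLeast (z - z').support a := by
  refine hpq.exists_isLeast_support_sub ?_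
  rw [Polynomial.map_mul]
  exact mul_dvd_mul (dvd_iff_isRoot.2 (isRoot_map_of_aeval_eq_zero hz))
    (dvd_iff_isRoot.2 (isRoot_map_of_aeval_eq_zero hz'))

theorem mem_support_sub_vadd {w : Fin d → ℤ} {φ : ρ.Series} {u : ρ.Expo} :
    u ∈ (φ - (w +ᵥ φ)).support ↔ u ∈ φ.support ∧ ρ.monodromyChar w u ≠ 1 := by
  rw [HahnSeries.mem_support, HahnSeries.coeff_sub, vadd_eq_monodromy, coeff_monodromy,
    ← one_sub_mul, mul_ne_zero_iff, and_comm, HahnSeries.mem_support, sub_ne_zero,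
    ne_comm (a := (1 : ℂ))]

theorem vadd_sub (w : Fin d → ℤ) (φ ψ : ρ.Series) : w +ᵥ (φ - ψ) = (w +ᵥ φ) - (w +ᵥ ψ) :=
  map_sub (ρ.monodromy w) φ ψ

theorem mem_of_forall_monodromyChar_eq_one {k : ℕ} (hk : 0 < k) {L : AddSubgroup ρ.Expo}
    (hM : ρ.M ≤ L) (hL : L ≤ ρ.fracM k) {u : ρ.Expo} (hu : u ∈ ρ.fracM k)
    (h : ∀ w ∈ ρ.ann L, ρ.monodromyChar w u = 1) : u ∈ L := by
  by_contra huL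
  obtain ⟨w, hw, hne⟩ := exists_mem_ann_monodromyChar_ne_one hk hM hL hu huL
  exact hne (h w hw)

theorem fracM_le_fracM_mul (k l : ℕ) : ρ.fracM k ≤ ρ.fracM (k * l) := fun u hu => by
  change (k * l) • u ∈ ρ.M
  rw [mul_comm, mul_smul]
  exact ρ.M.nsmul_mem hu l

theorem IsBranchOf.vadd {p : ρ.Poly} {z : ρ.Series} (hz : ρ.IsBranchOf p z) (w : Fin d → ℤ) :
    ρ.IsBranchOf p (w +ᵥ z) := by
  obtain ⟨⟨k, hk, hzk⟩, h0⟩ := hz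
  exact ⟨⟨k, hk, ρ.monodromy_mem_conv w hzk⟩, ρ.aeval_vadd_eq_zero h0 w⟩

theorem IsBranchOf.isMonomialTimesUnit_sub {p q : ρ.Poly} {z z' : ρ.Series}
    (hz : ρ.IsBranchOf p z) (hz' : ρ.IsBranchOf q z') {a : ρ.Expo}
    (ha : IsLeast (z - z').support a) : ρ.IsMonomialTimesUnit (z - z') a := by
  obtain ⟨⟨k, hk, hzk⟩, -⟩ := hz
  obtain ⟨⟨l, hl, hzl⟩, -⟩ := hz'
  exact isMonomialTimesUnit_of_isLeast_support ha (mul_pos hk hl)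
    (sub_mem (conv_mono (fracM_le_fracM_mul k l) hzk)
      (conv_mono (mul_comm l k ▸ fracM_le_fracM_mul l k) hzl))

theorem exists_aeval_eq_mul_prod_orbit {p : ρ.Poly} (hp : Irreducible p) {z : ρ.Series}
    (hz : ρ.IsBranchOf p z) (hfin : (AddAction.orbit (Fin d → ℤ) z).Finite) (φ : ρ.Series) :
    ∃ c : ρ.conv ρ.M, IsUnit c ∧ aeval φ p = c * ∏ y ∈ hfin.toFinset, (φ - y) := by
  obtain ⟨⟨k, -, hzk⟩, h0⟩ := hz
  obtain ⟨c, hc, h⟩ := ρ.map_eq_C_mul_prod_orbit hp hzk h0 hfin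
  refine ⟨c, hc, ?_⟩
  simp only [← eval_map_algebraMap, h, eval_mul, eval_C, eval_prod, eval_sub, eval_X]

theorem IsBranchOf.mem_orbit {p : ρ.Poly} (hp : Irreducible p) {z z' : ρ.Series}
    (hz : ρ.IsBranchOf p z) (hz' : aeval z' p = 0) : z' ∈ AddAction.orbit (Fin d → ℤ) z := by
  have hfin := ρ.finite_orbit hp.ne_zero hz.2
  obtain ⟨c, hc, h⟩ := exists_aeval_eq_mul_prod_orbit hp hz hfin z'
  have hc0 : (c : ρ.Series) ≠ 0 := (hc.map (algebraMap _ ρ.Series)).ne_zero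
  obtain ⟨y, hy, hy0⟩ := Finset.prod_eq_zero_iff.1 ((mul_eq_zero.1 (h ▸ hz')).resolve_left hc0)
  exact sub_eq_zero.1 hy0 ▸ hfin.mem_toFinset.1 hy

theorem IsBranchOf.natDegree_eq_ncard_orbit {p : ρ.Poly} (hp : Irreducible p) {z : ρ.Series}
    (hz : ρ.IsBranchOf p z) : p.natDegree = (AddAction.orbit (Fin d → ℤ) z).ncard := by
  have hfin := ρ.finite_orbit hp.ne_zero hz.2
  obtain ⟨⟨k, -, hzk⟩, h0⟩ := hz
  obtain ⟨c, hc, h⟩ := ρ.map_eq_C_mul_prod_orbit hp hzk h0 hfin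
  have hc0 : (c : ρ.Series) ≠ 0 := (hc.map (algebraMap _ ρ.Series)).ne_zero
  rw [← natDegree_map_eq_of_injective (ρ.algebraMap_conv_injective ρ.M), h,
    natDegree_C_mul hc0, natDegree_finsetProd_X_sub_C_eq_card,
    Set.ncard_eq_toFinset_card _ hfin]

end ToricCone

namespace Branch

open ToricCone

variable {d : ℕ} {ρ : ToricCone d} (Z : Branch ρ)

theorem natDegree_pos : 0 < Z.f.natDegree :=
  Z.monic.natDegree_pos_of_not_isUnit Z.irreducible.not_isUnit

theorem isBranchOf_ζ : ρ.IsBranchOf Z.f Z.ζ := ⟨⟨_, Z.natDegree_pos, Z.ζ_mem⟩, Z.root⟩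

theorem exists_isLeast_support_sub_vadd {w : Fin d → ℤ} (hw : w +ᵥ Z.ζ ≠ Z.ζ) :
    ∃ i, IsLeast (Z.ζ - (w +ᵥ Z.ζ)).support (Z.lam i) := by
  have hroot := Z.isBranchOf_ζ.vadd w
  obtain ⟨a, ha⟩ := Z.quasiOrdinary.exists_isLeast_support_sub_of_ne Z.root hroot.2 hw.symm
  have hchar : a ∈ ρ.charExponents Z.f :=
    ⟨_, _, hw.symm, Z.isBranchOf_ζ, hroot, Z.isBranchOf_ζ.isMonomialTimesUnit_sub hroot ha⟩
  rw [← Z.range_lam] at hchar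
  obtain ⟨i, rfl⟩ := hchar
  exact ⟨i, ha⟩

theorem exists_vadd_isLeast_support_sub (i : Fin Z.g) :
    ∃ w : Fin d → ℤ, IsLeast (Z.ζ - (w +ᵥ Z.ζ)).support (Z.lam i) := by
  have hi : Z.lam i ∈ ρ.charExponents Z.f := Z.range_lam ▸ ⟨i, rfl⟩
  obtain ⟨z, z', -, hz, hz', h⟩ := hi
  obtain ⟨w, rfl⟩ := Z.isBranchOf_ζ.mem_orbit Z.irreducible hz.2
  obtain ⟨w', rfl⟩ := Z.isBranchOf_ζ.mem_orbit Z.irreducible hz'.2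
  refine ⟨-w + w', ?_⟩
  have hleast := h.isLeast_support
  rwa [← ρ.support_monodromy (-w), ← vadd_eq_monodromy, vadd_sub, neg_vadd_vadd,
    ← add_vadd] at hleast

theorem lam_mem_support (i : Fin Z.g) : Z.lam i ∈ Z.ζ.support := by
  obtain ⟨w, hw⟩ := Z.exists_vadd_isLeast_support_sub i
  exact (mem_support_sub_vadd.1 hw.1).1

theorem lam_mem_fracM (i : Fin Z.g) : Z.lam i ∈ ρ.fracM Z.f.natDegree :=
  (Z.ζ_mem.1 _ (Z.lam_mem_support i)).2

theorem M_le_lattice (i : ℕ) : ρ.M ≤ Z.lattice i := le_sup_left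

theorem lattice_le_iff {i : ℕ} {L : AddSubgroup ρ.Expo} :
    Z.lattice i ≤ L ↔ ρ.M ≤ L ∧ ∀ k : Fin Z.g, (k : ℕ) < i → Z.lam k ∈ L := by
  rw [lattice, sup_le_iff, AddSubgroup.closure_le]
  refine and_congr_right fun _ => ⟨fun h k hk => h ⟨k, hk, rfl⟩, ?_⟩
  rintro h _ ⟨k, hk, rfl⟩
  exact h k hk

theorem lattice_le_fracM (i : ℕ) : Z.lattice i ≤ ρ.fracM Z.f.natDegree :=
  Z.lattice_le_iff.2 ⟨M_le_fracM _, fun k _ => Z.lam_mem_fracM k⟩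

theorem lam_mem_lattice (k : Fin Z.g) {i : ℕ} (h : (k : ℕ) < i) : Z.lam k ∈ Z.lattice i :=
  (Z.lattice_le_iff.1 le_rfl).2 k h

theorem lattice_mono : Monotone Z.lattice := fun _ j h =>
  Z.lattice_le_iff.2 ⟨Z.M_le_lattice j, fun k hk => Z.lam_mem_lattice k (hk.trans_le h)⟩

theorem lattice_zero : Z.lattice 0 = ρ.M :=
  le_antisymm (Z.lattice_le_iff.2 ⟨le_rfl, fun _ hk => absurd hk (Nat.not_lt_zero _)⟩)
    (Z.M_le_lattice 0)

theorem lattice_succ (i : Fin Z.g) :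
    Z.lattice (i + 1) = Z.lattice i ⊔ AddSubgroup.zmultiples (Z.lam i) := by
  refine le_antisymm (Z.lattice_le_iff.2 ⟨le_sup_of_le_left (Z.M_le_lattice i), fun k hk => ?_⟩)
    (sup_le (Z.lattice_mono (Nat.le_succ _)) ?_)
  · rcases (Nat.lt_succ_iff.1 hk).lt_or_eq with hlt | heq
    · exact AddSubgroup.mem_sup_left (Z.lam_mem_lattice k hlt)
    · rw [Fin.ext heq]
      exact AddSubgroup.mem_sup_right (AddSubgroup.mem_zmultiples _)
  · exact AddSubgroup.zmultiples_le.2 (Z.lam_mem_lattice i (Nat.lt_succ_self _))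

/-- The annihilator of the `i`-th characteristic lattice: the elements of `N` whose monodromy is
trivial on the series with exponents in `M_i`. -/
def annLattice (i : ℕ) : AddSubgroup (Fin d → ℤ) := ρ.ann (Z.lattice i)

theorem annLattice_anti : Antitone Z.annLattice := fun _ _ h => ann_anti (Z.lattice_mono h)

theorem annLattice_zero : Z.annLattice 0 = ⊤ := by rw [annLattice, lattice_zero, ann_M]

theorem mem_annLattice {i : ℕ} {w : Fin d → ℤ} :
    w ∈ Z.annLattice i ↔ ∀ k : Fin Z.g, (k : ℕ) < i → ρ.monodromyChar w (Z.lam k) = 1 := by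
  rw [annLattice, mem_ann, lattice_le_iff]
  exact and_iff_right (mem_ann.1 (ann_M (ρ := ρ) ▸ AddSubgroup.mem_top w))

theorem mem_annLattice_succ {i : Fin Z.g} {w : Fin d → ℤ} (hw : w ∈ Z.annLattice i) :
    w ∈ Z.annLattice (i + 1) ↔ ρ.monodromyChar w (Z.lam i) = 1 := by
  rw [mem_annLattice] at hw ⊢
  refine ⟨fun h => h i (Nat.lt_succ_self _), fun h k hk => ?_⟩
  rcases (Nat.lt_succ_iff.1 hk).lt_or_eq with hlt | heq
  · exact hw k hlt
  · rwa [Fin.ext heq]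

theorem exists_isLeast_of_monodromyChar_ne_one {i : ℕ} {w : Fin d → ℤ} (hw : w ∈ Z.annLattice i)
    {u : ρ.Expo} (hu : u ∈ Z.ζ.support) (h : ρ.monodromyChar w u ≠ 1) :
    ∃ k : Fin Z.g, i ≤ k ∧ IsLeast (Z.ζ - (w +ᵥ Z.ζ)).support (Z.lam k) ∧ Z.lam k ≤ u := by
  have hmem := mem_support_sub_vadd.2 ⟨hu, h⟩
  have hne : w +ᵥ Z.ζ ≠ Z.ζ := fun heq => by
    rw [heq, sub_self] at hmem
    exact hmem rfl
  obtain ⟨k, hk⟩ := Z.exists_isLeast_support_sub_vadd hne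
  refine ⟨k, le_of_not_gt fun hlt => ?_, hk, hk.2 hmem⟩
  exact (mem_support_sub_vadd.1 hk.1).2 (Z.mem_annLattice.1 hw k hlt)

theorem support_ζ_subset_lattice {u : ρ.Expo} (hu : u ∈ Z.ζ.support) : u ∈ Z.lattice Z.g := by
  refine mem_of_forall_monodromyChar_eq_one Z.natDegree_pos (Z.M_le_lattice _)
    (Z.lattice_le_fracM _) (Z.ζ_mem.1 u hu).2 fun w hw => by_contra fun h => ?_
  obtain ⟨k, hk, -⟩ := Z.exists_isLeast_of_monodromyChar_ne_one hw hu h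
  exact absurd k.2 (not_lt.2 hk)

theorem ζ_mem_bigRing : Z.ζ ∈ Z.bigRing :=
  ⟨fun u hu => ⟨(Z.ζ_mem.1 u hu).1, Z.support_ζ_subset_lattice hu⟩, Z.ζ_mem.2⟩

theorem isLeast_support_sub_vadd {i : Fin Z.g} {w : Fin d → ℤ} (hw : w ∈ Z.annLattice i)
    (hw' : w ∉ Z.annLattice (i + 1)) : IsLeast (Z.ζ - (w +ᵥ Z.ζ)).support (Z.lam i) := by
  rw [Z.mem_annLattice_succ hw] at hw'
  obtain ⟨k, hik, hk, hle⟩ :=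
    Z.exists_isLeast_of_monodromyChar_ne_one hw (Z.lam_mem_support i) hw'
  rw [Z.lam_strictMono.le_iff_le] at hle
  rwa [le_antisymm hle hik] at hk

theorem lam_mem_lowerBounds_support_sub_vadd {i : Fin Z.g} {w : Fin d → ℤ}
    (hw : w ∈ Z.annLattice i) : Z.lam i ∈ lowerBounds (Z.ζ - (w +ᵥ Z.ζ)).support := by
  intro u hu
  obtain ⟨hu, h⟩ := mem_support_sub_vadd.1 hu
  obtain ⟨k, hik, -, hku⟩ := Z.exists_isLeast_of_monodromyChar_ne_one hw hu h
  exact (Z.lam_strictMono.monotone hik).trans hku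

theorem stabilizer_ζ : AddAction.stabilizer (Fin d → ℤ) Z.ζ = Z.annLattice Z.g := by
  ext w
  rw [AddAction.mem_stabilizer_iff]
  constructor
  · refine fun h => Z.mem_annLattice.2 fun k _ => by_contra fun hk => ?_
    have hmem := mem_support_sub_vadd.2 ⟨Z.lam_mem_support k, hk⟩
    rw [h, sub_self] at hmem
    exact hmem rfl
  · refine fun h => (sub_eq_zero.1 (HahnSeries.support_eq_empty_iff.1 ?_)).symm
    refine Set.eq_empty_of_forall_notMem fun u hu => ?_
    obtain ⟨hu, hne⟩ := mem_support_sub_vadd.1 hu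
    exact hne (mem_ann.1 h (Z.support_ζ_subset_lattice hu))

theorem relIndex_annLattice_succ {i : ℕ} (hi : i < Z.g) :
    (Z.annLattice (i + 1)).relIndex (Z.annLattice i) = Z.charInt i := by
  rw [annLattice, annLattice, charInt, Z.lattice_succ ⟨i, hi⟩]
  exact relIndex_ann_sup_zmultiples Z.natDegree_pos (Z.M_le_lattice i) (Z.lattice_le_fracM i)
    (Z.lam_mem_fracM _)

theorem relIndex_annLattice {i j : ℕ} (hij : i ≤ j) (hj : j ≤ Z.g) :
    (Z.annLattice j).relIndex (Z.annLattice i) = ∏ k ∈ Finset.Ico i j, Z.charInt k := by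
  induction j, hij using Nat.le_induction with
  | base => simp
  | succ j hij ih =>
    rw [Finset.prod_Ico_succ_top hij, ← ih (Nat.le_of_succ_le hj),
      ← Z.relIndex_annLattice_succ hj, mul_comm]
    exact (AddSubgroup.relIndex_mul_relIndex _ _ _ (Z.annLattice_anti (Nat.le_succ j))
      (Z.annLattice_anti hij)).symm

theorem index_annLattice {j : ℕ} (hj : j ≤ Z.g) :
    (Z.annLattice j).index = ∏ k ∈ Finset.range j, Z.charInt k := by
  rw [Finset.range_eq_Ico, ← Z.relIndex_annLattice (Nat.zero_le j) hj, annLattice_zero,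
    AddSubgroup.relIndex_top_right]

theorem natDegree_eq_prod_charInt : Z.f.natDegree = ∏ k ∈ Finset.range Z.g, Z.charInt k := by
  rw [Z.isBranchOf_ζ.natDegree_eq_ncard_orbit Z.irreducible, ← AddAction.index_stabilizer,
    stabilizer_ζ, Z.index_annLattice le_rfl]

theorem charInt_pos {i : ℕ} (hi : i < Z.g) : 0 < Z.charInt i := by
  have h := Z.natDegree_pos.ne'
  rw [natDegree_eq_prod_charInt, Finset.prod_ne_zero_iff] at h
  exact Nat.pos_of_ne_zero (h i (Finset.mem_range.2 hi))

end Branch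

/-! ### The least exponent of a semi-root along the branch -/

theorem vadd_mem_orbit_addSubgroup_iff {G α : Type*} [AddGroup G] [AddAction G α]
    {H : AddSubgroup G} {y : α} (h : AddAction.stabilizer G y ≤ H) {w : G} :
    w +ᵥ y ∈ AddAction.orbit H y ↔ w ∈ H := by
  refine ⟨?_, fun hw => ⟨⟨w, hw⟩, rfl⟩⟩
  rintro ⟨v, hv⟩
  have hst : -(v : G) + w ∈ AddAction.stabilizer G y := by
    rw [AddAction.mem_stabilizer_iff, add_vadd, neg_vadd_eq_iff]
    exact hv.symm
  simpa using add_mem v.2 (h hst)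

theorem ncard_orbit_addSubgroup {G α : Type*} [AddGroup G] [AddAction G α] (H : AddSubgroup G)
    (y : α) : (AddAction.orbit H y).ncard = (AddAction.stabilizer G y).relIndex H := by
  rw [← AddAction.index_stabilizer]
  rfl

namespace Branch

open ToricCone

variable {d : ℕ} {ρ : ToricCone d} (Z : Branch ρ)

/-- The characteristic exponents `λ_{i+1}` with natural number indices, extended by `0`. -/
def lamNat (i : ℕ) : ρ.Expo := if h : i < Z.g then Z.lam ⟨i, h⟩ else 0

theorem lamNat_eq (i : Fin Z.g) : Z.lamNat i = Z.lam i := dif_pos i.2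

theorem gammaAux_succ {j : ℕ} (hj : j + 1 < Z.g) :
    Z.gammaAux (j + 1) hj = Z.charInt j • Z.gammaAux j (Nat.lt_of_succ_lt hj) +
      (Z.lamNat (j + 1) - Z.lamNat j) := by
  rw [gammaAux, ← Z.lamNat_eq ⟨j + 1, hj⟩, ← Z.lamNat_eq ⟨j, _⟩, add_sub_assoc]

theorem gammaAux_eq_sum {j : ℕ} (hj : j < Z.g) : Z.gammaAux j hj =
    (∏ k ∈ Finset.range j, Z.charInt k) • Z.lamNat 0 + ∑ i ∈ Finset.range j,
      (∏ k ∈ Finset.Ico (i + 1) j, Z.charInt k) • (Z.lamNat (i + 1) - Z.lamNat i) := by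
  induction j with
  | zero => simp [gammaAux, lamNat, hj]
  | succ j ih =>
    rw [gammaAux_succ, ih, Finset.sum_range_succ, Finset.Ico_self, Finset.prod_empty, one_smul,
      smul_add, smul_smul, Finset.prod_range_succ, mul_comm (Z.charInt j), Finset.smul_sum,
      ← add_assoc]
    congr 2
    refine Finset.sum_congr rfl fun i hi => ?_
    rw [smul_smul, Finset.prod_Ico_succ_top (Finset.mem_range.1 hi), mul_comm]

theorem exists_mem_annLattice_notMem_succ (j : ℕ) (w : Fin d → ℤ) :
    ∃ l ≤ j, w ∈ Z.annLattice l ∧ (l < j → w ∉ Z.annLattice (l + 1)) := by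
  classical
  refine ⟨Nat.findGreatest (fun l => w ∈ Z.annLattice l) j, Nat.findGreatest_le _, ?_, ?_⟩
  · exact Nat.findGreatest_spec (P := fun l => w ∈ Z.annLattice l) (Nat.zero_le _)
      (Z.annLattice_zero.symm ▸ AddSubgroup.mem_top w)
  · exact fun hlt => Nat.findGreatest_is_greatest (Nat.lt_succ_self _) hlt

open Classical in
theorem lamNat_zero_add_sum_ite_mem_annLattice {j l : ℕ} (hlj : l ≤ j) {w : Fin d → ℤ}
    (hl : w ∈ Z.annLattice l) (hl' : l < j → w ∉ Z.annLattice (l + 1)) :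
    Z.lamNat 0 + ∑ i ∈ Finset.range j,
      (if w ∈ Z.annLattice (i + 1) then Z.lamNat (i + 1) - Z.lamNat i else 0) = Z.lamNat l := by
  rw [← Finset.sum_filter]
  have hfilter : {i ∈ Finset.range j | w ∈ Z.annLattice (i + 1)} = Finset.range l := by
    ext i
    rw [Finset.mem_filter, Finset.mem_range, Finset.mem_range]
    refine ⟨fun ⟨hij, hw⟩ => ?_, fun hil => ⟨hil.trans_le hlj, Z.annLattice_anti hil hl⟩⟩
    by_contra! hli
    exact hl' (hli.trans_lt hij) (Z.annLattice_anti (Nat.succ_le_succ hli) hw)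
  rw [hfilter, Finset.sum_range_sub, add_sub_cancel]

variable {Z}

theorem IsSemiRoot.exists_root {j : Fin Z.g} {q : ρ.Poly} (hq : Z.IsSemiRoot j q) :
    ∃ y, ρ.IsBranchOf q y ∧ IsLeast (Z.ζ - y).support (Z.lam j) := by
  obtain ⟨-, -, -, -, ⟨z, y, hz, hy, h⟩, -⟩ := hq
  obtain ⟨w, rfl⟩ := Z.isBranchOf_ζ.mem_orbit Z.irreducible hz.2
  refine ⟨-w +ᵥ y, hy.vadd _, ?_⟩
  have hleast := h.isLeast_support
  rwa [← ρ.support_monodromy (-w), ← vadd_eq_monodromy, vadd_sub, neg_vadd_vadd] at hleast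

theorem stabilizer_le_annLattice {j : Fin Z.g} {y : ρ.Series}
    (hζy : IsLeast (Z.ζ - y).support (Z.lam j)) :
    AddAction.stabilizer (Fin d → ℤ) y ≤ Z.annLattice j := by
  refine fun w hw => Z.mem_annLattice.2 fun i hi => ?_
  have hcoeff : (Z.ζ - y).coeff (Z.lam i) = 0 :=
    by_contra fun h => (hζy.2 h).not_gt (Z.lam_strictMono hi)
  rw [HahnSeries.coeff_sub, sub_eq_zero] at hcoeff
  have hi0 : y.coeff (Z.lam i) ≠ 0 := hcoeff ▸ Z.lam_mem_support i
  have hw := congrArg (fun φ : ρ.Series => φ.coeff (Z.lam i)) (AddAction.mem_stabilizer_iff.1 hw)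
  exact mul_right_cancel₀ hi0 (by simpa [vadd_eq_monodromy, coeff_monodromy] using hw)

theorem IsSemiRoot.stabilizer_eq {j : Fin Z.g} {q : ρ.Poly} (hq : Z.IsSemiRoot j q)
    {y : ρ.Series} (hy : ρ.IsBranchOf q y) (hζy : IsLeast (Z.ζ - y).support (Z.lam j)) :
    AddAction.stabilizer (Fin d → ℤ) y = Z.annLattice j := by
  have hle := stabilizer_le_annLattice hζy
  have hindex : (AddAction.stabilizer (Fin d → ℤ) y).index = (Z.annLattice j).index := by
    rw [AddAction.index_stabilizer, ← hy.natDegree_eq_ncard_orbit hq.1, hq.2.2.1,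
      Z.index_annLattice j.2.le]
  have hpos : 0 < (Z.annLattice j).index := by
    rw [Z.index_annLattice j.2.le]
    exact Finset.prod_pos fun i hi => Z.charInt_pos ((Finset.mem_range.1 hi).trans j.2)
  refine le_antisymm hle (AddSubgroup.relIndex_eq_one.1 ?_)
  refine Nat.eq_of_mul_eq_mul_right hpos ?_
  rw [AddSubgroup.relIndex_mul_index hle, one_mul, hindex]

theorem sub_vadd_eq_add_vadd_sub (w : Fin d → ℤ) (φ ψ : ρ.Series) :
    φ - (w +ᵥ ψ) = (φ - (w +ᵥ φ)) + (w +ᵥ (φ - ψ)) := by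
  rw [vadd_sub, sub_add_sub_cancel]

theorem lam_mem_lowerBounds_support_vadd_sub {j : Fin Z.g} {y : ρ.Series}
    (hζy : IsLeast (Z.ζ - y).support (Z.lam j)) (w : Fin d → ℤ) :
    Z.lam j ∈ lowerBounds (w +ᵥ (Z.ζ - y)).support := by
  rw [vadd_eq_monodromy, support_monodromy]
  exact hζy.2

theorem IsSemiRoot.isLeast_support_sub_vadd {j : Fin Z.g} {q : ρ.Poly} (hq : Z.IsSemiRoot j q)
    {y : ρ.Series} (hy : ρ.IsBranchOf q y) (hζy : IsLeast (Z.ζ - y).support (Z.lam j))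
    {w : Fin d → ℤ} (hw : w ∈ Z.annLattice j) :
    IsLeast (Z.ζ - (w +ᵥ y)).support (Z.lam j) := by
  have hwy := hy.vadd w
  obtain ⟨a, ha⟩ := hq.2.2.2.1.exists_isLeast_support_sub_of_mul Z.root hwy.2
  have hle : a ≤ Z.lam j := hq.2.2.2.2.2
    ⟨Z.ζ, w +ᵥ y, Z.isBranchOf_ζ, hwy, Z.isBranchOf_ζ.isMonomialTimesUnit_sub hwy ha⟩
  have hge : Z.lam j ≤ a := by
    rw [sub_vadd_eq_add_vadd_sub] at ha
    exact (HahnSeries.support_add_subset _ _ ha.1).elim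
      (fun h => Z.lam_mem_lowerBounds_support_sub_vadd hw h)
      fun h => lam_mem_lowerBounds_support_vadd_sub hζy w h
  exact le_antisymm hle hge ▸ ha

theorem isLeast_support_sub_vadd_of_lt {j : Fin Z.g} {y : ρ.Series}
    (hζy : IsLeast (Z.ζ - y).support (Z.lam j)) {i : Fin Z.g} (hij : i < j) {w : Fin d → ℤ}
    (hw : w ∈ Z.annLattice i) (hw' : w ∉ Z.annLattice (i + 1)) :
    IsLeast (Z.ζ - (w +ᵥ y)).support (Z.lam i) := by
  rw [sub_vadd_eq_add_vadd_sub]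
  exact isLeast_support_add_of_lt (Z.isLeast_support_sub_vadd hw hw')
    (lam_mem_lowerBounds_support_vadd_sub hζy w) (Z.lam_strictMono hij)

open Classical in
/- The telescoping sum displays the least exponent as a sum of contributions of the subgroups
`annLattice i`, which makes it easy to sum over the orbit of `y`. -/
theorem IsSemiRoot.isLeast_support_sub_vadd_sum {j : Fin Z.g} {q : ρ.Poly}
    (hq : Z.IsSemiRoot j q) {y : ρ.Series} (hy : ρ.IsBranchOf q y)
    (hζy : IsLeast (Z.ζ - y).support (Z.lam j)) (w : Fin d → ℤ) :
    IsLeast (Z.ζ - (w +ᵥ y)).support (Z.lamNat 0 + ∑ i ∈ Finset.range j,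
      if w ∈ Z.annLattice (i + 1) then Z.lamNat (i + 1) - Z.lamNat i else 0) := by
  obtain ⟨l, hlj, hl, hl'⟩ := Z.exists_mem_annLattice_notMem_succ j w
  rw [Z.lamNat_zero_add_sum_ite_mem_annLattice hlj hl hl']
  rcases hlj.lt_or_eq with hlt | rfl
  · rw [Z.lamNat_eq ⟨l, hlt.trans j.2⟩]
    exact isLeast_support_sub_vadd_of_lt hζy hlt hl (hl' hlt)
  · rw [Z.lamNat_eq]
    exact hq.isLeast_support_sub_vadd hy hζy hl

open Classical in
theorem sum_orbit_eq_gamma {j : Fin Z.g} {y : ρ.Series}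
    (hst : AddAction.stabilizer (Fin d → ℤ) y = Z.annLattice j)
    (hfin : (AddAction.orbit (Fin d → ℤ) y).Finite) :
    ∑ x ∈ hfin.toFinset, (Z.lamNat 0 + ∑ i ∈ Finset.range j,
      if x ∈ AddAction.orbit (Z.annLattice (i + 1)) y then Z.lamNat (i + 1) - Z.lamNat i else 0) =
      Z.gamma j := by
  have hcard : hfin.toFinset.card = ∏ k ∈ Finset.range j, Z.charInt k := by
    rw [← Set.ncard_eq_toFinset_card _ hfin, ← AddAction.index_stabilizer, hst,
      Z.index_annLattice j.2.le]
  have hcardSub (i) (hi : i ∈ Finset.range j) :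
      {x ∈ hfin.toFinset | x ∈ AddAction.orbit (Z.annLattice (i + 1)) y}.card =
        ∏ k ∈ Finset.Ico (i + 1) j, Z.charInt k := by
    have hsub : AddAction.orbit (Z.annLattice (i + 1)) y ⊆ AddAction.orbit (Fin d → ℤ) y := by
      rintro _ ⟨v, rfl⟩
      exact ⟨v, rfl⟩
    rw [← Z.relIndex_annLattice (Finset.mem_range.1 hi) j.2.le, ← hst, ← ncard_orbit_addSubgroup,
      ← Set.ncard_coe_finset, Finset.coe_filter]
    congr 1
    ext x
    simpa using @hsub x
  rw [Finset.sum_add_distrib, Finset.sum_const, Finset.sum_comm, hcard, gamma, gammaAux_eq_sum]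
  refine congrArg _ (Finset.sum_congr rfl fun i hi => ?_)
  rw [← Finset.sum_filter, Finset.sum_const, hcardSub i hi]

theorem IsSemiRoot.isLeast_support_aeval {j : Fin Z.g} {q : ρ.Poly} (hq : Z.IsSemiRoot j q) :
    IsLeast (aeval Z.ζ q).support (Z.gamma j) := by
  classical
  obtain ⟨y, hy, hζy⟩ := hq.exists_root
  have hst := hq.stabilizer_eq hy hζy
  have hfin := ρ.finite_orbit hq.1.ne_zero hy.2
  obtain ⟨c, hc, hprod⟩ := exists_aeval_eq_mul_prod_orbit hq.1 hy hfin Z.ζ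
  have hfactor : ∀ x ∈ hfin.toFinset, IsLeast (Z.ζ - x).support
      (Z.lamNat 0 + ∑ i ∈ Finset.range j,
        if x ∈ AddAction.orbit (Z.annLattice (i + 1)) y then Z.lamNat (i + 1) - Z.lamNat i
        else 0) := by
    intro x hx
    obtain ⟨w, rfl⟩ := hfin.mem_toFinset.1 hx
    have hiff (i) (hi : i ∈ Finset.range j) :
        w +ᵥ y ∈ AddAction.orbit (Z.annLattice (i + 1)) y ↔ w ∈ Z.annLattice (i + 1) :=
      vadd_mem_orbit_addSubgroup_iff (hst.trans_le (Z.annLattice_anti (Finset.mem_range.1 hi)))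
    have hleast := hq.isLeast_support_sub_vadd_sum hy hζy w
    rwa [← Finset.sum_congr rfl fun i hi => if_congr (hiff i hi) rfl rfl] at hleast
  rw [hprod, ← zero_add (Z.gamma j), ← sum_orbit_eq_gamma hst hfin]
  exact isLeast_support_mul (isLeast_support_zero_of_isUnit hc) (isLeast_support_prod hfactor)

end Branch

/-! ### Expansions in terms of semi-roots -/

theorem exists_eq_sum_mul_pow_of_degree_lt {A : Type*} [CommRing A] [Nontrivial A] {p P : A[X]}
    (hp : IsUnit p.leadingCoeff) {s : ℕ} (hP : P.degree < (p.natDegree * s : ℕ)) :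
    ∃ c : Fin s → A[X], (∀ t, (c t).degree < p.natDegree) ∧ P = ∑ t, c t * p ^ (t : ℕ) := by
  obtain ⟨a, ha⟩ := hp.exists_right_inv
  have hmonic : (p * C a).Monic := monic_mul_C_of_leadingCoeff_mul_eq_one ha
  have hdeg : (p * C a).degree = p.natDegree := by
    rw [degree_mul_C_of_isUnit (.of_mul_eq_one_right _ ha), degree_eq_natDegree]
    exact leadingCoeff_ne_zero.1 hp.ne_zero
  obtain ⟨D, r, hr, hP'⟩ := P.eq_quo_mul_pow_add_sum_rem_mul_pow hmonic s
  rw [hdeg] at hr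
  have hpow (t : ℕ) : ((p * C a) ^ t).degree = (p.natDegree * t : ℕ) := by
    rw [degree_eq_natDegree (hmonic.pow t).ne_zero, hmonic.natDegree_pow,
      natDegree_eq_of_degree_eq_some hdeg, mul_comm]
  have hterm (t : Fin s) : (r t * (p * C a) ^ (t : ℕ)).degree < (p.natDegree * s : ℕ) := by
    rw [(hmonic.pow _).degree_mul, hpow]
    refine (WithBot.add_lt_add_right (WithBot.natCast_ne_bot _) (hr t)).trans_le ?_
    rw [← Nat.cast_add, add_comm, ← Nat.mul_succ]
    exact Nat.cast_le.2 (Nat.mul_le_mul_left _ t.2)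
  have hD : D * (p * C a) ^ s = 0 := by
    by_contra hne
    refine (hmonic.pow s).not_dvd_of_degree_lt hne ?_ (dvd_mul_left _ _)
    rw [hpow, eq_sub_of_add_eq hP'.symm]
    exact mem_degreeLT.1 (sub_mem (mem_degreeLT.2 hP)
      (sum_mem fun t _ => mem_degreeLT.2 (hterm t)))
  refine ⟨fun t => r t * C a ^ (t : ℕ), fun t => ?_, ?_⟩
  · beta_reduce
    rw [← C_pow, degree_mul_C_of_isUnit ((IsUnit.of_mul_eq_one_right _ ha).pow _)]
    exact hr t
  · rw [hP', hD, zero_add]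
    exact Finset.sum_congr rfl fun t _ => by ring

theorem exists_aeval_eq_of_degree_lt_prod {A : Type*} [CommRing A] [Nontrivial A] {g : ℕ}
    {q : Fin g → A[X]} {n : ℕ → ℕ} (hlead : ∀ j, IsUnit (q j).leadingCoeff)
    (hdeg : ∀ j, (q j).natDegree = ∏ k ∈ Finset.range j, n k) {i : ℕ} (hi : i ≤ g) {P : A[X]}
    (hP : P.degree < (∏ k ∈ Finset.range i, n k : ℕ)) :
    ∃ Q ∈ MvPolynomial.restrictSupport A {v : Fin g →₀ ℕ | ∀ k, v k < if k < i then n k else 1},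
      MvPolynomial.aeval q Q = P := by
  induction i generalizing P with
  | zero =>
    rw [Finset.prod_range_zero, Nat.cast_one, Nat.WithBot.lt_one_iff_le_zero] at hP
    refine ⟨MvPolynomial.C (P.coeff 0), ?_, ?_⟩
    · exact (MvPolynomial.monomial_mem_restrictSupport A).2 (.inl (by simp))
    · rw [MvPolynomial.aeval_C, Polynomial.algebraMap_apply, Algebra.algebraMap_self,
        RingHom.id_apply]
      exact (eq_C_of_degree_le_zero hP).symm
  | succ i ih =>
    rw [Finset.prod_range_succ, ← hdeg ⟨i, hi⟩] at hP
    obtain ⟨c, hc, rfl⟩ := exists_eq_sum_mul_pow_of_degree_lt (hlead ⟨i, hi⟩) hP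
    simp only [hdeg ⟨i, hi⟩] at hc
    choose Q hQ hQc using fun t => ih (Nat.le_of_succ_le hi) (hc t)
    refine ⟨∑ t, Q t * MvPolynomial.monomial (Finsupp.single (⟨i, hi⟩ : Fin g) (t : ℕ)) 1,
      sum_mem fun t _ => ?_, by simp [MvPolynomial.aeval_monomial, hQc]⟩
    have hmono : MvPolynomial.monomial (Finsupp.single (⟨i, hi⟩ : Fin g) (t : ℕ)) (1 : A) ∈
        MvPolynomial.restrictSupport A {Finsupp.single ⟨i, hi⟩ (t : ℕ)} :=
      (MvPolynomial.monomial_mem_restrictSupport A).2 (.inl rfl)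
    have hmul := Submodule.mul_mem_mul (hQ t) hmono
    rw [← MvPolynomial.restrictSupport_add] at hmul
    refine MvPolynomial.restrictSupport_mono A ?_ hmul
    rintro _ ⟨v, hv, _, rfl, rfl⟩ k
    have hvk : v k < if (k : ℕ) < i then n k else 1 := hv k
    rcases eq_or_ne k ⟨i, hi⟩ with rfl | hk
    · simp only [lt_irrefl, if_false, Nat.lt_one_iff] at hvk
      simp [hvk]
    · have hki : (k : ℕ) < i ↔ (k : ℕ) < i + 1 := by
        have hne : (k : ℕ) ≠ i := fun h => hk (Fin.ext h)
        omega
      simpa only [Finsupp.add_apply, Finsupp.single_eq_of_ne hk, add_zero, hki] using hvk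

namespace Branch

open ToricCone

variable {d : ℕ} {ρ : ToricCone d} (Z : Branch ρ)

theorem exists_restrictSupport_Psi_eq {q : Fin Z.g → ρ.Poly} (hq : ∀ j, Z.IsSemiRoot j (q j))
    (x : Z.R) : ∃ Q ∈ MvPolynomial.restrictSupport (ρ.conv ρ.M)
      {v : Fin Z.g →₀ ℕ | ∀ k, v k < Z.charInt k}, Z.Psi q Q = x := by
  obtain ⟨P, hP⟩ : ∃ P : ρ.Poly, aeval Z.ζ P = x := by
    have hx : (x : ρ.Series) ∈ Algebra.adjoin (ρ.conv ρ.M) ({Z.ζ} : Set ρ.Series) := x.2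
    rwa [Algebra.adjoin_singleton_eq_range_aeval] at hx
  have hlt := degree_modByMonic_lt P Z.monic
  rw [degree_eq_natDegree Z.monic.ne_zero, natDegree_eq_prod_charInt] at hlt
  obtain ⟨Q, hQ, hQP⟩ := exists_aeval_eq_of_degree_lt_prod (fun j => (hq j).2.1.1)
    (fun j => (hq j).2.2.1) le_rfl hlt
  refine ⟨Q, by simpa only [Fin.is_lt, if_true] using hQ, Subtype.ext ?_⟩
  rw [← hP, ← aeval_modByMonic_eq_self_of_root Z.root, ← hQP]
  exact (MvPolynomial.comp_aeval_apply _ (aeval Z.ζ) Q).symm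

/-! ### The semigroup `Γ` -/

theorem gammaAux_mem_lattice_and_sub_mem_lattice {j : ℕ} (hj : j < Z.g) :
    Z.gammaAux j hj ∈ Z.lattice (j + 1) ∧ Z.gammaAux j hj - Z.lam ⟨j, hj⟩ ∈ Z.lattice j := by
  induction j with
  | zero =>
    rw [gammaAux, sub_self]
    exact ⟨Z.lam_mem_lattice ⟨0, hj⟩ Nat.zero_lt_one, zero_mem _⟩
  | succ j ih =>
    have hj' := Nat.lt_of_succ_lt hj
    have hsub : Z.gammaAux (j + 1) hj - Z.lam ⟨j + 1, hj⟩ ∈ Z.lattice (j + 1) := by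
      rw [gammaAux, add_sub_right_comm, add_sub_cancel_right]
      exact sub_mem (AddSubgroup.nsmul_mem _ (ih hj').1 _)
        (Z.lam_mem_lattice ⟨j, hj'⟩ (Nat.lt_succ_self _))
    refine ⟨?_, hsub⟩
    rw [← sub_add_cancel (Z.gammaAux (j + 1) hj)]
    exact add_mem (Z.lattice_mono (Nat.le_succ _) hsub)
      (Z.lam_mem_lattice ⟨j + 1, hj⟩ (Nat.lt_succ_self _))

theorem gamma_mem_lattice (j : Fin Z.g) : Z.gamma j ∈ Z.lattice (j + 1) :=
  (Z.gammaAux_mem_lattice_and_sub_mem_lattice j.2).1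

theorem gamma_sub_lam_mem_lattice (j : Fin Z.g) : Z.gamma j - Z.lam j ∈ Z.lattice j :=
  (Z.gammaAux_mem_lattice_and_sub_mem_lattice j.2).2

theorem gammaAux_nonneg {j : ℕ} (hj : j < Z.g) : 0 ≤ Z.gammaAux j hj := by
  induction j with
  | zero =>
    rw [gammaAux, le_def, sub_zero]
    exact (Z.ζ_mem.1 _ (Z.lam_mem_support _)).1
  | succ j ih =>
    rw [gammaAux, add_sub_assoc]
    exact add_nonneg (nsmul_nonneg (ih _) _)
      (sub_nonneg.2 (Z.lam_strictMono.monotone (Nat.le_succ j)))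

theorem gamma_mem_bigSemigroup (j : Fin Z.g) : Z.gamma j ∈ Z.bigSemigroup :=
  ⟨sub_zero (Z.gamma j) ▸ Z.gammaAux_nonneg j.2, Z.lattice_mono j.2 (Z.gamma_mem_lattice j)⟩

theorem Gam_le_bigSemigroup : Z.Gam ≤ Z.bigSemigroup :=
  sup_le (fun _ hu => ⟨hu.1, Z.M_le_lattice _ hu.2⟩)
    (AddSubmonoid.closure_le.2 (Set.range_subset_iff.2 Z.gamma_mem_bigSemigroup))

theorem mem_Gam_iff {u : ρ.Expo} :
    u ∈ Z.Gam ↔ ∃ α ∈ ρ.semigroup ρ.M, ∃ v : Fin Z.g →₀ ℕ, α + Finsupp.weight Z.gamma v = u := by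
  simp only [Gam, AddSubmonoid.mem_sup, AddSubmonoid.mem_closure_range_iff,
    Finsupp.weight_apply (R := ℕ)]
  constructor
  · rintro ⟨α, hα, _, ⟨v, rfl⟩, rfl⟩
    exact ⟨α, hα, v, rfl⟩
  · rintro ⟨α, hα, v, rfl⟩
    exact ⟨α, hα, _, ⟨v, rfl⟩, rfl⟩

theorem add_weight_mem_Gam {α : ρ.Expo} (hα : α ∈ ρ.semigroup ρ.M) (v : Fin Z.g →₀ ℕ) :
    α + Finsupp.weight Z.gamma v ∈ Z.Gam :=
  Z.mem_Gam_iff.2 ⟨α, hα, v, rfl⟩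

theorem semigroup_M_le_Gam : ρ.semigroup ρ.M ≤ Z.Gam := le_sup_left

theorem gamma_mem_Gam (i : Fin Z.g) : Z.gamma i ∈ Z.Gam :=
  Z.mem_Gam_iff.2 ⟨0, zero_mem _, Finsupp.single i 1, by
    rw [Finsupp.weight_single, one_smul, zero_add]⟩

theorem weight_gamma_mem_Gam (v : Fin Z.g →₀ ℕ) : Finsupp.weight Z.gamma v ∈ Z.Gam :=
  Z.mem_Gam_iff.2 ⟨0, zero_mem _, v, zero_add _⟩

theorem charInt_dvd_of_zsmul_lam_mem_lattice {i : Fin Z.g} {m : ℤ}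
    (h : m • Z.lam i ∈ Z.lattice i) : (Z.charInt i : ℤ) ∣ m := by
  rw [charInt, lattice_succ, relIndex_sup_zmultiples, addOrderOf_dvd_iff_zsmul_eq_zero]
  exact (QuotientAddGroup.eq_zero_iff _).2 h

theorem charInt_dvd_of_sum_zsmul_gamma_mem_M {c : Fin Z.g → ℤ}
    (h : ∑ k, c k • Z.gamma k ∈ ρ.M) {i : Fin Z.g} (hi : ∀ k, i < k → c k = 0) :
    (Z.charInt i : ℤ) ∣ c i := by
  refine Z.charInt_dvd_of_zsmul_lam_mem_lattice ?_
  have hgamma : c i • Z.gamma i ∈ Z.lattice i := by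
    rw [← Finset.add_sum_erase _ _ (Finset.mem_univ i)] at h
    refine (AddSubgroup.add_mem_cancel_right _ ?_).1 (Z.M_le_lattice i h)
    refine sum_mem fun k hk => ?_
    rcases lt_or_gt_of_ne (Finset.ne_of_mem_erase hk) with hlt | hlt
    · exact AddSubgroup.zsmul_mem _ (Z.lattice_mono hlt (Z.gamma_mem_lattice k)) _
    · rw [hi k hlt, zero_smul]
      exact zero_mem _
  have hlam := sub_mem hgamma (AddSubgroup.zsmul_mem _ (Z.gamma_sub_lam_mem_lattice i) (c i))
  rwa [← smul_sub, sub_sub_cancel] at hlam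

theorem eq_zero_of_sum_zsmul_gamma_mem_M {c : Fin Z.g → ℤ} (hc : ∀ k, |c k| < Z.charInt k)
    (h : ∑ k, c k • Z.gamma k ∈ ρ.M) : c = 0 := by
  by_contra hne
  have hs : ({k | c k ≠ 0} : Finset (Fin Z.g)).Nonempty := by
    obtain ⟨k, hk⟩ := Function.ne_iff.1 hne
    exact ⟨k, by simpa using hk⟩
  obtain ⟨i, hi⟩ := Finset.exists_maximal hs
  refine (Finset.mem_filter.1 hi.prop).2 (Int.eq_zero_of_abs_lt_dvd
    (Z.charInt_dvd_of_sum_zsmul_gamma_mem_M h fun k hik => ?_) (hc i))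
  by_contra hk
  exact hi.not_gt (by simpa using hk) hik

theorem eq_of_add_weight_eq {v v' : Fin Z.g →₀ ℕ} (hv : ∀ i, v i < Z.charInt i)
    (hv' : ∀ i, v' i < Z.charInt i) {α α' : ρ.Expo} (hα : α ∈ ρ.M) (hα' : α' ∈ ρ.M)
    (h : α + Finsupp.weight Z.gamma v = α' + Finsupp.weight Z.gamma v') : v = v' := by
  have hmem : ∑ k, ((v k : ℤ) - v' k) • Z.gamma k ∈ ρ.M := by
    simp only [sub_smul, Finset.sum_sub_distrib, natCast_zsmul, ← Finsupp.weight_eq_sum]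
    have hsub : Finsupp.weight Z.gamma v - Finsupp.weight Z.gamma v' = α' - α :=
      sub_eq_sub_iff_add_eq_add.2 ((add_comm _ _).trans h)
    rw [hsub]
    exact sub_mem hα' hα
  have hzero := Z.eq_zero_of_sum_zsmul_gamma_mem_M (c := fun k => (v k : ℤ) - v' k)
    (fun k => by have := hv k; have := hv' k; rw [abs_lt]; omega) hmem
  ext k
  exact_mod_cast sub_eq_zero.1 (congrFun hzero k)

end Branch

namespace Filt

/-! ### Initial forms -/

section InitialForms

variable {ι : Type} [AddCommMonoid ι] [LinearOrder ι]
  {B : Type} [CommRing B] [Algebra ℂ B] {C : Type} [CommRing C] [Algebra ℂ C]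

/-- A system of initial forms, with values in a graded algebra `C`, on a filtered algebra `B`: every
non-zero element of `B` has a non-zero initial form, in the largest degree `i` for which it lies in
the term `F i` of the filtration. It identifies the associated graded algebra with `C`. -/
structure InitialForms (F : Filt ι B) (𝒞 : ι → Submodule ℂ C) where
  /-- the initial form of degree `i` -/
  ini : ι → B →ₗ[ℂ] C
  ini_of_lt : ∀ {i k : ι}, i < k → ∀ x ∈ F.F k, ini i x = 0
  exists_ini_ne_zero : ∀ {x : B}, x ≠ 0 → ∃ i, x ∈ F.F i ∧ ini i x ≠ 0
  ini_one : ini 0 1 = 1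
  ini_mul : ∀ {i j : ι}, ∀ x ∈ F.F i, ∀ y ∈ F.F j, ini (i + j) (x * y) = ini i x * ini j y
  map_eq : ∀ i, (F.F i).map (ini i) = 𝒞 i
  isInternal : DirectSum.IsInternal 𝒞

namespace InitialForms

variable {F : Filt ι B} {𝒞 : ι → Submodule ℂ C} (I : InitialForms F 𝒞)

theorem ini_eq_zero_of_mem_above {i : ι} {x : B} (hx : x ∈ F.above i) : I.ini i x = 0 :=
  (iSup₂_le fun _ hk _ => I.ini_of_lt hk _ : F.above i ≤ LinearMap.ker (I.ini i)) hx

theorem mem_above {i : ι} {x : B} (hx : x ∈ F.F i) (h : I.ini i x = 0) : x ∈ F.above i := by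
  rcases eq_or_ne x 0 with rfl | hx0
  · exact zero_mem _
  obtain ⟨j, hj, hj0⟩ := I.exists_ini_ne_zero hx0
  rcases lt_trichotomy i j with hij | rfl | hji
  · exact Submodule.mem_iSup_of_mem j (Submodule.mem_iSup_of_mem hij hj)
  · exact absurd h hj0
  · exact absurd (I.ini_of_lt hji x hx) hj0

variable [IsOrderedCancelAddMonoid ι]

/-- The identification of the homogeneous components of degree `i` of the associated graded algebra
and of `C`. -/
def pieceEquiv (i : ι) : F.Piece i ≃ₗ[ℂ] 𝒞 i :=
  LinearEquiv.ofBijective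
    (Submodule.liftQ _
      (((I.ini i).comp (F.F i).subtype).codRestrict (𝒞 i) fun x => by
        rw [← I.map_eq i]
        exact ⟨x, x.2, rfl⟩)
      fun _ hx => Subtype.ext (I.ini_eq_zero_of_mem_above hx))
    (by
      constructor
      · rw [injective_iff_map_eq_zero]
        intro a ha
        obtain ⟨x, rfl⟩ := F.cls_surjective i a
        exact F.cls_eq_zero.2 (I.mem_above x.2 (congrArg Subtype.val ha))
      · rintro ⟨c, hc⟩
        rw [← I.map_eq i] at hc
        obtain ⟨x, hx, rfl⟩ := hc
        exact ⟨F.cls i ⟨x, hx⟩, rfl⟩)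

theorem pieceEquiv_cls {i : ι} (x : F.F i) : (I.pieceEquiv i (F.cls i x) : C) = I.ini i x := rfl

/-- The homomorphism from the associated graded algebra to `C` defined by initial forms. -/
def grHom : F.Gr →ₐ[ℂ] C :=
  DirectSum.toAlgebra ℂ F.Piece (fun i => (𝒞 i).subtype.comp (I.pieceEquiv i).toLinearMap)
    I.ini_one
    (by
      intro i j a b
      obtain ⟨x, rfl⟩ := F.cls_surjective i a
      obtain ⟨y, rfl⟩ := F.cls_surjective j b
      exact I.ini_mul x.1 x.2 y.1 y.2)

theorem grHom_lof {i : ι} (a : F.Piece i) :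
    I.grHom (DirectSum.lof ℂ ι F.Piece i a) = I.pieceEquiv i a :=
  DirectSum.toModule_lof (φ := fun i => (𝒞 i).subtype.comp (I.pieceEquiv i).toLinearMap) ℂ i a

theorem grHom_eq_comp : ⇑I.grHom = DirectSum.coeLinearMap 𝒞 ∘
    DirectSum.lmap fun i => (I.pieceEquiv i).toLinearMap := by
  refine congrArg (DFunLike.coe : (F.Gr →ₗ[ℂ] C) → F.Gr → C)
    (DirectSum.linearMap_ext ℂ (ψ := I.grHom.toLinearMap)
      (ψ' := (DirectSum.coeLinearMap 𝒞).comp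
        (DirectSum.lmap fun i => (I.pieceEquiv i).toLinearMap))
      fun i => LinearMap.ext fun a => ?_)
  change I.grHom (DirectSum.lof ℂ ι F.Piece i a) = DirectSum.coeLinearMap 𝒞
    (DirectSum.lmap _ (DirectSum.lof ℂ ι F.Piece i a))
  rw [grHom_lof, DirectSum.lmap_lof, DirectSum.coeLinearMap_lof]
  rfl

theorem grHom_bijective : Function.Bijective I.grHom := by
  rw [grHom_eq_comp]
  exact I.isInternal.comp
    ⟨(DirectSum.lmap_injective _).2 fun i => (I.pieceEquiv i).injective,
      (DirectSum.lmap_surjective _).2 fun i => (I.pieceEquiv i).surjective⟩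

/-- The isomorphism of the associated graded algebra with `C` defined by initial forms. -/
def grEquiv : F.Gr ≃ₐ[ℂ] C := AlgEquiv.ofBijective I.grHom I.grHom_bijective

theorem grEquiv_lof {i : ι} (a : F.Piece i) :
    I.grEquiv (DirectSum.lof ℂ ι F.Piece i a) = I.pieceEquiv i a := I.grHom_lof a

theorem isGradedEquiv_grEquiv : F.IsGradedEquiv 𝒞 I.grEquiv := by
  intro i
  ext c
  constructor
  · rintro ⟨_, ⟨a, rfl⟩, rfl⟩
    exact I.grEquiv_lof a ▸ (I.pieceEquiv i a).2
  · intro hc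
    refine ⟨_, ⟨(I.pieceEquiv i).symm ⟨c, hc⟩, rfl⟩, (I.grEquiv_lof _).trans ?_⟩
    rw [LinearEquiv.apply_symm_apply]

theorem grEquiv_comp_grMap {B' : Type} [CommRing B'] [Algebra ℂ B'] {D : Type} [CommRing D]
    [Algebra ℂ D] {F' : Filt ι B'} {𝒟 : ι → Submodule ℂ D} (I' : InitialForms F' 𝒟)
    (φ : B →ₐ[ℂ] B') (h : IsFiltered F F' φ) (ψ : C →ₐ[ℂ] D)
    (hφ : ∀ i, ∀ x ∈ F.F i, I'.ini i (φ x) = ψ (I.ini i x)) :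
    (I'.grEquiv : F'.Gr →ₐ[ℂ] D).comp (grMap F F' φ h) =
      ψ.comp (I.grEquiv : F.Gr →ₐ[ℂ] C) := by
  refine AlgHom.toLinearMap_injective (DirectSum.linearMap_ext ℂ fun i => LinearMap.ext fun a => ?_)
  obtain ⟨x, rfl⟩ := F.cls_surjective i a
  have hlof : grMap F F' φ h (DirectSum.lof ℂ ι F.Piece i (F.cls i x)) =
      DirectSum.lof ℂ ι F'.Piece i (F'.cls i ⟨φ x, h i x x.2⟩) :=
    DirectSum.toModule_lof ℂ i (F.cls i x)
  change I'.grEquiv (grMap F F' φ h (DirectSum.lof ℂ ι F.Piece i (F.cls i x))) =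
    ψ (I.grEquiv (DirectSum.lof ℂ ι F.Piece i (F.cls i x)))
  rw [hlof, grEquiv_lof, grEquiv_lof, pieceEquiv_cls, pieceEquiv_cls]
  exact hφ i x x.2

end InitialForms

end InitialForms

end Filt

theorem isInternal_span_image_preimage {k ι κ C : Type*} [DecidableEq ι] [Ring k] [AddCommGroup C]
    [Module k C] (b : Module.Basis κ k C) (deg : κ → ι) :
    DirectSum.IsInternal fun i => Submodule.span k (b '' (deg ⁻¹' {i})) := by
  refine DirectSum.isInternal_submodule_of_iSupIndep_of_iSup_eq_top (fun i => ?_) ?_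
  · simp only [← Submodule.span_iUnion, ← Set.image_iUnion]
    refine b.linearIndependent.disjoint_span_image (Set.disjoint_left.2 fun a ha ha' => ?_)
    obtain ⟨j, hj, haj⟩ := Set.mem_iUnion₂.1 ha'
    exact hj (haj.symm.trans ha)
  · rw [← Submodule.span_iUnion, ← Set.image_iUnion, ← Set.preimage_iUnion,
      Set.iUnion_of_singleton, Set.preimage_univ, Set.image_univ, b.span_eq]

/-! ### Homogeneous parts of Hahn series -/

section HomogeneousPart

theorem finite_support_inter_fiber {Γ Δ R : Type*} [PartialOrder Γ] [PartialOrder Δ] [Zero R]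
    {κ : Γ → Δ} (hκ : StrictMono κ) (x : HahnSeries Γ R) (i : Δ) :
    (x.support ∩ κ ⁻¹' {i}).Finite :=
  IsAntichain.finite_of_partiallyWellOrderedOn (r := (· ≤ ·))
    (fun _ hu _ hv hne hle => (hκ (lt_of_le_of_ne hle hne)).ne (hu.2.trans hv.2.symm))
    (x.isPWO_support.mono Set.inter_subset_left)

variable {Γ Δ R : Type*} [AddCommMonoid Γ] [PartialOrder Γ] [AddCommMonoid Δ] [PartialOrder Δ]
  [CommSemiring R] {κ : Γ →+ Δ}

open Classical in
/-- The homogeneous part of degree `i` of a Hahn series with respect to the degree function `κ`,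
restricted to the exponents in `Λ`. It is a polynomial, since the exponents of degree `i` form an
antichain. -/
def homogeneousPart (hκ : StrictMono κ) (Λ : AddSubmonoid Γ) (i : Δ) :
    HahnSeries Γ R →ₗ[R] AddMonoidAlgebra R Λ where
  toFun x := AddMonoidAlgebra.ofCoeff (Finsupp.ofSupportFinite
    (fun u : Λ => if κ u = i then x.coeff u else 0)
    (.of_injOn (t := x.support ∩ κ ⁻¹' {i}) (fun _ hu => (ite_ne_right_iff.1 hu).symm)
      Subtype.val_injective.injOn (finite_support_inter_fiber hκ x i)))
  map_add' x y := by
    ext u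
    change (if κ u = i then x.coeff u + y.coeff u else 0) =
      (if κ u = i then x.coeff u else 0) + if κ u = i then y.coeff u else 0
    rw [← ite_add_zero]
  map_smul' c x := by
    ext u
    change (if κ u = i then c * x.coeff u else 0) = c * if κ u = i then x.coeff u else 0
    rw [mul_ite_zero]

variable (hκ : StrictMono κ) {Λ : AddSubmonoid Γ} {i j : Δ} {x y : HahnSeries Γ R} {a : Γ}

open Classical in
theorem coeff_homogeneousPart (Λ : AddSubmonoid Γ) (i : Δ) (x : HahnSeries Γ R) (u : Λ) :
    (homogeneousPart hκ Λ i x).coeff u = if κ u = i then x.coeff u else 0 := rfl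

theorem mem_support_homogeneousPart {u : Λ} :
    u ∈ (homogeneousPart hκ Λ i x).coeff.support ↔ κ u = i ∧ (u : Γ) ∈ x.support := by
  classical
  rw [Finsupp.mem_support_iff, coeff_homogeneousPart, ite_ne_right_iff, HahnSeries.mem_support]

theorem homogeneousPart_mem_gradeBy :
    homogeneousPart hκ Λ i x ∈ AddMonoidAlgebra.gradeBy R (fun u : Λ => κ u) i :=
  fun _ hu => ((mem_support_homogeneousPart hκ).1 hu).1

theorem homogeneousPart_eq_zero_of_lt (h : ∀ u ∈ x.support, i < κ u) :
    homogeneousPart hκ Λ i x = 0 := by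
  ext u
  by_contra hu
  obtain ⟨hui, hux⟩ := (mem_support_homogeneousPart hκ).1 (Finsupp.mem_support_iff.2 hu)
  exact (h _ hux).ne' hui

theorem homogeneousPart_of_mem_lowerBounds (ha : a ∈ lowerBounds x.support) (haΛ : a ∈ Λ) :
    homogeneousPart hκ Λ (κ a) x = AddMonoidAlgebra.single ⟨a, haΛ⟩ (x.coeff a) := by
  classical
  ext u
  rw [coeff_homogeneousPart, AddMonoidAlgebra.coeff_single]
  rcases eq_or_ne (⟨a, haΛ⟩ : Λ) u with rfl | hu
  · rw [if_pos rfl, Finsupp.single_eq_same]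
  · rw [Finsupp.single_eq_of_ne hu.symm, ite_eq_right_iff]
    intro hκu
    by_contra h0
    exact (hκ (lt_of_le_of_ne (ha h0) fun h => hu (Subtype.ext h))).ne' hκu

theorem homogeneousPart_eq_mapDomain {Λ' : AddSubmonoid Γ} (h : Λ ≤ Λ')
    (hx : ∀ u ∈ x.support, κ u = i → u ∈ Λ) : homogeneousPart hκ Λ' i x =
      AddMonoidAlgebra.mapDomainAlgHom R R (AddSubmonoid.inclusion h)
        (homogeneousPart hκ Λ i x) := by
  ext u
  by_cases hu : (u : Γ) ∈ Λ
  · exact (Finsupp.mapDomain_apply (AddSubmonoid.inclusion_injective h)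
      (homogeneousPart hκ Λ i x).coeff ⟨u, hu⟩).symm
  · have hout : u ∉ Set.range (AddSubmonoid.inclusion h) := by
      rintro ⟨v, rfl⟩
      exact hu v.2
    refine Eq.trans ?_ (Finsupp.mapDomain_of_notMem_range _ _ hout).symm
    by_contra h0
    obtain ⟨hui, hux⟩ := (mem_support_homogeneousPart hκ).1 (Finsupp.mem_support_iff.2 h0)
    exact hu (hx _ hux hui)

theorem homogeneousPart_one (Λ : AddSubmonoid Γ) :
    homogeneousPart hκ Λ 0 (1 : HahnSeries Γ R) = 1 := by
  have h0 : (0 : Γ) ∈ lowerBounds (1 : HahnSeries Γ R).support :=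
    fun u hu => (HahnSeries.support_single_subset hu).ge
  rw [← map_zero κ, homogeneousPart_of_mem_lowerBounds hκ h0 (zero_mem Λ), HahnSeries.coeff_one,
    if_pos rfl]
  rfl

variable [IsOrderedCancelAddMonoid Δ]

theorem map_eq_and_map_eq_of_map_add_eq (hx : ∀ u ∈ x.support, i ≤ κ u)
    (hy : ∀ u ∈ y.support, j ≤ κ u) {u v : Γ} (hu : u ∈ x.support) (hv : v ∈ y.support)
    (h : κ (u + v) = i + j) : κ u = i ∧ κ v = j := by
  rw [map_add] at h
  obtain ⟨h1, h2⟩ := (add_eq_add_iff_eq_and_eq (hx u hu) (hy v hv)).1 h.symm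
  exact ⟨h1.symm, h2.symm⟩

variable [IsOrderedCancelAddMonoid Γ]

theorem homogeneousPart_mul (hx : ∀ u ∈ x.support, i ≤ κ u) (hy : ∀ u ∈ y.support, j ≤ κ u)
    (hxΛ : ∀ u ∈ x.support, κ u = i → u ∈ Λ) (hyΛ : ∀ u ∈ y.support, κ u = j → u ∈ Λ) :
    homogeneousPart hκ Λ (i + j) (x * y) = homogeneousPart hκ Λ i x * homogeneousPart hκ Λ j y := by
  classical
  set p := homogeneousPart hκ Λ i x
  set q := homogeneousPart hκ Λ j y
  ext u
  rw [coeff_homogeneousPart]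
  split_ifs with hu
  · have hpq : (p * q).coeff u = ∑ s ∈ p.coeff.support ×ˢ q.coeff.support with s.1 + s.2 = u,
        p.coeff s.1 * q.coeff s.2 := by
      rw [AddMonoidAlgebra.coeff_mul, Finset.sum_filter, Finset.sum_product]
      rfl
    rw [hpq, HahnSeries.coeff_mul]
    refine (Finset.sum_bij (fun s _ => ((s.1 : Γ), (s.2 : Γ))) ?_ ?_ ?_ ?_).symm
    · rintro ⟨a, b⟩ hab
      simp only [Finset.mem_filter, Finset.mem_product, mem_support_homogeneousPart, p, q] at hab
      exact Finset.mem_antidiagonal.2 ⟨hab.1.1.2, hab.1.2.2, congrArg Subtype.val hab.2⟩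
    · rintro ⟨a, b⟩ - ⟨a', b'⟩ - h
      exact Prod.ext (Subtype.ext (congrArg Prod.fst h)) (Subtype.ext (congrArg Prod.snd h))
    · rintro ⟨a, b⟩ hab
      obtain ⟨ha, hb, hsum⟩ := Finset.mem_antidiagonal.1 hab
      obtain ⟨hai, hbj⟩ := map_eq_and_map_eq_of_map_add_eq hx hy ha hb (hsum ▸ hu)
      refine ⟨(⟨a, hxΛ a ha hai⟩, ⟨b, hyΛ b hb hbj⟩), ?_, rfl⟩
      simp only [Finset.mem_filter, Finset.mem_product, mem_support_homogeneousPart, p, q]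
      exact ⟨⟨⟨hai, ha⟩, hbj, hb⟩, Subtype.ext hsum⟩
    · rintro ⟨a, b⟩ hab
      simp only [Finset.mem_filter, Finset.mem_product, mem_support_homogeneousPart, p, q] at hab
      rw [coeff_homogeneousPart, coeff_homogeneousPart, if_pos hab.1.1.1, if_pos hab.1.2.1]
  · have hmem : p * q ∈ AddMonoidAlgebra.gradeBy R (κ.comp Λ.subtype) (i + j) :=
      SetLike.mul_mem_graded (homogeneousPart_mem_gradeBy hκ) (homogeneousPart_mem_gradeBy hκ)
    by_contra h0
    exact hu (hmem u (Finsupp.mem_support_iff.2 (Ne.symm h0)))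

end HomogeneousPart

namespace ToricCone

variable {d : ℕ} {ρ : ToricCone d} {η : Fin d → ℝ}

theorem pair_strictMono (hη : η ∈ interior (ρ.cone : Set (Fin d → ℝ))) : StrictMono (ρ.pair η) := by
  intro u v huv
  have hpos := ρ.pair_pos_of_mem_interior (u := v - u) hη huv.le (sub_ne_zero.2 huv.ne')
  rwa [map_sub, sub_pos] at hpos

theorem single_mem_conv {L : AddSubgroup ρ.Expo} {u : ρ.Expo} (hu : u ∈ ρ.semigroup L) (c : ℂ) :
    HahnSeries.single u c ∈ ρ.conv L := by
  refine ⟨fun v hv => ?_, 0, zero_mem _, summable_of_ne_finset_zero (s := {u}) fun v hv => ?_⟩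
  · rw [Set.mem_singleton_iff.1 (HahnSeries.support_single_subset hv)]
    exact hu
  · rw [HahnSeries.coeff_single_of_ne (Finset.notMem_singleton.1 hv), norm_zero, zero_mul]

/-! ### Initial forms of series -/

section EtaGrade

variable {S : AddSubmonoid ℝ} {Λ : AddSubmonoid ρ.Expo}

theorem etaGrade_eq_span (η : Fin d → ℝ) (j : S) : ρ.etaGrade η S Λ j =
    Submodule.span ℂ ((AddMonoidAlgebra.single · 1) '' {u : Λ | ρ.pair η u = j}) :=
  AddMonoidAlgebra.supported_eq_span_single ℂ {u : Λ | ρ.pair η u = j}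

theorem isInternal_etaGrade (h : ∀ u ∈ Λ, ρ.pair η u ∈ S) :
    DirectSum.IsInternal (ρ.etaGrade η S Λ) := by
  have hgrade : ρ.etaGrade η S Λ = fun j => Submodule.span ℂ (AddMonoidAlgebra.basis Λ ℂ ''
      ((fun u : Λ => (⟨ρ.pair η u, h u u.2⟩ : S)) ⁻¹' {j})) := by
    funext j
    rw [etaGrade_eq_span]
    congr 2
    exact Set.ext fun u => ⟨fun h => Subtype.ext h, fun h => congrArg Subtype.val h⟩
  rw [hgrade]
  exact isInternal_span_image_preimage (AddMonoidAlgebra.basis Λ ℂ) _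

theorem nontrivial_etaGrade_iff {j : S} :
    Nontrivial (ρ.etaGrade η S Λ j) ↔ ∃ u ∈ Λ, ρ.pair η u = j := by
  rw [Submodule.nontrivial_iff_ne_bot, ne_eq, etaGrade_eq_span, Submodule.span_eq_bot]
  simp

theorem rank_etaGrade (η : Fin d → ℝ) (j : S) :
    Module.rank ℂ (ρ.etaGrade η S Λ j) = Cardinal.mk {u : Λ | ρ.pair η u = j} := by
  rw [etaGrade_eq_span, rank_span_set]
  · exact Cardinal.mk_image_eq (AddMonoidAlgebra.basis Λ ℂ).injective
  · exact ((AddMonoidAlgebra.basis Λ ℂ).linearIndependent.linearIndepOn_id).mono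
      (Set.image_subset_range _ _)

theorem rank_etaGrade_le_one (hinj : Set.InjOn (ρ.pair η) Λ) (j : S) :
    Module.rank ℂ (ρ.etaGrade η S Λ j) ≤ 1 := by
  rw [rank_etaGrade, Cardinal.mk_le_one_iff_set_subsingleton]
  exact fun u hu v hv => Subtype.ext (hinj u.2 v.2 (hu.trans hv.symm))

/-- The initial forms, with exponents in `Λ`, on an algebra of series for which the exponents of
least degree belong to `Λ`. -/
def initialFormsOfSubalgebra (hη : StrictMono (ρ.pair η)) {B : Subalgebra ℂ ρ.Series}
    (hS : ∀ x ∈ B, ∀ u ∈ x.support, ρ.pair η u ∈ S) (hΛS : ∀ u ∈ Λ, ρ.pair η u ∈ S)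
    (hΛ : ∀ i : S, ∀ x ∈ B, (∀ u ∈ x.support, (i : ℝ) ≤ ρ.pair η u) →
      ∀ u ∈ x.support, ρ.pair η u = i → u ∈ Λ)
    (hlead : ∀ u ∈ Λ, ∃ x ∈ B, u ∈ lowerBounds x.support ∧ x.coeff u = 1) :
    Filt.InitialForms ((ρ.etaFilt η S).comap (B := B) B.val) (ρ.etaGrade η S Λ) where
  ini i := homogeneousPart hη Λ i ∘ₗ B.val.toLinearMap
  ini_of_lt hik x hx :=
    homogeneousPart_eq_zero_of_lt hη fun u hu => lt_of_lt_of_le hik (hx u hu)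
  exists_ini_ne_zero {x} hx := by
    obtain ⟨a, ha, hmin⟩ := exists_mem_support_isMinOn hη.monotone (Subtype.coe_ne_coe.2 hx)
    have haΛ : a ∈ Λ := hΛ ⟨_, hS x x.2 a ha⟩ x x.2 hmin a ha rfl
    refine ⟨⟨_, hS x x.2 a ha⟩, hmin, fun h => ?_⟩
    have hcoeff : (⟨a, haΛ⟩ : Λ) ∈ (homogeneousPart hη Λ (ρ.pair η a) x.1).coeff.support :=
      (mem_support_homogeneousPart hη).2 ⟨rfl, ha⟩
    rw [show homogeneousPart hη Λ (ρ.pair η a) x.1 = 0 from h] at hcoeff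
    exact Finsupp.notMem_support_iff.2 rfl hcoeff
  ini_one := homogeneousPart_one hη Λ
  ini_mul {i j} x hx y hy := homogeneousPart_mul hη hx hy (hΛ i x x.2 hx) (hΛ j y y.2 hy)
  map_eq i := by
    refine le_antisymm ?_ ?_
    · rintro _ ⟨x, -, rfl⟩
      exact homogeneousPart_mem_gradeBy hη
    · rw [etaGrade_eq_span, Submodule.span_le]
      rintro _ ⟨u, hu, rfl⟩
      obtain ⟨x, hx, hle, hone⟩ := hlead u u.2
      refine ⟨⟨x, hx⟩, fun v hv => hu.ge.trans (hη.monotone (hle hv)), ?_⟩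
      change homogeneousPart hη Λ i x = _
      rw [← hu, homogeneousPart_of_mem_lowerBounds hη hle u.2, hone]
  isInternal := isInternal_etaGrade hΛS

end EtaGrade

/-! ### Initial forms of polynomials -/

section WeightGrade

variable {S : AddSubmonoid ℝ} {g : ℕ} {γ : Fin g → ρ.Expo}

theorem mem_weightFilt {i : S} {P : MvPolynomial (Fin g) (ρ.conv ρ.M)} :
    P ∈ (ρ.weightFilt γ η S).F i ↔ ∀ v, ∀ α ∈ (P.coeff v).1.support,
      (i : ℝ) - ρ.pair η (Finsupp.weight γ v) ≤ ρ.pair η α := by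
  simp only [sub_le_iff_le_add, ← map_add, Finsupp.weight_eq_sum]
  rfl

theorem isInternal_weightGrade
    (hS : ∀ α ∈ ρ.semigroup ρ.M, ∀ v : Fin g →₀ ℕ, ρ.pair η (α + Finsupp.weight γ v) ∈ S) :
    DirectSum.IsInternal (ρ.weightGrade γ η S) := by
  have hgrade : ρ.weightGrade γ η S = fun j => Submodule.span ℂ
      ((AddMonoidAlgebra.basis (ρ.semigroup ρ.M) ℂ).smulTower (MvPolynomial.basisMonomials (Fin g)
        (AddMonoidAlgebra ℂ (ρ.semigroup ρ.M))) ''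
        ((fun p => (⟨_, hS p.1 p.1.2 p.2⟩ : S)) ⁻¹' {j})) := by
    funext j
    refine congrArg (Submodule.span ℂ) (Set.ext fun P => ?_)
    simp [Subtype.ext_iff, MvPolynomial.smul_monomial, Finsupp.weight_eq_sum, eq_comm]
  rw [hgrade]
  exact isInternal_span_image_preimage _ _

theorem exists_mem_support_coeff_isMin (hη : Monotone (ρ.pair η)) (γ : Fin g → ρ.Expo)
    {P : MvPolynomial (Fin g) (ρ.conv ρ.M)} (hP : P ≠ 0) :
    ∃ v, ∃ a ∈ (P.coeff v).1.support, ∀ v', ∀ b ∈ (P.coeff v').1.support,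
      ρ.pair η (a + Finsupp.weight γ v) ≤ ρ.pair η (b + Finsupp.weight γ v') := by
  have hmin : ∀ v : P.support, ∃ a ∈ (P.coeff v).1.support,
      IsMinOn (ρ.pair η) (P.coeff v).1.support a := fun v =>
    exists_mem_support_isMinOn hη (Subtype.coe_ne_coe.2 (MvPolynomial.mem_support_iff.1 v.2))
  choose a ha hmin using hmin
  have : Nonempty P.support := (MvPolynomial.support_nonempty.2 hP).to_subtype
  obtain ⟨v, hv⟩ := Finite.exists_min fun v : P.support => ρ.pair η (a v + Finsupp.weight γ v.1)
  refine ⟨v, a v, ha v, fun v' b hb => ?_⟩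
  have hv' : v' ∈ P.support := by
    rw [MvPolynomial.mem_support_iff]
    intro h
    exact hb (by rw [h]; rfl)
  refine (hv ⟨v', hv'⟩).trans ?_
  rw [map_add, map_add]
  gcongr
  exact hmin ⟨v', hv'⟩ hb

/-- The part of weight `j` of an element of `ℂ{ρ^∨ ∩ M}[U_1, …, U_g]`, where the weight of `X^α U^v`
is `⟨η, α + ∑ v_i γ_i⟩`. -/
def weightedPart (hη : StrictMono (ρ.pair η)) (γ : Fin g → ρ.Expo) (j : ℝ) :
    MvPolynomial (Fin g) (ρ.conv ρ.M) →ₗ[ℂ]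
      MvPolynomial (Fin g) (AddMonoidAlgebra ℂ (ρ.semigroup ρ.M)) :=
  (Finsupp.lsum ℂ fun v => (MvPolynomial.monomial v).restrictScalars ℂ ∘ₗ
    homogeneousPart hη (ρ.semigroup ρ.M) (j - ρ.pair η (Finsupp.weight γ v)) ∘ₗ
      (ρ.conv ρ.M).val.toLinearMap) ∘ₗ (AddMonoidAlgebra.coeffLinearEquiv ℂ).toLinearMap

variable (hη : StrictMono (ρ.pair η))

theorem weightedPart_eq_sum (γ : Fin g → ρ.Expo) (j : ℝ) (P : MvPolynomial (Fin g) (ρ.conv ρ.M)) :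
    weightedPart hη γ j P = ∑ v ∈ P.support, MvPolynomial.monomial v
      (homogeneousPart hη (ρ.semigroup ρ.M) (j - ρ.pair η (Finsupp.weight γ v)) (P.coeff v).1) :=
  rfl

theorem coeff_weightedPart (γ : Fin g → ρ.Expo) (j : ℝ) (P : MvPolynomial (Fin g) (ρ.conv ρ.M))
    (v : Fin g →₀ ℕ) : (weightedPart hη γ j P).coeff v =
      homogeneousPart hη (ρ.semigroup ρ.M) (j - ρ.pair η (Finsupp.weight γ v)) (P.coeff v).1 := by
  classical
  simp only [weightedPart_eq_sum, MvPolynomial.coeff_sum, MvPolynomial.coeff_monomial,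
    Finset.sum_ite_eq', ite_eq_left_iff, MvPolynomial.notMem_support_iff]
  intro h
  rw [h, ZeroMemClass.coe_zero, map_zero]

theorem monomial_mem_weightGrade {j : S} {v : Fin g →₀ ℕ}
    {x : AddMonoidAlgebra ℂ (ρ.semigroup ρ.M)} (hx : x ∈ AddMonoidAlgebra.gradeBy ℂ
      (fun α : ρ.semigroup ρ.M => ρ.pair η α) (j - ρ.pair η (Finsupp.weight γ v))) :
    MvPolynomial.monomial v x ∈ ρ.weightGrade γ η S j := by
  refine (Submodule.span_le (p := (ρ.weightGrade γ η S j).comap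
    ((MvPolynomial.monomial v).restrictScalars ℂ))).2 ?_
    ((AddMonoidAlgebra.supported_eq_span_single ℂ _).le hx)
  rintro _ ⟨α, hα, rfl⟩
  refine Submodule.subset_span ⟨α, v, ?_, rfl⟩
  rw [← Finsupp.weight_eq_sum, map_add]
  exact eq_sub_iff_add_eq.1 hα

theorem weightedPart_mem_weightGrade (j : S) (P : MvPolynomial (Fin g) (ρ.conv ρ.M)) :
    weightedPart hη γ j P ∈ ρ.weightGrade γ η S j := by
  rw [weightedPart_eq_sum]
  exact Submodule.sum_mem _ fun v _ => monomial_mem_weightGrade (homogeneousPart_mem_gradeBy hη)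

theorem weightedPart_eq_zero_of_lt {i k : S} (hik : i < k)
    {P : MvPolynomial (Fin g) (ρ.conv ρ.M)} (hP : P ∈ (ρ.weightFilt γ η S).F k) :
    weightedPart hη γ i P = 0 := by
  ext1 v
  rw [coeff_weightedPart, homogeneousPart_eq_zero_of_lt, MvPolynomial.coeff_zero]
  exact fun α hα =>
    (sub_lt_sub_right (Subtype.coe_lt_coe.2 hik) _).trans_le (mem_weightFilt.1 hP v α hα)

theorem weightedPart_one (γ : Fin g → ρ.Expo) : weightedPart hη γ 0 1 = 1 := by
  classical
  ext1 v
  rw [coeff_weightedPart, MvPolynomial.coeff_one, MvPolynomial.coeff_one]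
  split_ifs with h
  · rw [← h, map_zero, map_zero, sub_zero]
    exact homogeneousPart_one hη _
  · exact map_zero _

theorem weightedPart_mul {i j : S} {P Q : MvPolynomial (Fin g) (ρ.conv ρ.M)}
    (hP : P ∈ (ρ.weightFilt γ η S).F i) (hQ : Q ∈ (ρ.weightFilt γ η S).F j) :
    weightedPart hη γ (i + j) (P * Q) = weightedPart hη γ i P * weightedPart hη γ j Q := by
  ext1 v
  rw [coeff_weightedPart, MvPolynomial.coeff_mul, MvPolynomial.coeff_mul]
  refine (congrArg _ (AddSubmonoidClass.coe_finsetSum _ _)).trans ((map_sum _ _ _).trans ?_)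
  refine Finset.sum_congr rfl fun x hx => ?_
  rw [coeff_weightedPart, coeff_weightedPart, ← Finset.HasAntidiagonal.mem_antidiagonal.1 hx,
    map_add, map_add, add_sub_add_comm]
  exact homogeneousPart_mul hη (mem_weightFilt.1 hP _) (mem_weightFilt.1 hQ _)
    (fun α hα _ => (P.coeff x.1).2.1 α hα) (fun α hα _ => (Q.coeff x.2).2.1 α hα)

theorem weightedPart_monomial {α : ρ.Expo} (hα : α ∈ ρ.semigroup ρ.M) (v : Fin g →₀ ℕ) :
    weightedPart hη γ (ρ.pair η (α + Finsupp.weight γ v))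
      (MvPolynomial.monomial v ⟨HahnSeries.single α 1, single_mem_conv hα 1⟩) =
        MvPolynomial.monomial v (AddMonoidAlgebra.single ⟨α, hα⟩ 1) := by
  classical
  ext1 v'
  rw [coeff_weightedPart, MvPolynomial.coeff_monomial, MvPolynomial.coeff_monomial]
  split_ifs with h
  · rw [← h, map_add, add_sub_cancel_right, homogeneousPart_of_mem_lowerBounds hη _ hα,
      HahnSeries.coeff_single_same]
    exact fun u hu => (HahnSeries.support_single_subset hu).ge
  · exact map_zero _

theorem monomial_mem_weightFilt {α : ρ.Expo} (hα : α ∈ ρ.semigroup ρ.M) {v : Fin g →₀ ℕ} {i : S}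
    (h : ρ.pair η (α + Finsupp.weight γ v) = i) :
    MvPolynomial.monomial v ⟨HahnSeries.single α 1, single_mem_conv hα 1⟩ ∈
      (ρ.weightFilt γ η S).F i := by
  classical
  refine mem_weightFilt.2 fun v' β hβ => ?_
  rw [MvPolynomial.coeff_monomial] at hβ
  split_ifs at hβ with hv
  · rw [← hv, Set.mem_singleton_iff.1 (HahnSeries.support_single_subset hβ), ← h, map_add,
      add_sub_cancel_right]
  · exact absurd rfl hβ

theorem weightedPart_ne_zero {P : MvPolynomial (Fin g) (ρ.conv ρ.M)} {v : Fin g →₀ ℕ} {a : ρ.Expo}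
    (ha : a ∈ (P.coeff v).1.support) :
    weightedPart hη γ (ρ.pair η (a + Finsupp.weight γ v)) P ≠ 0 := by
  intro h
  have hmem : (⟨a, (P.coeff v).2.1 a ha⟩ : ρ.semigroup ρ.M) ∈
      ((weightedPart hη γ (ρ.pair η (a + Finsupp.weight γ v)) P).coeff v).coeff.support := by
    rw [coeff_weightedPart, mem_support_homogeneousPart, map_add, add_sub_cancel_right]
    exact ⟨rfl, ha⟩
  rw [h] at hmem
  exact Finsupp.notMem_support_iff.2 rfl hmem

/-- The initial forms of the elements of `ℂ{ρ^∨ ∩ M}[U_1, …, U_g]` for the weighted filtration. -/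
def initialFormsOfWeight
    (hS : ∀ α ∈ ρ.semigroup ρ.M, ∀ v : Fin g →₀ ℕ, ρ.pair η (α + Finsupp.weight γ v) ∈ S) :
    Filt.InitialForms (ρ.weightFilt γ η S) (ρ.weightGrade γ η S) where
  ini i := weightedPart hη γ i
  ini_of_lt hik _ hP := weightedPart_eq_zero_of_lt hη hik hP
  exists_ini_ne_zero {P} hP := by
    obtain ⟨v, a, ha, hmin⟩ := exists_mem_support_coeff_isMin hη.monotone γ hP
    refine ⟨⟨_, hS a ((P.coeff v).2.1 a ha) v⟩, mem_weightFilt.2 fun v' b hb => ?_,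
      weightedPart_ne_zero hη ha⟩
    rw [sub_le_iff_le_add, ← map_add]
    exact hmin v' b hb
  ini_one := weightedPart_one hη γ
  ini_mul _ hP _ hQ := weightedPart_mul hη hP hQ
  map_eq i := by
    refine le_antisymm ?_ (Submodule.span_le.2 ?_)
    · rintro _ ⟨P, -, rfl⟩
      exact weightedPart_mem_weightGrade hη i P
    · rintro _ ⟨α, v, h, rfl⟩
      rw [← Finsupp.weight_eq_sum] at h
      exact ⟨_, monomial_mem_weightFilt α.2 h, h ▸ weightedPart_monomial hη α.2 v⟩
  isInternal := isInternal_weightGrade hS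

end WeightGrade

end ToricCone

namespace Branch

open ToricCone

variable {d : ℕ} {ρ : ToricCone d} (Z : Branch ρ)

/-! ### The homomorphism `Ψ₀` and initial forms -/

theorem conv_M_le_R : ρ.conv ρ.M ≤ Z.R := fun x hx =>
  Subalgebra.algebraMap_mem (Algebra.adjoin (ρ.conv ρ.M) {Z.ζ}) ⟨x, hx⟩

theorem R_le_bigRing : Z.R ≤ Z.bigRing := by
  intro x hx
  obtain ⟨P, rfl⟩ : x ∈ (aeval (R := ρ.conv ρ.M) Z.ζ).range :=
    Algebra.adjoin_singleton_eq_range_aeval (ρ.conv ρ.M) Z.ζ ▸ hx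
  change aeval Z.ζ P ∈ Z.bigRing
  rw [aeval_eq_sum_range]
  refine sum_mem fun i _ => ?_
  rw [Algebra.smul_def]
  exact mul_mem (conv_mono (Z.M_le_lattice _) (P.coeff i).2) (pow_mem Z.ζ_mem_bigRing i)

/-- The value `∏ q_{i-1}(ζ)^{v_i}` at the semi-roots of the monomial `U^v`. -/
def semiRootMonomial (q : Fin Z.g → ρ.Poly) (v : Fin Z.g →₀ ℕ) : ρ.Series :=
  ∏ i, aeval Z.ζ (q i) ^ v i

variable {Z} {q : Fin Z.g → ρ.Poly}

theorem semiRootMonomial_mem_R (v : Fin Z.g →₀ ℕ) : Z.semiRootMonomial q v ∈ Z.R :=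
  prod_mem fun i _ => pow_mem (aeval_mem_adjoin_singleton (ρ.conv ρ.M) Z.ζ : _ ∈ Z.R) (v i)

theorem weight_gamma_mem_lowerBounds_support_semiRootMonomial (hq : ∀ j, Z.IsSemiRoot j (q j))
    (v : Fin Z.g →₀ ℕ) :
    Finsupp.weight Z.gamma v ∈ lowerBounds (Z.semiRootMonomial q v).support := by
  rw [Finsupp.weight_eq_sum]
  exact sum_mem_lowerBounds_support_prod fun i _ =>
    nsmul_mem_lowerBounds_support_pow (hq i).isLeast_support_aeval.2 (v i)

theorem coeff_semiRootMonomial_weight_gamma (hq : ∀ j, Z.IsSemiRoot j (q j))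
    (hnorm : ∀ j, (aeval Z.ζ (q j)).coeff (Z.gamma j) = 1) (v : Fin Z.g →₀ ℕ) :
    (Z.semiRootMonomial q v).coeff (Finsupp.weight Z.gamma v) = 1 := by
  rw [Finsupp.weight_eq_sum, semiRootMonomial, coeff_prod_sum_of_mem_lowerBounds fun i _ =>
    nsmul_mem_lowerBounds_support_pow (hq i).isLeast_support_aeval.2 (v i)]
  refine Finset.prod_eq_one fun i _ => ?_
  rw [coeff_pow_nsmul_of_mem_lowerBounds (hq i).isLeast_support_aeval.2, hnorm, one_pow]

theorem coe_Psi (P : MvPolynomial (Fin Z.g) (ρ.conv ρ.M)) :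
    (Z.Psi q P : ρ.Series) = ∑ v ∈ P.support, (P.coeff v).1 * Z.semiRootMonomial q v :=
  MvPolynomial.eval₂_eq' _ _ P

theorem exists_add_eq_of_mem_support_Psi (hq : ∀ j, Z.IsSemiRoot j (q j))
    {P : MvPolynomial (Fin Z.g) (ρ.conv ρ.M)} {u : ρ.Expo}
    (hu : u ∈ (Z.Psi q P : ρ.Series).support) :
    ∃ v, ∃ a ∈ (P.coeff v).1.support, ∃ b, Finsupp.weight Z.gamma v ≤ b ∧ a + b = u := by
  rw [HahnSeries.mem_support, coe_Psi, HahnSeries.coeff_sum] at hu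
  obtain ⟨v, -, hv⟩ := Finset.exists_ne_zero_of_sum_ne_zero hu
  obtain ⟨a, ha, b, hb, hab⟩ := HahnSeries.support_mul_subset hv
  exact ⟨v, a, ha, b, weight_gamma_mem_lowerBounds_support_semiRootMonomial hq v hb, hab⟩

theorem isFiltered_Psi {η : Fin d → ℝ} (hη : Monotone (ρ.pair η))
    (hq : ∀ j, Z.IsSemiRoot j (q j)) : Filt.IsFiltered (Z.filtU η) (Z.filtR η) (Z.Psi q) := by
  intro i P hP u hu
  obtain ⟨v, a, ha, b, hb, rfl⟩ := exists_add_eq_of_mem_support_Psi hq hu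
  rw [map_add]
  exact (sub_le_iff_le_add.1 (mem_weightFilt.1 hP v a ha)).trans (by gcongr; exact hη hb)

theorem monomialMap_monomial (v : Fin Z.g →₀ ℕ) (x : AddMonoidAlgebra ℂ (ρ.semigroup ρ.M)) :
    Z.monomialMap (MvPolynomial.monomial v x) =
      AddMonoidAlgebra.mapDomainAlgHom ℂ ℂ (AddSubmonoid.inclusion Z.semigroup_M_le_Gam) x *
        AddMonoidAlgebra.single ⟨Finsupp.weight Z.gamma v, Z.weight_gamma_mem_Gam v⟩ 1 := by
  have hsum : ∑ i, v i • (⟨Z.gamma i, Z.gamma_mem_Gam i⟩ : Z.Gam) =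
      ⟨Finsupp.weight Z.gamma v, Z.weight_gamma_mem_Gam v⟩ := by
    refine Subtype.ext ((AddSubmonoidClass.coe_finsetSum _ _).trans ?_)
    exact (Finsupp.weight_eq_sum Z.gamma v).symm
  rw [MvPolynomial.monomial_eq, map_mul, Finsupp.prod_fintype _ _ fun i => pow_zero _, map_prod,
    ← hsum]
  congr 1
  · exact MvPolynomial.aevalTower_C _ _ x
  · simp only [map_pow, monomialMap, MvPolynomial.aevalTower_X, AddMonoidAlgebra.single_pow,
      one_pow, AddMonoidAlgebra.prod_single, Finset.prod_const_one]

theorem coeff_monomialMap {P : MvPolynomial (Fin Z.g) (AddMonoidAlgebra ℂ (ρ.semigroup ρ.M))}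
    (hP : P ∈ MvPolynomial.restrictSupport _ {v : Fin Z.g →₀ ℕ | ∀ k, v k < Z.charInt k})
    {v : Fin Z.g →₀ ℕ} (hv : ∀ k, v k < Z.charInt k) (α : ρ.semigroup ρ.M) :
    (Z.monomialMap P).coeff ⟨α + Finsupp.weight Z.gamma v, Z.add_weight_mem_Gam α.2 v⟩ =
      (P.coeff v).coeff α := by
  classical
  have hα : (⟨α + Finsupp.weight Z.gamma v, Z.add_weight_mem_Gam α.2 v⟩ : Z.Gam) =
      AddSubmonoid.inclusion Z.semigroup_M_le_Gam α +
        ⟨Finsupp.weight Z.gamma v, Z.weight_gamma_mem_Gam v⟩ := rfl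
  conv_lhs => rw [P.as_sum, map_sum]
  simp only [monomialMap_monomial, AddMonoidAlgebra.coeff_sum, Finsupp.finsetSum_apply]
  rw [Finset.sum_eq_single v, hα, AddMonoidAlgebra.coeff_mul_single_add, mul_one]
  · exact Finsupp.mapDomain_apply (AddSubmonoid.inclusion_injective _) _ _
  · intro v' hv' hne
    by_contra hcoeff
    obtain ⟨β', hβ', hβ⟩ := Finset.mem_image.1 (AddMonoidAlgebra.support_coeff_mul_single_subset
      _ _ _ (Finsupp.mem_support_iff.2 hcoeff))
    obtain ⟨β, -, rfl⟩ := Finset.mem_image.1 (Finsupp.mapDomain_support hβ')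
    exact hne (Z.eq_of_add_weight_eq (hP hv') hv β.2.2 α.2.2 (congrArg Subtype.val hβ))
  · intro h
    rw [MvPolynomial.notMem_support_iff.1 h, map_zero, zero_mul, AddMonoidAlgebra.coeff_zero]
    rfl

theorem injOn_monomialMap : Set.InjOn Z.monomialMap
    (MvPolynomial.restrictSupport (AddMonoidAlgebra ℂ (ρ.semigroup ρ.M))
      {v : Fin Z.g →₀ ℕ | ∀ k, v k < Z.charInt k}) := by
  intro P hP Q hQ h
  refine MvPolynomial.ext _ _ fun v => ?_
  by_cases hv : ∀ k, v k < Z.charInt k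
  · ext α
    rw [← coeff_monomialMap hP hv, h, coeff_monomialMap hQ hv]
  · have hPv : P.coeff v = 0 := MvPolynomial.notMem_support_iff.1 fun h => hv (hP h)
    have hQv : Q.coeff v = 0 := MvPolynomial.notMem_support_iff.1 fun h => hv (hQ h)
    exact hPv.trans hQv.symm

variable {η : Fin d → ℝ} (hη : StrictMono (ρ.pair η))

theorem homogeneousPart_mul_semiRootMonomial (hq : ∀ j, Z.IsSemiRoot j (q j))
    (hnorm : ∀ j, (aeval Z.ζ (q j)).coeff (Z.gamma j) = 1) {x : ρ.Series}
    (hx : ∀ u ∈ x.support, u ∈ ρ.semigroup ρ.M) {i : ℝ} {v : Fin Z.g →₀ ℕ}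
    (hi : ∀ u ∈ x.support, i - ρ.pair η (Finsupp.weight Z.gamma v) ≤ ρ.pair η u) :
    homogeneousPart hη Z.Gam i (x * Z.semiRootMonomial q v) =
      Z.monomialMap (MvPolynomial.monomial v (homogeneousPart hη (ρ.semigroup ρ.M)
        (i - ρ.pair η (Finsupp.weight Z.gamma v)) x)) := by
  have hlead := weight_gamma_mem_lowerBounds_support_semiRootMonomial hq v
  have hlevel (u) (hu : u ∈ (Z.semiRootMonomial q v).support)
      (hpair : ρ.pair η u = ρ.pair η (Finsupp.weight Z.gamma v)) : u ∈ Z.Gam := by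
    obtain rfl : Finsupp.weight Z.gamma v = u :=
      (hlead hu).eq_of_not_lt fun hlt => (hη hlt).ne hpair.symm
    exact Z.weight_gamma_mem_Gam v
  conv_lhs => rw [← sub_add_cancel i (ρ.pair η (Finsupp.weight Z.gamma v))]
  rw [homogeneousPart_mul hη hi (fun u hu => hη.monotone (hlead hu))
    (fun u hu _ => Z.semigroup_M_le_Gam (hx u hu)) hlevel,
    homogeneousPart_of_mem_lowerBounds hη hlead (Z.weight_gamma_mem_Gam v),
    coeff_semiRootMonomial_weight_gamma hq hnorm,
    homogeneousPart_eq_mapDomain hη Z.semigroup_M_le_Gam fun u hu _ => hx u hu,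
    monomialMap_monomial]

theorem homogeneousPart_Psi (hq : ∀ j, Z.IsSemiRoot j (q j))
    (hnorm : ∀ j, (aeval Z.ζ (q j)).coeff (Z.gamma j) = 1) {i : Z.degrees η}
    {P : MvPolynomial (Fin Z.g) (ρ.conv ρ.M)} (hP : P ∈ (Z.filtU η).F i) :
    homogeneousPart hη Z.Gam i (Z.Psi q P : ρ.Series) =
      Z.monomialMap (weightedPart hη Z.gamma i P) := by
  rw [coe_Psi, map_sum, weightedPart_eq_sum, map_sum]
  exact Finset.sum_congr rfl fun v _ => homogeneousPart_mul_semiRootMonomial hη hq hnorm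
    (P.coeff v).2.1 (mem_weightFilt.1 hP v)

theorem pair_add_weight_gamma_mem_degrees (η : Fin d → ℝ) {α : ρ.Expo}
    (hα : α ∈ ρ.semigroup ρ.M) (v : Fin Z.g →₀ ℕ) :
    ρ.pair η (α + Finsupp.weight Z.gamma v) ∈ Z.degrees η :=
  ⟨_, Z.Gam_le_bigSemigroup (Z.add_weight_mem_Gam hα v), rfl⟩

variable (Z) in
/-- Initial forms on `ℂ{ρ^∨ ∩ M}[U_1, …, U_g]`. -/
def initialFormsU : Filt.InitialForms (Z.filtU η) (ρ.weightGrade Z.gamma η (Z.degrees η)) :=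
  initialFormsOfWeight hη fun _ => pair_add_weight_gamma_mem_degrees η

variable (Z) in
/-- Initial forms on `ℂ{ρ^∨ ∩ M_g}`. -/
def initialFormsBig : Filt.InitialForms (Z.filtBig η)
    (ρ.etaGrade η (Z.degrees η) Z.bigSemigroup) :=
  initialFormsOfSubalgebra hη (fun _ hx u hu => ⟨u, hx.1 u hu, rfl⟩) (fun u hu => ⟨u, hu, rfl⟩)
    (fun _ _ hx _ u hu _ => hx.1 u hu) fun u hu => ⟨_, single_mem_conv hu 1,
      fun _ hv => (HahnSeries.support_single_subset hv).ge, HahnSeries.coeff_single_same u 1⟩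

/-- `Ψ₀` is strict on the elements with exponents `v_i < n_i`, as it is injective on their initial
forms. -/
theorem mem_filtU_of_Psi_mem_filtR (hη : StrictMono (ρ.pair η)) (hq : ∀ j, Z.IsSemiRoot j (q j))
    (hnorm : ∀ j, (aeval Z.ζ (q j)).coeff (Z.gamma j) = 1) {i : Z.degrees η}
    {Q : MvPolynomial (Fin Z.g) (ρ.conv ρ.M)}
    (hQ : Q ∈ MvPolynomial.restrictSupport _ {v : Fin Z.g →₀ ℕ | ∀ k, v k < Z.charInt k})
    (h : Z.Psi q Q ∈ (Z.filtR η).F i) : Q ∈ (Z.filtU η).F i := by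
  rcases eq_or_ne Q 0 with rfl | hQ0
  · exact zero_mem _
  obtain ⟨j, hQj, hini⟩ := (Z.initialFormsU hη).exists_ini_ne_zero hQ0
  by_contra hnot
  have hji : j < i := not_le.1 fun hij => hnot ((Z.filtU η).anti hij hQj)
  have hmap : Z.monomialMap (weightedPart hη Z.gamma j Q) = Z.monomialMap 0 := by
    rw [← homogeneousPart_Psi hη hq hnorm hQj, map_zero]
    exact homogeneousPart_eq_zero_of_lt hη fun u hu => lt_of_lt_of_le hji (h u hu)
  refine hini (injOn_monomialMap (fun v hv => hQ ?_) (zero_mem _) hmap)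
  have hcoeff : (weightedPart hη Z.gamma j Q).coeff v ≠ 0 := MvPolynomial.mem_support_iff.1 hv
  refine MvPolynomial.mem_support_iff.2 fun (hQv : Q.coeff v = 0) => hcoeff ?_
  rw [coeff_weightedPart, hQv, ZeroMemClass.coe_zero, map_zero]

theorem mem_Gam_of_mem_support_of_pair_eq (hη : StrictMono (ρ.pair η))
    (hq : ∀ j, Z.IsSemiRoot j (q j)) (hnorm : ∀ j, (aeval Z.ζ (q j)).coeff (Z.gamma j) = 1)
    {i : Z.degrees η} {x : Z.R} (hx : x ∈ (Z.filtR η).F i) {u : ρ.Expo} (hu : u ∈ x.1.support)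
    (hui : ρ.pair η u = i) : u ∈ Z.Gam := by
  obtain ⟨Q, hQ, rfl⟩ := Z.exists_restrictSupport_Psi_eq hq x
  obtain ⟨v, a, ha, b, hb, rfl⟩ := exists_add_eq_of_mem_support_Psi hq hu
  have hQi := mem_weightFilt.1 (mem_filtU_of_Psi_mem_filtR hη hq hnorm hQ hx) v a ha
  have hpair : ρ.pair η b ≤ ρ.pair η (Finsupp.weight Z.gamma v) := by
    rw [map_add] at hui
    linarith
  obtain rfl : Finsupp.weight Z.gamma v = b :=
    hb.eq_of_not_lt fun hlt => (hη hlt).not_ge hpair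
  exact Z.add_weight_mem_Gam ((Q.coeff v).2.1 a ha) v

theorem homogeneousPart_eq_mapDomain_of_mem_filtR (hq : ∀ j, Z.IsSemiRoot j (q j))
    (hnorm : ∀ j, (aeval Z.ζ (q j)).coeff (Z.gamma j) = 1) {i : Z.degrees η} {x : Z.R}
    (hx : x ∈ (Z.filtR η).F i) :
    homogeneousPart hη Z.bigSemigroup i x.1 = AddMonoidAlgebra.mapDomainAlgHom ℂ ℂ
      (AddSubmonoid.inclusion Z.Gam_le_bigSemigroup) (homogeneousPart hη Z.Gam i x.1) :=
  homogeneousPart_eq_mapDomain hη Z.Gam_le_bigSemigroup fun _ =>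
    mem_Gam_of_mem_support_of_pair_eq hη hq hnorm hx

theorem exists_mem_R_coeff_eq_one (hq : ∀ j, Z.IsSemiRoot j (q j))
    (hnorm : ∀ j, (aeval Z.ζ (q j)).coeff (Z.gamma j) = 1) {u : ρ.Expo} (hu : u ∈ Z.Gam) :
    ∃ x ∈ Z.R, u ∈ lowerBounds x.support ∧ x.coeff u = 1 := by
  obtain ⟨α, hα, v, rfl⟩ := Z.mem_Gam_iff.1 hu
  have hlead := weight_gamma_mem_lowerBounds_support_semiRootMonomial hq v
  have hsingle : α ∈ lowerBounds (HahnSeries.single α (1 : ℂ)).support :=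
    fun _ hv => (HahnSeries.support_single_subset hv).ge
  refine ⟨HahnSeries.single α 1 * Z.semiRootMonomial q v,
    mul_mem (Z.conv_M_le_R (single_mem_conv hα 1)) (semiRootMonomial_mem_R v),
    add_mem_lowerBounds_support_mul hsingle hlead, ?_⟩
  rw [coeff_mul_add_of_mem_lowerBounds hsingle hlead, HahnSeries.coeff_single_same, one_mul,
    coeff_semiRootMonomial_weight_gamma hq hnorm]

/-- Initial forms on `R`. -/
def initialFormsR (hq : ∀ j, Z.IsSemiRoot j (q j))
    (hnorm : ∀ j, (aeval Z.ζ (q j)).coeff (Z.gamma j) = 1) :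
    Filt.InitialForms (Z.filtR η) (ρ.etaGrade η (Z.degrees η) Z.Gam) :=
  initialFormsOfSubalgebra hη (fun _ hx u hu => ⟨u, (Z.R_le_bigRing hx).1 u hu, rfl⟩)
    (fun u hu => ⟨u, Z.Gam_le_bigSemigroup hu, rfl⟩)
    (fun _ x hx hi _ => mem_Gam_of_mem_support_of_pair_eq hη hq hnorm (x := ⟨x, hx⟩) hi)
    fun _ => exists_mem_R_coeff_eq_one hq hnorm

end Branch

/-! ### Irrational weights -/

namespace ToricCone

variable {d : ℕ} {ρ : ToricCone d} {η : Fin d → ℝ}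

theorem injOn_pair_fracM (hη : LinearIndependent ℚ η) {k : ℕ} (hk : 0 < k) :
    Set.InjOn (ρ.pair η) (ρ.fracM k) := by
  intro u hu v hv huv
  obtain ⟨m, hm⟩ := (mem_fracM_iff_mem_range_fracPoint hk).1 (sub_mem hu hv)
  have hpair : (∑ i, η i * m i) / k = 0 := by
    rw [← ρ.pair_fracPoint, hm, map_sub, huv, sub_self]
  have hrel : ∑ i, (m i : ℚ) • η i = 0 := by
    rw [← (div_eq_zero_iff.1 hpair).resolve_right (by positivity)]
    exact Finset.sum_congr rfl fun i _ => by rw [Rat.smul_def, Rat.cast_intCast, mul_comm]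
  have hm0 : m = 0 := funext fun i => by exact_mod_cast Fintype.linearIndependent_iff.1 hη _ hrel i
  rw [← sub_eq_zero, ← hm, hm0, map_zero]

theorem rank_etaGrade_eq_one {S : AddSubmonoid ℝ} {Λ : AddSubmonoid ρ.Expo}
    (hinj : Set.InjOn (ρ.pair η) Λ) {j : S} (hj : ∃ u ∈ Λ, ρ.pair η u = j) :
    Module.rank ℂ (ρ.etaGrade η S Λ j) = 1 := by
  have := nontrivial_etaGrade_iff.2 hj
  exact (rank_etaGrade_le_one hinj j).antisymm (Cardinal.one_le_iff_pos.2 rank_pos)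

end ToricCone

namespace Branch

open ToricCone

variable {d : ℕ} {ρ : ToricCone d} {Z : Branch ρ} {q : Fin Z.g → ρ.Poly} {η : Fin d → ℝ}

theorem injOn_pair_bigSemigroup (hη : LinearIndependent ℚ η) :
    Set.InjOn (ρ.pair η) Z.bigSemigroup :=
  (injOn_pair_fracM hη Z.natDegree_pos).mono fun _ hu => Z.lattice_le_fracM _ hu.2

theorem nontrivial_piece_filtR_iff (hη : StrictMono (ρ.pair η)) (hq : ∀ j, Z.IsSemiRoot j (q j))
    (hnorm : ∀ j, (aeval Z.ζ (q j)).coeff (Z.gamma j) = 1) {j : Z.degrees η} :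
    Nontrivial ((Z.filtR η).Piece j) ↔ ∃ u ∈ Z.Gam, ρ.pair η u = j :=
  ((initialFormsR hη hq hnorm).pieceEquiv j).toEquiv.nontrivial_congr.trans nontrivial_etaGrade_iff

variable (Z) in
/-- The grading of `Γ` by `η`, with values in the monoid of degrees of `ρ^∨ ∩ M_g`. -/
def degGam (η : Fin d → ℝ) : Z.Gam →+ Z.degrees η :=
  ((ρ.pair η).comp Z.Gam.subtype).codRestrict (Z.degrees η) fun u =>
    ⟨u, Z.Gam_le_bigSemigroup u.2, rfl⟩

theorem mem_mrange_degGam {j : Z.degrees η} :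
    j ∈ AddMonoidHom.mrange (Z.degGam η) ↔ ∃ u ∈ Z.Gam, ρ.pair η u = j :=
  ⟨fun ⟨u, hu⟩ => ⟨u, u.2, congrArg Subtype.val hu⟩, fun ⟨u, hu, h⟩ => ⟨⟨u, hu⟩, Subtype.ext h⟩⟩

theorem injective_degGam (hη : Set.InjOn (ρ.pair η) Z.bigSemigroup) : Injective (Z.degGam η) :=
  fun u v h => Subtype.ext (hη (Z.Gam_le_bigSemigroup u.2) (Z.Gam_le_bigSemigroup v.2)
    (congrArg Subtype.val h))

theorem exists_addEquiv_Gam_of_injOn (hη : Set.InjOn (ρ.pair η) Z.bigSemigroup) :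
    ∃ e : Z.Gam ≃+ AddMonoidHom.mrange (Z.degGam η),
      ∀ u, ((e u : Z.degrees η) : ℝ) = ρ.pair η u :=
  ⟨AddEquiv.ofBijective (Z.degGam η).mrangeRestrict
    ⟨fun _ _ h => injective_degGam hη (congrArg Subtype.val h),
      AddMonoidHom.mrangeRestrict_surjective _⟩, fun _ => rfl⟩

theorem mem_Gam_iff_exists_pair_eq (hη : Set.InjOn (ρ.pair η) Z.bigSemigroup)
    (u : Z.bigSemigroup) : (u : ρ.Expo) ∈ Z.Gam ↔ ∃ v ∈ Z.Gam, ρ.pair η v = Z.deg η u :=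
  ⟨fun hu => ⟨u, hu, rfl⟩, fun ⟨_, hv, h⟩ => hη (Z.Gam_le_bigSemigroup hv) u.2 h ▸ hv⟩

end Branch

end ToricQO

end

theorem mainTheorem7 {d : ℕ} (ρ : ToricQO.ToricCone d) (Z : ToricQO.Branch ρ)
    (q : Fin Z.g → ρ.Poly) (hq : ∀ j, Z.IsSemiRoot j (q j))
    (hnorm : ∀ j, (Polynomial.aeval Z.ζ (q j)).coeff (Z.gamma j) = 1)
    (η : Fin d → ℝ) (hη : η ∈ interior (ρ.cone : Set (Fin d → ℝ))) :
    ∃ (hR : Z.R ≤ Z.bigRing) (hΓ : Z.Gam ≤ Z.bigSemigroup)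
      (hΨ : ToricQO.Filt.IsFiltered (Z.filtU η) (Z.filtR η) (Z.Psi q))
      (hι : ToricQO.Filt.IsFiltered (Z.filtR η) (Z.filtBig η) (Subalgebra.inclusion hR)),
      (∃ (e₁ : (Z.filtU η).Gr ≃ₐ[ℂ]
            MvPolynomial (Fin Z.g) (AddMonoidAlgebra ℂ (ρ.semigroup ρ.M)))
          (e₂ : (Z.filtR η).Gr ≃ₐ[ℂ] AddMonoidAlgebra ℂ Z.Gam)
          (e₃ : (Z.filtBig η).Gr ≃ₐ[ℂ] AddMonoidAlgebra ℂ Z.bigSemigroup),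
        (Z.filtU η).IsGradedEquiv (ρ.weightGrade Z.gamma η (Z.degrees η)) e₁ ∧
        (Z.filtR η).IsGradedEquiv (ρ.etaGrade η (Z.degrees η) Z.Gam) e₂ ∧
        (Z.filtBig η).IsGradedEquiv (ρ.etaGrade η (Z.degrees η) Z.bigSemigroup) e₃ ∧
        (e₂ : (Z.filtR η).Gr →ₐ[ℂ] AddMonoidAlgebra ℂ Z.Gam).comp
            (ToricQO.Filt.grMap (Z.filtU η) (Z.filtR η) (Z.Psi q) hΨ) =
          Z.monomialMap.comp (e₁ : (Z.filtU η).Gr →ₐ[ℂ] _) ∧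
        (e₃ : (Z.filtBig η).Gr →ₐ[ℂ] AddMonoidAlgebra ℂ Z.bigSemigroup).comp
            (ToricQO.Filt.grMap (Z.filtR η) (Z.filtBig η) (Subalgebra.inclusion hR) hι) =
          (AddMonoidAlgebra.mapDomainAlgHom ℂ ℂ (AddSubmonoid.inclusion hΓ)).comp
            (e₂ : (Z.filtR η).Gr →ₐ[ℂ] _)) ∧
      (LinearIndependent ℚ η →
        (∀ j, Module.rank ℂ ((Z.filtBig η).Piece j) = 1) ∧
        (∀ j, Module.rank ℂ ((Z.filtR η).Piece j) ≤ 1) ∧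
        Function.Injective (Z.deg η) ∧
        (∀ u : Z.bigSemigroup, (u : ρ.Expo) ∈ Z.Gam ↔ Nontrivial ((Z.filtR η).Piece (Z.deg η u))) ∧
        ∃ D : AddSubmonoid (Z.degrees η), (∀ j, j ∈ D ↔ Nontrivial ((Z.filtR η).Piece j)) ∧
          ∃ e : Z.Gam ≃+ D, ∀ u, ((e u : Z.degrees η) : ℝ) = ρ.pair η u) := by
  have hstrict := ToricQO.ToricCone.pair_strictMono hη
  let I₁ := Z.initialFormsU hstrict
  let I₂ := ToricQO.Branch.initialFormsR hstrict hq hnorm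
  let I₃ := Z.initialFormsBig hstrict
  refine ⟨Z.R_le_bigRing, Z.Gam_le_bigSemigroup,
    ToricQO.Branch.isFiltered_Psi hstrict.monotone hq, fun _ _ hx => hx,
    ⟨I₁.grEquiv, I₂.grEquiv, I₃.grEquiv,
      I₁.isGradedEquiv_grEquiv, I₂.isGradedEquiv_grEquiv, I₃.isGradedEquiv_grEquiv,
      I₁.grEquiv_comp_grMap I₂ _ _ _ fun _ _ hP =>
        ToricQO.Branch.homogeneousPart_Psi hstrict hq hnorm hP,
      I₂.grEquiv_comp_grMap I₃ _ _ _ fun _ _ hx =>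
        ToricQO.Branch.homogeneousPart_eq_mapDomain_of_mem_filtR hstrict hq hnorm hx⟩,
    fun hirr => ?_⟩
  have hinj := ToricQO.Branch.injOn_pair_bigSemigroup (Z := Z) hirr
  have hpiece (j) := ToricQO.Branch.nontrivial_piece_filtR_iff hstrict hq hnorm (j := j)
  exact ⟨fun j => (I₃.pieceEquiv j).rank_eq.trans
      (ToricQO.ToricCone.rank_etaGrade_eq_one hinj j.2),
    fun j => (I₂.pieceEquiv j).rank_eq.trans_le
      (ToricQO.ToricCone.rank_etaGrade_le_one (hinj.mono Z.Gam_le_bigSemigroup) j),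
    fun u v h => Subtype.ext (hinj u.2 v.2 (congrArg Subtype.val h)),
    fun u => (ToricQO.Branch.mem_Gam_iff_exists_pair_eq hinj u).trans (hpiece _).symm,
    AddMonoidHom.mrange (Z.degGam η),
    fun j => ToricQO.Branch.mem_mrange_degGam.trans (hpiece j).symm,
    ToricQO.Branch.exists_addEquiv_Gam_of_injOn hinj⟩
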